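/- **Theorem 1.1.** For $s>1$ let $\zeta_s=\sum_{m\ge1}m^{-s}$. For $\alpha\in(1,3)$ let $$c_\alpha=\sqrt{\alpha(\alpha+1)\zeta_\alpha},\quad \kappa_1=2c_\alpha,\quad \kappa_2=\alpha(\alpha+1)(\alpha+2)\zeta_\alpha,\quad \kappa_3=\alpha(\alpha+1)\int_0^\infty\frac{1-\operatorname{sinc}^2(s/2)}{s^\alpha}\,ds,$$ where $\operatorname{sinc}s=\sin(s)/s$, and $$\gamma_\alpha=\begin{cases}2\alpha-5/2,&\alpha\in(1,2],\\ 3/2,&\alpha\in(2,3).\end{cases}$$ Write $\hat f(k)=(2\pi)^{-1}\int_{\mathbf R}f(X)e^{-ikX}\,dX$ (in the sense of Plancherel for $f\in L^2$), $\|f\|_{H^s}^2=\int_{\mathbf R}(1+k^2)^s|\hat f(k)|^2\,dk$, and let $H|D|^\alpha$ be the Fourier multiplier $\widehat{H|D|^\alpha f}(k)=-i\,\operatorname{sgn}(k)|k|^\alpha\hat f(k)$. The generalized Benjamin–Ono equation for a real function $u(X,\tau)$ is $$\kappa_1\partial_\tau u+\kappa_2u\,\partial_Xu+\kappa_3H|D|^\alpha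 u=0,\tag{BO}$$ and the generalized Calogero–Moser system for real $x_j(t)$, $j\in\mathbf Z$, is $$\ddot x_j=-\alpha\sum_{m\ge1}\left[\frac1{(x_{j+m}-x_j)^{\alpha+1}}-\frac1{(x_j-x_{j-m})^{\alpha+1}}\right].\tag{CM}$$ A solution of (CM) on a time interval is understood to be ordered ($x_j(t)<x_{j+1}(t)$ for all $j$ and $t$) and such that the relative displacements $r_j=x_{j+1}-x_j-1$ and the velocities $p_j=\dot x_j$ form a $C^1$ curve $t\mapsto(r(t),p(t))$ in $\ell^2(\mathbf Z)\times\ell^2(\mathbf Z)$. There exists $\alpha_*\in(1.45,1.5)$ such that the following holds for every $\alpha\in(\alpha_*,3)$. Suppose that, for some $\tau_0>0$, $u$ is a (classical) solution of (BO) for $|\tau|\le\tau_0$ with $\sup_{|\tau|\le\tau_0}\|u(\cdot,\tau)\|_{H^6}<\infty$. Then there exist $C_1,C_2,\epsilon_*>0$ such that the following holds for every $\epsilon\in(0,\epsilon_*]$. If the initial data $(x_j(0),\dot x_j(0))_{j\in\mathbf Z}$ satisfy $$x_{j+1}(0)-x_j(0)-1=-\epsilon^{\alpha-1}u(\epsilon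 j,0)+\bar\mu_j,\qquad \dot x_j(0)=c_\alpha\epsilon^{\alpha-1}u(\epsilon j,0)+\bar\nu_j,$$ with $\|\bar\mu\|_{\ell^2}\le C_1\epsilon^{\gamma_\alpha}$ and $\|\bar\nu\|_{\ell^2}\le C_1\epsilon^{\gamma_\alpha}$, then (CM) has exactly one solution with these initial data on the time interval $|t|\le\tau_0/\epsilon^\alpha$, and it satisfies $$r_j(t)=x_{j+1}(t)-x_j(t)-1=-\epsilon^{\alpha-1}u(\epsilon(j-c_\alpha t),\epsilon^\alpha t)+\mu_j(t),\qquad p_j(t)=\dot x_j(t)=c_\alpha\epsilon^{\alpha-1}u(\epsilon(j-c_\alpha t),\epsilon^\alpha t)+\nu_j(t),$$ where $$\sup_{|t|\le\tau_0/\epsilon^\alpha}\|\mu(t)\|_{\ell^2}\le C_2\epsilon^{\gamma_\alpha}\quad\text{and}\quad\sup_{|t|\le\tau_0/\epsilon^\alpha}\|\nu(t)\|_{\ell^2}\le C_2\epsilon^{\gamma_\alpha}.$$ -/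

import Mathlib

open MeasureTheory Set FourierTransform

noncomputable section

/-! ### Constants -/

/-- `ζ_s = ∑_{m ≥ 1} 1 / m ^ s` (used for `s > 1`). -/
def zetaSum (s : ℝ) : ℝ := ∑' m : ℕ, 1 / ((m : ℝ) + 1) ^ s

/-- The wave speed `c_α`. -/
def cSpeed (α : ℝ) : ℝ := Real.sqrt (α * (α + 1) * zetaSum α)

def kappa₁ (α : ℝ) : ℝ := 2 * cSpeed α

def kappa₂ (α : ℝ) : ℝ := α * (α + 1) * (α + 2) * zetaSum α

/-- `Real.sinc s = sin s / s`. -/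
def kappa₃ (α : ℝ) : ℝ :=
  α * (α + 1) * ∫ s in Ioi (0 : ℝ), (1 - Real.sinc (s / 2) ^ 2) / s ^ α

/-- The exponent of the error. -/
def gammaExp (α : ℝ) : ℝ := if α ≤ 2 then 2 * α - 5 / 2 else 3 / 2

/-! ### Fourier transform, Sobolev norms and the dispersive operator -/

open Classical in
/-- The Fourier transform `f̂(k) = (2π)⁻¹ ∫ f(X) e^{-ikX} dX` of a real function `f ∈ L²(ℝ)`, in the
sense of Plancherel. Mathlib's `𝓕` uses the kernel `e^{-2πiξX}`, whence the rescaling `k = 2πξ`.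
(The value is `0` for `f ∉ L²`.) -/
def fourierHat (f : ℝ → ℝ) (k : ℝ) : ℂ :=
  if h : MemLp (fun X => (f X : ℂ)) 2 (volume : Measure ℝ) then
    ((2 * Real.pi)⁻¹ : ℝ) * (𝓕 (h.toLp (fun X => (f X : ℂ))) : Lp ℂ 2 (volume : Measure ℝ))
      (k / (2 * Real.pi))
  else 0

/-- `f ∈ H^s(ℝ)`, for `s ≥ 0`. -/
def MemHs (s : ℝ) (f : ℝ → ℝ) : Prop :=
  MemLp (fun X => (f X : ℂ)) 2 (volume : Measure ℝ) ∧
    Integrable (fun k : ℝ => (1 + k ^ 2) ^ s * ‖fourierHat f k‖ ^ 2)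

/-- The norm of `H^s(ℝ)`. -/
def hsNorm (s : ℝ) (f : ℝ → ℝ) : ℝ :=
  Real.sqrt (∫ k : ℝ, (1 + k ^ 2) ^ s * ‖fourierHat f k‖ ^ 2)

/-- The Fourier transform of `H |D|^α f`, that is `-i sgn(k) |k|^α f̂(k)`. -/
def hilbertDHat (α : ℝ) (f : ℝ → ℝ) (k : ℝ) : ℂ :=
  -Complex.I * (SignType.sign k : ℝ) * ((|k| ^ α : ℝ) : ℂ) * fourierHat f k

/-- `H |D|^α f`, by the inversion formula `∫ ĝ(k) e^{ikX} dk` (for integrable `hilbertDHat α f`). -/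
def hilbertD (α : ℝ) (f : ℝ → ℝ) (X : ℝ) : ℂ :=
  ∫ k : ℝ, hilbertDHat α f k * Complex.exp (Complex.I * (k * X))

/-- `u = u(X, τ)` is a classical solution of
`κ₁ ∂_τ u + κ₂ u ∂_X u + κ₃ H|D|^α u = 0` for `|τ| ≤ τ₀`
(with one-sided time derivatives at `τ = ± τ₀`). -/
def IsBOSolution (α τ₀ : ℝ) (u : ℝ → ℝ → ℝ) : Prop :=
  ∀ τ ∈ Icc (-τ₀) τ₀,
    Integrable (hilbertDHat α (fun Y => u Y τ)) ∧
    ∀ X : ℝ, ∃ uX uτ : ℝ,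
      HasDerivAt (fun Y => u Y τ) uX X ∧
      HasDerivWithinAt (fun σ => u X σ) uτ (Icc (-τ₀) τ₀) τ ∧
      ((kappa₁ α * uτ + kappa₂ α * u X τ * uX : ℝ) : ℂ)
        + kappa₃ α * hilbertD α (fun Y => u Y τ) X = 0

/-! ### The Calogero-Moser lattice -/

/-- Square-summable real sequences indexed by `ℤ`, with the `ℓ²` norm. -/
abbrev EllTwo : Type := lp (fun _ : ℤ => ℝ) 2

/-- The summand with index `m + 1` in the Calogero-Moser force on particle `j`, for the
configuration `q`. -/
def cmTerm (α : ℝ) (q : ℤ → ℝ) (j : ℤ) (m : ℕ) : ℝ :=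
  1 / (q (j + (m + 1)) - q j) ^ (α + 1) - 1 / (q j - q (j - (m + 1))) ^ (α + 1)

/-- `x` solves the Calogero-Moser system for `|t| ≤ T`, with velocities `p`: the particles stay
ordered, the equations of motion hold, and the relative displacements `x_{j+1} - x_j - 1` and the
velocities form a `C¹` curve in `ℓ² × ℓ²`. -/
structure IsCMSolution (α T : ℝ) (x p : ℤ → ℝ → ℝ) : Prop where
  ordered : ∀ t ∈ Icc (-T) T, StrictMono (fun j => x j t)
  velocity : ∀ j, ∀ t ∈ Icc (-T) T, HasDerivWithinAt (x j) (p j t) (Icc (-T) T) t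
  summable_force : ∀ j, ∀ t ∈ Icc (-T) T, Summable (cmTerm α (fun i => x i t) j)
  acceleration : ∀ j, ∀ t ∈ Icc (-T) T,
    HasDerivWithinAt (p j) (-α * ∑' m : ℕ, cmTerm α (fun i => x i t) j m) (Icc (-T) T) t
  regular : ∃ R P : ℝ → EllTwo,
    ContDiffOn ℝ 1 R (Icc (-T) T) ∧ ContDiffOn ℝ 1 P (Icc (-T) T) ∧
    ∀ t ∈ Icc (-T) T, ∀ j, R t j = x (j + 1) t - x j t - 1 ∧ P t j = p j t

end

/-!
# The Benjamin-Ono approximation of the Calogero-Moser lattice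

In the relative displacements `r` and the velocities `p` the lattice equations read `r' = D p`,
`p' = -(J D)† N(J r)`, where `D` is the difference operator on `ℓ²(ℤ)`, the bond strain `J` collects
the averages of `m` consecutive displacements with the weights `m ^ (-α/2)` over all `m ≥ 1`, and `N`
applies the interaction force bond by bond. The force is truncated away from small strains, which
makes it globally Lipschitz and the interaction potential uniformly convex. The theorem then follows
from consistency and stability.

*Consistency.* Let `a = ε ^ (α - 1)`, `X = ε (j - c_α t)` and `τ = ε ^ α t`. The approximate solution
has the displacements `-a ⨍ u` over `[X, X + ε]` and the velocities `c_α a u - a² w`, where the flux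
`w` satisfies `w_X = u_τ` by the Benjamin-Ono equation. With this choice `r' = D p` holds exactly. In
`p'` the averages of `u` over `[X, X + m ε]` enter, which are Fourier multipliers:

* the linear part of the force has the symbol `∑ m ^ (-α) (1 - sinc² (m ε k / 2))`, and the midpoint
  rule compares this Riemann sum with the integral which defines `κ₃`, up to `O((ε k)²)`
  (`exists_dispersion_sum_error`, `exists_linear_dispersion`);
* the quadratic part converges to a multiple of `u u_X` at the rate `ε ^ (α - 1)`
  (`exists_quadratic_interaction`);
* the cubic remainder and the term with `w_τ` are of order `a³ ε`.

The leading terms cancel by the definitions of `c_α`, `κ₁`, `κ₂`, `κ₃` and by the equation for `u`, so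
the residual is `O(ε ^ (α + γ_α))` in `ℓ²` (`exists_residual_bound`, `residual_le`); sampling on a grid
of step `ε` costs the factor `ε ^ (-1/2)`, which the notion `SampleBound` keeps track of. The flux
contains `|D|^(α-1) u`; it is differentiable in time because this fractional derivative is an
absolutely convergent integral of second differences (`integral_rpow_mul_second_difference`). All of
this uses the spectral density of `u` only through its `H^6` bound.

*Stability.* The energy of the error relative to the approximate solution controls the `ℓ²` distance
by convexity, and its growth rate is the strain rate `O(ε ^ α)` of the approximate solution
(`IsForce.stability`). On the time scale `τ₀ / ε ^ α` Gronwall's inequality keeps the error at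
`O(ε ^ γ_α)`.

Since `γ_α > 0`, the strains of the truncated dynamics remain small, the truncation is inactive, and
the solution, which exists by the Picard-Lindelöf theorem, solves the Calogero-Moser system
(`exists_isCMSolution`). Any other solution has its bond lengths bounded away from zero on the compact
time interval, so that it solves the equations with some truncated force as well; this gives uniqueness
(`IsCMSolution.unique`).
-/

noncomputable section

/-! ### Fourier synthesis and Plancherel's theorem -/

/-- The function `X ↦ ∫ v(k) e^{ikX} dk` with spectral density `v`. -/
def fourierSynth (v : ℝ → ℂ) (X : ℝ) : ℂ :=
  ∫ k : ℝ, v k * Complex.exp (Complex.I * (k * X))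

lemma norm_exp_I_mul (k X : ℝ) : ‖Complex.exp (Complex.I * (k * X))‖ = 1 := by
  rw [mul_comm, ← Complex.ofReal_mul, Complex.norm_exp_ofReal_mul_I]

lemma fourierInv_toLp_ae_eq {g : ℝ → ℂ} (h1 : Integrable g)
    (h2 : MemLp g 2 (volume : Measure ℝ)) :
    ((𝓕⁻ (h2.toLp g) : Lp ℂ 2 (volume : Measure ℝ)) : ℝ → ℂ) =ᵐ[volume] 𝓕⁻ g := by
  have hcont : Continuous (𝓕⁻ g) := by
    rw [Real.fourierInv_eq_fourier_comp_neg]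
    simpa using! VectorFourier.fourierIntegral_continuous (L := innerₗ ℝ) Real.continuous_fourierChar
      continuous_inner h1.comp_neg
  have hl : LocallyIntegrable
      ((𝓕⁻ (h2.toLp g) : Lp ℂ 2 (volume : Measure ℝ)) : ℝ → ℂ) volume :=
    (Lp.memLp _).locallyIntegrable (by norm_num)
  apply ae_eq_of_integral_contDiff_smul_eq hl hcont.locallyIntegrable
  intro φ hφ hφc
  have hφ' : ContDiff ℝ (⊤ : ℕ∞) (fun x => (φ x : ℂ)) :=
    Complex.ofRealCLM.contDiff.comp hφ
  have hφc' : HasCompactSupport (fun x => (φ x : ℂ)) := hφc.comp_left (g := fun x : ℝ => (x : ℂ)) rfl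
  set Φ : SchwartzMap ℝ ℂ := hφc'.toSchwartzMap hφ' with hΦ
  have hΦa : ∀ x, Φ x = (φ x : ℂ) := fun x => rfl
  have key := congrArg (fun T => T Φ) (Lp.fourierInv_toTemperedDistribution_eq (h2.toLp g))
  simp only [TemperedDistribution.fourierInv_apply, Lp.toTemperedDistribution_apply] at key
  have e1 : ∫ x, φ x • ((𝓕⁻ (h2.toLp g) : Lp ℂ 2 (volume : Measure ℝ)) : ℝ → ℂ) x
      = ∫ x, Φ x • ((𝓕⁻ (h2.toLp g) : Lp ℂ 2 (volume : Measure ℝ)) : ℝ → ℂ) x := by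
    simp [hΦa]
  rw [e1, ← key]
  have e2 : ∫ x, φ x • 𝓕⁻ g x = ∫ x, Φ x • 𝓕⁻ g x := by simp [hΦa]
  rw [e2]
  have e3 : ∫ x, (𝓕⁻ Φ) x • (h2.toLp g) x = ∫ x, (𝓕⁻ Φ) x • g x := by
    apply integral_congr_ae
    filter_upwards [h2.coeFn_toLp] with x hx
    rw [hx]
  rw [e3]
  have hΦn : Integrable (fun x => Φ (-x)) := Φ.integrable.comp_neg
  have key2 : ∫ ξ, 𝓕 (fun x => Φ (-x)) ξ • g ξ = ∫ x, Φ (-x) • 𝓕 g x := by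
    simpa using! VectorFourier.integral_fourierIntegral_smul_eq_flip (L := innerₗ ℝ)
      Real.continuous_fourierChar continuous_inner hΦn h1
  rw [← integral_neg_eq_self] at key2
  rw [← integral_neg_eq_self]
  have e4 : ∀ x, 𝓕⁻ Φ x = 𝓕 (fun x => Φ (-x)) x := by
    intro x
    rw [SchwartzMap.fourierInv_coe, Real.fourierInv_eq_fourier_comp_neg]
  simp only [e4, Real.fourierInv_eq_fourier_neg] at key2 ⊢
  rw [key2, ← integral_neg_eq_self]
  simp

lemma fourierSynth_eq_fourierInv (v : ℝ → ℂ) :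
    fourierSynth v = 𝓕⁻ (fun ξ => ((2 * Real.pi : ℝ) : ℂ) * v (2 * Real.pi * ξ)) := by
  ext X
  have hpi : (0 : ℝ) < 2 * Real.pi := by positivity
  rw [Real.fourierInv_eq', fourierSynth]
  have := Measure.integral_comp_mul_left
    (fun k : ℝ => v k * Complex.exp (Complex.I * (k * X))) (2 * Real.pi)
  rw [abs_of_pos (inv_pos.2 hpi), eq_inv_smul_iff₀ hpi.ne'] at this
  rw [← this, ← integral_smul]
  congr 1
  ext ξ
  simp only [Complex.real_smul, smul_eq_mul, RCLike.inner_apply, conj_trivial]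
  rw [show Complex.I * (((2 * Real.pi * ξ : ℝ) : ℂ) * X)
    = ((2 * Real.pi * (X * ξ) : ℝ) : ℂ) * Complex.I by push_cast; ring]
  ring

lemma continuous_fourierSynth {v : ℝ → ℂ} (hv : Integrable v) : Continuous (fourierSynth v) := by
  apply continuous_of_dominated (bound := fun k => ‖v k‖)
  · exact fun X => hv.1.mul (by fun_prop : Continuous _).aestronglyMeasurable
  · exact fun X => ae_of_all _ fun k => by simp [norm_exp_I_mul]
  · exact hv.norm
  · exact ae_of_all _ fun k => by fun_prop

lemma integrable_fourierSynth_integrand {v : ℝ → ℂ} (hv : Integrable v) (X : ℝ) :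
    Integrable fun k : ℝ => v k * Complex.exp (Complex.I * (k * X)) := by
  refine hv.mono (hv.1.mul (by fun_prop : Continuous _).aestronglyMeasurable) ?_
  exact ae_of_all _ fun k => by simp [norm_exp_I_mul]

lemma hasDerivAt_fourierSynth {v : ℝ → ℂ} (hv : Integrable v)
    (hv' : Integrable fun k : ℝ => Complex.I * k * v k) (X : ℝ) :
    HasDerivAt (fourierSynth v) (fourierSynth (fun k => Complex.I * k * v k) X) X := by
  refine (hasDerivAt_integral_of_dominated_loc_of_deriv_le (μ := volume) (s := univ)
    (F := fun (X : ℝ) (k : ℝ) => v k * Complex.exp (Complex.I * (k * X)))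
    (F' := fun (X : ℝ) (k : ℝ) => Complex.I * k * v k * Complex.exp (Complex.I * (k * X)))
    (bound := fun k : ℝ => ‖Complex.I * k * v k‖) Filter.univ_mem
    (.of_forall fun Y => (integrable_fourierSynth_integrand hv Y).1)
    (integrable_fourierSynth_integrand hv X)
    (integrable_fourierSynth_integrand hv' X).1 ?_ hv'.norm ?_).2
  · exact ae_of_all _ fun k Y _ => by rw [norm_mul _ (Complex.exp _), norm_exp_I_mul, mul_one]
  · refine ae_of_all _ fun k Y _ => ?_
    have h1 : HasDerivAt (fun Y : ℝ => Complex.I * ((k : ℂ) * (Y : ℂ))) (Complex.I * ((k : ℂ) * 1)) Y :=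
      ((Complex.ofRealCLM.hasDerivAt (x := Y)).const_mul (k : ℂ)).const_mul Complex.I
    have h2 := h1.cexp.const_mul (v k)
    rwa [show v k * (Complex.exp (Complex.I * (k * Y)) * (Complex.I * (k * 1)))
      = Complex.I * k * v k * Complex.exp (Complex.I * (k * Y)) by ring] at h2

/-- Plancherel's theorem. -/
lemma integral_norm_sq_fourierSynth {v : ℝ → ℂ} (hv : Integrable v)
    (hv2 : MemLp v 2 (volume : Measure ℝ)) :
    MemLp (fourierSynth v) 2 (volume : Measure ℝ) ∧
    ∫ X, ‖fourierSynth v X‖ ^ 2 = 2 * Real.pi * ∫ k, ‖v k‖ ^ 2 := by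
  have hpi : (0 : ℝ) < 2 * Real.pi := by positivity
  set g : ℝ → ℂ := fun ξ => ((2 * Real.pi : ℝ) : ℂ) * v (2 * Real.pi * ξ) with hg
  have g1 : Integrable g := (hv.comp_mul_left' hpi.ne').const_mul _
  have g2 : MemLp g 2 (volume : Measure ℝ) := by
    rw [memLp_two_iff_integrable_sq_norm g1.1]
    have h := (memLp_two_iff_integrable_sq_norm hv.1).1 hv2
    have := (h.comp_mul_left' hpi.ne').const_mul ((2 * Real.pi) ^ 2)
    refine this.congr (ae_of_all _ fun ξ => ?_)
    simp only [hg, norm_mul, mul_pow, Complex.norm_real, Real.norm_eq_abs, sq_abs]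
  have hae := fourierInv_toLp_ae_eq g1 g2
  have hsyn := fourierSynth_eq_fourierInv v
  rw [← hsyn] at hae
  have hmem : MemLp (fourierSynth v) 2 (volume : Measure ℝ) := (memLp_congr_ae hae).1 (Lp.memLp _)
  refine ⟨hmem, ?_⟩
  have n1 : ‖(𝓕⁻ (g2.toLp g) : Lp ℂ 2 (volume : Measure ℝ))‖ = ‖g2.toLp g‖ := by
    rw [← Lp.norm_fourier_eq, FourierTransform.fourier_fourierInv_eq]
  have sq : ∀ F : Lp ℂ 2 (volume : Measure ℝ), ‖F‖ ^ 2 = ∫ x, ‖F x‖ ^ 2 := by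
    intro F
    have := L2.inner_def (𝕜 := ℂ) F F
    rw [inner_self_eq_norm_sq_to_K] at this
    simp only [inner_self_eq_norm_sq_to_K] at this
    have h2 := congrArg Complex.re this
    rw [← RCLike.re_eq_complex_re, ← integral_re] at h2
    · simpa [← Complex.ofReal_pow] using h2
    · have := (memLp_two_iff_integrable_sq_norm (Lp.aestronglyMeasurable F)).1 (Lp.memLp F)
      simpa [← Complex.ofReal_pow] using this.ofReal (𝕜 := ℂ)
  have n2 := congrArg (fun x => x ^ 2) n1
  simp only [sq] at n2
  have i1 : ∫ X, ‖fourierSynth v X‖ ^ 2 = ∫ x, ‖(𝓕⁻ (g2.toLp g) : Lp ℂ 2 (volume : Measure ℝ)) x‖ ^ 2 :=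
    integral_congr_ae (hae.mono fun x hx => by simp [hx])
  have i2 : ∫ x, ‖(g2.toLp g) x‖ ^ 2 = ∫ x, ‖g x‖ ^ 2 :=
    integral_congr_ae (g2.coeFn_toLp.mono fun x hx => by simp [hx])
  rw [i1, n2, i2]
  have := Measure.integral_comp_mul_left (fun k : ℝ => ‖v k‖ ^ 2) (2 * Real.pi)
  simp only [hg, norm_mul, mul_pow, integral_const_mul, this, Complex.norm_real, Real.norm_eq_abs, sq_abs]
  rw [abs_of_pos (inv_pos.2 hpi), smul_eq_mul]
  field_simp

/-- The Fourier inversion formula. -/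
lemma eq_fourierSynth_fourierHat {f : ℝ → ℝ} (hf : Continuous f)
    (h2 : MemLp (fun X => (f X : ℂ)) 2 (volume : Measure ℝ))
    (h1 : Integrable (fourierHat f)) (X : ℝ) :
    (f X : ℂ) = fourierSynth (fourierHat f) X := by
  have hpi : (0 : ℝ) < 2 * Real.pi := by positivity
  set G : Lp ℂ 2 (volume : Measure ℝ) := 𝓕 (h2.toLp (fun X => (f X : ℂ))) with hG
  have hg : (fun ξ => ((2 * Real.pi : ℝ) : ℂ) * fourierHat f (2 * Real.pi * ξ)) = G := by
    ext ξ
    simp only [fourierHat, h2, dif_pos]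
    rw [mul_div_cancel_left₀ _ hpi.ne', ← mul_assoc, ← Complex.ofReal_mul, mul_inv_cancel₀ hpi.ne']
    simp [hG]
  have g1 : Integrable (G : ℝ → ℂ) := by
    rw [← hg]
    exact (h1.comp_mul_left' hpi.ne').const_mul _
  have hae := fourierInv_toLp_ae_eq g1 (Lp.memLp G)
  rw [Lp.toLp_coeFn, hG, FourierTransform.fourierInv_fourier_eq, ← hG, ← hg,
    ← fourierSynth_eq_fourierInv] at hae
  have hae2 := h2.coeFn_toLp.symm.trans hae
  have := Continuous.ae_eq_iff_eq (μ := (volume : Measure ℝ))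
    (Complex.continuous_ofReal.comp hf) (continuous_fourierSynth h1)
  exact congrFun (this.1 hae2) X

/-! ### Samples and Sobolev bounds -/

lemma cell_sum_le {g : ℝ → ℝ} (hg : Integrable g) (h0 : ∀ x, 0 ≤ g x) {ε : ℝ} (hε : 0 < ε)
    (θ : ℝ) (F : Finset ℤ) :
    ∑ j ∈ F, ∫ x in Ioc (ε * j + θ) (ε * j + θ + ε), g x ≤ ∫ x, g x := by
  rw [← integral_biUnion_finset F (fun _ _ => measurableSet_Ioc) _ (fun _ _ => hg.integrableOn)]
  · exact setIntegral_le_integral hg (ae_of_all _ h0)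
  · intro i _ j _ hij
    have key : ∀ i j : ℤ, i < j → Disjoint (Ioc (ε * i + θ) (ε * i + θ + ε))
        (Ioc (ε * j + θ) (ε * j + θ + ε)) := by
      intro i j h
      rw [Set.disjoint_left]
      rintro x ⟨_, h1⟩ ⟨h2, _⟩
      have : (i : ℝ) + 1 ≤ j := by exact_mod_cast h
      nlinarith
    rcases lt_or_gt_of_ne hij with h | h
    · exact key i j h
    · exact (key j i h).symm

/-- A function in `H¹` has square-summable samples on a grid of step `ε`. -/
lemma sum_sample_norm_sq_le {f f' : ℝ → ℂ} (hd : ∀ x, HasDerivAt f (f' x) x)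
    (hc : Continuous f') (h : Integrable fun x => ‖f x‖ ^ 2)
    (h' : Integrable fun x => ‖f' x‖ ^ 2) {ε : ℝ} (hε : ε ∈ Ioc (0 : ℝ) 1) (θ : ℝ)
    (F : Finset ℤ) :
    ∑ j ∈ F, ‖f (ε * j + θ)‖ ^ 2 ≤ 2 / ε * ∫ x, (‖f x‖ ^ 2 + ‖f' x‖ ^ 2) := by
  obtain ⟨h0, h1⟩ := hε
  have hfc : Continuous f := continuous_iff_continuousAt.2 fun x => (hd x).continuousAt
  set G : ℝ → ℝ := fun x => ‖f x‖ ^ 2 + ‖f' x‖ ^ 2 with hG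
  have hGi : Integrable G := h.add h'
  have hG0 : ∀ x, 0 ≤ G x := fun x => by positivity
  have hGc : Continuous G := by fun_prop
  have cell : ∀ a : ℝ, ε * ‖f a‖ ^ 2 ≤ 2 * ∫ x in Ioc a (a + ε), G x := by
    intro a
    have hpt : ∀ y ∈ Icc a (a + ε), ‖f a‖ ^ 2 - ∫ x in Ioc a (a + ε), G x ≤ ‖f y‖ ^ 2 := by
      intro y hy
      have hF := intervalIntegral.integral_eq_sub_of_hasDerivAt (a := a) (b := y)
        (fun x _ => (hd x).norm_sq)
        (by apply Continuous.intervalIntegrable; fun_prop)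
      have hle : -∫ x in a..y, 2 * inner ℝ (f x) (f' x) ≤ ∫ x in Ioc a (a + ε), G x := by
        rw [← intervalIntegral.integral_neg]
        calc ∫ x in a..y, -(2 * inner ℝ (f x) (f' x)) ≤ ∫ x in a..y, G x := by
              apply intervalIntegral.integral_mono_on hy.1
              · apply Continuous.intervalIntegrable; fun_prop
              · apply Continuous.intervalIntegrable; fun_prop
              · intro x _
                have := abs_le.1 (abs_real_inner_le_norm (f x) (f' x))
                have := sq_nonneg (‖f x‖ - ‖f' x‖)
                simp only [hG]
                nlinarith
          _ ≤ ∫ x in Ioc a (a + ε), G x := by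
              rw [intervalIntegral.integral_of_le hy.1]
              exact setIntegral_mono_set hGi.integrableOn (ae_of_all _ hG0)
                (Ioc_subset_Ioc_right hy.2).eventuallyLE
      linarith
    have hint : ∫ x in a..(a + ε), (‖f a‖ ^ 2 - ∫ x in Ioc a (a + ε), G x)
        ≤ ∫ x in a..(a + ε), ‖f x‖ ^ 2 :=
      intervalIntegral.integral_mono_on (by linarith) (by simp)
        (by apply Continuous.intervalIntegrable; fun_prop) hpt
    rw [intervalIntegral.integral_const, smul_eq_mul, add_sub_cancel_left,
      intervalIntegral.integral_of_le (by linarith)] at hint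
    have h2 : ∫ x in Ioc a (a + ε), ‖f x‖ ^ 2 ≤ ∫ x in Ioc a (a + ε), G x :=
      setIntegral_mono h.integrableOn hGi.integrableOn
        (fun x => le_add_of_nonneg_right (by positivity))
    have h3 : 0 ≤ ∫ x in Ioc a (a + ε), G x := integral_nonneg hG0
    nlinarith
  have hs := cell_sum_le hGi hG0 h0 θ F
  rw [div_mul_eq_mul_div, le_div_iff₀ h0, mul_comm, Finset.mul_sum]
  calc ∑ j ∈ F, ε * ‖f (ε * j + θ)‖ ^ 2
      ≤ ∑ j ∈ F, 2 * ∫ x in Ioc (ε * j + θ) (ε * j + θ + ε), G x :=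
        Finset.sum_le_sum fun j _ => cell _
    _ ≤ 2 * ∫ x, G x := by
        rw [← Finset.mul_sum]
        gcongr

/-- The Japanese bracket `⟨k⟩ = (1 + k²)^{1/2}`. -/
def jap (k : ℝ) : ℝ := Real.sqrt (1 + k ^ 2)

lemma jap_sq (k : ℝ) : jap k ^ 2 = 1 + k ^ 2 := Real.sq_sqrt (by positivity)

lemma one_le_jap (k : ℝ) : 1 ≤ jap k := Real.one_le_sqrt.2 (by nlinarith [sq_nonneg k])

lemma jap_pos (k : ℝ) : 0 < jap k := one_pos.trans_le (one_le_jap k)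

lemma abs_le_jap (k : ℝ) : |k| ≤ jap k := Real.abs_le_sqrt (by linarith)

lemma continuous_jap : Continuous jap := by unfold jap; fun_prop

/-- The spectral densities `v` controlled by `L` in the norm of `H^6`. -/
structure SpectralBound (L : ℝ) (v : ℝ → ℂ) : Prop where
  measurable : AEStronglyMeasurable v
  integrable : Integrable fun k => jap k ^ 12 * ‖v k‖ ^ 2
  nonneg : 0 ≤ L
  le : ∫ k, jap k ^ 12 * ‖v k‖ ^ 2 ≤ L ^ 2

/-- A Fourier multiplier of order at most five with constant `K`. -/
structure IsMult (K : ℝ) (m : ℝ → ℂ) : Prop where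
  measurable : Measurable m
  nonneg : 0 ≤ K
  le : ∀ k, ‖m k‖ ≤ K * jap k ^ 5

lemma memHs_spectralBound {f : ℝ → ℝ} {M : ℝ} (hf : MemHs 6 f) (hM : hsNorm 6 f ≤ M) :
    SpectralBound M (fourierHat f) := by
  have e : ∀ k : ℝ, (1 + k ^ 2) ^ (6 : ℝ) * ‖fourierHat f k‖ ^ 2 = jap k ^ 12 * ‖fourierHat f k‖ ^ 2 := by
    intro k
    rw [show (12 : ℕ) = 2 * 6 by norm_num, pow_mul, jap_sq, ← Real.rpow_natCast]
    norm_num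
  have h0 : 0 ≤ M := (Real.sqrt_nonneg _).trans hM
  refine ⟨?_, ?_, h0, ?_⟩
  · have : Measurable (fourierHat f) := by
      have : fourierHat f = fun k => ((2 * Real.pi)⁻¹ : ℝ) *
          (𝓕 (hf.1.toLp (fun X => (f X : ℂ))) : Lp ℂ 2 (volume : Measure ℝ)) (k / (2 * Real.pi)) := by
        ext k
        simp [fourierHat, hf.1]
      rw [this]
      exact ((Lp.stronglyMeasurable _).measurable.comp (measurable_id.div_const _)).const_mul _
    exact this.aestronglyMeasurable
  · simpa only [e] using hf.2
  · have := Real.sqrt_le_iff.1 hM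
    simpa only [e] using this.2

lemma integrable_inv_jap_sq : Integrable (fun k => (jap k ^ 2)⁻¹) := by
  simpa only [jap_sq] using integrable_inv_one_add_sq

namespace SpectralBound

variable {L : ℝ} {v : ℝ → ℂ} (hv : SpectralBound L v)
include hv

lemma integrable_jap_five : Integrable fun k => jap k ^ 5 * ‖v k‖ := by
  have hi := integrable_inv_jap_sq.add hv.integrable
  refine hi.mono ((continuous_jap.pow 5).aestronglyMeasurable.mul hv.measurable.norm)
    (ae_of_all _ fun k => ?_)
  have hj := jap_pos k
  rw [Real.norm_of_nonneg (by positivity)]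
  refine le_trans ?_ (le_abs_self _)
  simp only [Pi.add_apply]
  have h1 : (jap k)⁻¹ * jap k = 1 := inv_mul_cancel₀ hj.ne'
  have e : jap k ^ 5 * ‖v k‖ = (jap k)⁻¹ * (jap k ^ 6 * ‖v k‖) := by
    linear_combination -(jap k ^ 5 * ‖v k‖) * h1
  rw [e, ← inv_pow]
  nlinarith [sq_nonneg ((jap k)⁻¹ - jap k ^ 6 * ‖v k‖), sq_nonneg ((jap k)⁻¹),
    sq_nonneg (jap k ^ 6 * ‖v k‖)]

lemma integral_jap_five_le : ∫ k, jap k ^ 5 * ‖v k‖ ≤ 3 * L := by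
  -- Cauchy-Schwarz in the form `2 ab ≤ λ a² + b² / λ`, with `λ` tending to the optimal value
  have key : ∀ c > 0, L ≤ c → ∫ k, jap k ^ 5 * ‖v k‖ ≤ 3 * c := by
    intro c hc hLc
    have hle : ∫ k, jap k ^ 5 * ‖v k‖ ≤
        ∫ k, (c / 2 * (1 + k ^ 2)⁻¹ + (2 * c)⁻¹ * (jap k ^ 12 * ‖v k‖ ^ 2)) := by
      apply integral_mono hv.integrable_jap_five
      · exact (integrable_inv_one_add_sq.const_mul _).add (hv.integrable.const_mul _)
      · intro k
        have hj := jap_pos k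
        simp only
        have h1 : (jap k)⁻¹ * jap k = 1 := inv_mul_cancel₀ hj.ne'
        have h2 : c * c⁻¹ = 1 := mul_inv_cancel₀ hc.ne'
        have e : jap k ^ 5 * ‖v k‖ = (jap k)⁻¹ * (jap k ^ 6 * ‖v k‖) := by
          linear_combination -(jap k ^ 5 * ‖v k‖) * h1
        rw [e, ← jap_sq, ← inv_pow, mul_inv]
        have h3 := mul_nonneg (inv_nonneg.2 hc.le)
          (sq_nonneg (c * (jap k)⁻¹ - jap k ^ 6 * ‖v k‖))
        have h4 : c⁻¹ * (c * (jap k)⁻¹ - jap k ^ 6 * ‖v k‖) ^ 2 =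
          c * (jap k)⁻¹ ^ 2 - 2 * (jap k)⁻¹ * (jap k ^ 6 * ‖v k‖)
            + c⁻¹ * (jap k ^ 12 * ‖v k‖ ^ 2) := by
          linear_combination (c * (jap k)⁻¹ ^ 2 - 2 * (jap k)⁻¹ * (jap k ^ 6 * ‖v k‖)) * h2
        linarith
    rw [integral_add (integrable_inv_one_add_sq.const_mul _) (hv.integrable.const_mul _),
      integral_const_mul, integral_const_mul, integral_univ_inv_one_add_sq] at hle
    have h5 : (2 * c)⁻¹ * ∫ k, jap k ^ 12 * ‖v k‖ ^ 2 ≤ (2 * c)⁻¹ * c ^ 2 := by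
      gcongr
      exact hv.le.trans (pow_le_pow_left₀ hv.nonneg hLc 2)
    have h6 : (2 * c)⁻¹ * c ^ 2 = c / 2 := by field_simp
    have := Real.pi_lt_d2
    nlinarith
  apply le_of_forall_pos_le_add
  intro e he
  have := key (L + e / 3) (by linarith [hv.nonneg]) (by linarith)
  linarith

variable {K : ℝ} {m : ℝ → ℂ} (hm : IsMult K m)
include hm

lemma integrable_mul : Integrable fun k => m k * v k := by
  refine (hv.integrable_jap_five.const_mul K).mono
    (hm.measurable.aestronglyMeasurable.mul hv.measurable) (ae_of_all _ fun k => ?_)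
  have hj := jap_pos k
  have hK := hm.nonneg
  rw [Real.norm_of_nonneg (by positivity), norm_mul, ← mul_assoc]
  gcongr
  exact hm.le k

lemma integrable_sq_mul : Integrable fun k => (1 + k ^ 2) * ‖m k * v k‖ ^ 2 := by
  refine (hv.integrable.const_mul (K ^ 2)).mono
    (((by fun_prop : Continuous fun k : ℝ => 1 + k ^ 2)).aestronglyMeasurable.mul
      ((hm.measurable.aestronglyMeasurable.mul hv.measurable).norm.pow 2))
    (ae_of_all _ fun k => ?_)
  have hj := jap_pos k
  rw [Real.norm_of_nonneg (by positivity), Real.norm_of_nonneg (by positivity), ← jap_sq, norm_mul,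
    mul_pow]
  have := pow_le_pow_left₀ (norm_nonneg _) (hm.le k) 2
  calc jap k ^ 2 * (‖m k‖ ^ 2 * ‖v k‖ ^ 2) ≤ jap k ^ 2 * ((K * jap k ^ 5) ^ 2 * ‖v k‖ ^ 2) := by gcongr
    _ = _ := by ring

lemma integral_sq_mul_le : ∫ k, (1 + k ^ 2) * ‖m k * v k‖ ^ 2 ≤ (K * L) ^ 2 := by
  have : ∫ k, (1 + k ^ 2) * ‖m k * v k‖ ^ 2 ≤ ∫ k, K ^ 2 * (jap k ^ 12 * ‖v k‖ ^ 2) := by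
    apply integral_mono (hv.integrable_sq_mul hm) (hv.integrable.const_mul _)
    intro k
    have hj := jap_pos k
    simp only [← jap_sq, norm_mul, mul_pow]
    have := pow_le_pow_left₀ (norm_nonneg _) (hm.le k) 2
    calc jap k ^ 2 * (‖m k‖ ^ 2 * ‖v k‖ ^ 2) ≤ jap k ^ 2 * ((K * jap k ^ 5) ^ 2 * ‖v k‖ ^ 2) := by
          gcongr
      _ = _ := by ring
  rw [integral_const_mul] at this
  nlinarith [hv.le, sq_nonneg K]

lemma sum_sample_le_of_integrable (hm' : Integrable fun k : ℝ => Complex.I * k * (m k * v k)) {ε : ℝ}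
    (hε : ε ∈ Ioc (0 : ℝ) 1) (θ : ℝ) (F : Finset ℤ) :
    ∑ j ∈ F, ‖fourierSynth (fun k => m k * v k) (ε * j + θ)‖ ^ 2 ≤ (4 * K * L) ^ 2 / ε := by
  set w : ℝ → ℂ := fun k => m k * v k with hw
  have hwi : Integrable w := hv.integrable_mul hm
  have hsq := hv.integrable_sq_mul hm
  have s1 : Integrable fun k => ‖w k‖ ^ 2 := by
    refine hsq.mono (hwi.1.norm.pow 2) (ae_of_all _ fun k => ?_)
    rw [Real.norm_of_nonneg (by positivity), Real.norm_of_nonneg (by positivity)]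
    nlinarith [mul_nonneg (sq_nonneg k) (sq_nonneg ‖w k‖)]
  have s2 : Integrable fun k : ℝ => ‖Complex.I * k * w k‖ ^ 2 := by
    refine hsq.mono (hm'.1.norm.pow 2) (ae_of_all _ fun k => ?_)
    rw [Real.norm_of_nonneg (by positivity), Real.norm_of_nonneg (by positivity)]
    simp only [norm_mul, Complex.norm_I, Complex.norm_real, Real.norm_eq_abs, one_mul, mul_pow, sq_abs,
      hw]
    nlinarith [sq_nonneg (‖m k‖ * ‖v k‖)]
  have p1 := integral_norm_sq_fourierSynth hwi ((memLp_two_iff_integrable_sq_norm hwi.1).2 s1)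
  have p2 := integral_norm_sq_fourierSynth hm' ((memLp_two_iff_integrable_sq_norm hm'.1).2 s2)
  have q1 := (memLp_two_iff_integrable_sq_norm p1.1.1).1 p1.1
  have q2 := (memLp_two_iff_integrable_sq_norm p2.1.1).1 p2.1
  have key := sum_sample_norm_sq_le (fun X => hasDerivAt_fourierSynth hwi hm' X)
    (continuous_fourierSynth hm') q1 q2 hε θ F
  rw [integral_add q1 q2, p1.2, p2.2, ← mul_add, ← integral_add s1 s2] at key
  have e : ∫ k, (‖w k‖ ^ 2 + ‖Complex.I * k * w k‖ ^ 2) = ∫ k, (1 + k ^ 2) * ‖m k * v k‖ ^ 2 := by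
    congr 1
    ext k
    simp only [norm_mul, Complex.norm_I, Complex.norm_real, Real.norm_eq_abs, one_mul, mul_pow, sq_abs,
      hw]
    ring
  rw [e] at key
  refine key.trans ?_
  have h0 : 0 ≤ ∫ k, (1 + k ^ 2) * ‖m k * v k‖ ^ 2 := integral_nonneg fun k => by positivity
  have := hv.integral_sq_mul_le hm
  rw [div_mul_eq_mul_div, div_le_div_iff_of_pos_right hε.1]
  nlinarith [Real.pi_lt_d2, Real.pi_pos]

/-- The samples on a grid of step `ε` of a function with `H^6`-bounded density, after the action of
a multiplier of order at most five. One derivative is spent on passing to the samples. -/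
lemma sum_sample_le {ε : ℝ} (hε : ε ∈ Ioc (0 : ℝ) 1) (θ : ℝ) (F : Finset ℤ) :
    ∑ j ∈ F, ‖fourierSynth (fun k => m k * v k) (ε * j + θ)‖ ^ 2 ≤ (4 * K * L) ^ 2 / ε := by
  -- The derivative need not have an integrable density, so the frequencies are cut off first.
  set mR : ℕ → ℝ → ℂ := fun n => (Icc (-(n : ℝ)) n).indicator m with hmR
  have hle : ∀ n k, ‖mR n k‖ ≤ ‖m k‖ := fun n k => norm_indicator_le_norm_self _ _
  have hM : ∀ n, IsMult K (mR n) := fun n =>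
    ⟨hm.measurable.indicator measurableSet_Icc, hm.nonneg, fun k => (hle n k).trans (hm.le k)⟩
  have hwi := hv.integrable_mul hm
  have hb : ∀ n : ℕ, ∑ j ∈ F, ‖fourierSynth (fun k => mR n k * v k) (ε * j + θ)‖ ^ 2
      ≤ (4 * K * L) ^ 2 / ε := by
    intro n
    refine hv.sum_sample_le_of_integrable (hM n) ?_ hε θ F
    refine ((hwi.norm).const_mul n).mono ?_ (ae_of_all _ fun k => ?_)
    · exact ((by fun_prop : Continuous fun k : ℝ => Complex.I * (k : ℂ))).aestronglyMeasurable.mul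
        (hv.integrable_mul (hM n)).1
    · rw [Real.norm_of_nonneg (by positivity)]
      simp only [norm_mul, Complex.norm_I, Complex.norm_real, Real.norm_eq_abs, one_mul]
      by_cases hk : k ∈ Icc (-(n : ℝ)) n
      · have := abs_le.2 hk
        have := hle n k
        gcongr
      · simp only [hmR, indicator_of_notMem hk, norm_zero, zero_mul, mul_zero]
        positivity
  have hlim : ∀ X, Filter.Tendsto (fun n => fourierSynth (fun k => mR n k * v k) X) Filter.atTop
      (nhds (fourierSynth (fun k => m k * v k) X)) := by
    intro X
    apply tendsto_integral_of_dominated_convergence (fun k => ‖m k * v k‖)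
    · exact fun n => (integrable_fourierSynth_integrand (hv.integrable_mul (hM n)) X).1
    · exact hwi.norm
    · refine fun n => ae_of_all _ fun k => ?_
      rw [norm_mul _ (Complex.exp _), norm_exp_I_mul, mul_one, norm_mul, norm_mul]
      gcongr
      exact hle n k
    · refine ae_of_all _ fun k => tendsto_const_nhds.congr' ?_
      obtain ⟨N, hN⟩ := exists_nat_ge |k|
      filter_upwards [Filter.eventually_ge_atTop N] with n hn
      have : k ∈ Icc (-(n : ℝ)) n := abs_le.1 (hN.trans (by exact_mod_cast hn))
      simp only [hmR, indicator_of_mem this]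
  exact le_of_tendsto' (tendsto_finsetSum F fun j _ => ((hlim _).norm.pow 2)) hb

end SpectralBound

/-! ### Second differences -/

lemma norm_second_difference_le {E : Type*} [NormedAddCommGroup E] [NormedSpace ℝ E]
    {f f' f'' : ℝ → E} {c s B : ℝ} (hs : 0 ≤ s)
    (h1 : ∀ x ∈ Icc (c - s) (c + s), HasDerivAt f (f' x) x)
    (h2 : ∀ x ∈ Icc (c - s) (c + s), HasDerivAt f' (f'' x) x)
    (hB : ∀ x ∈ Icc (c - s) (c + s), ‖f'' x‖ ≤ B) :
    ‖f (c + s) + f (c - s) - (2 : ℝ) • f c‖ ≤ 2 * B * s ^ 2 := by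
  have hB0 : 0 ≤ B := (norm_nonneg _).trans (hB c ⟨by linarith, by linarith⟩)
  have m1 : ∀ t ∈ Icc 0 s, c + t ∈ Icc (c - s) (c + s) := fun t ht =>
    ⟨by linarith [ht.1], by linarith [ht.2]⟩
  have m2 : ∀ t ∈ Icc 0 s, c - t ∈ Icc (c - s) (c + s) := fun t ht =>
    ⟨by linarith [ht.2], by linarith [ht.1]⟩
  have d1 : ∀ t ∈ Icc 0 s, ‖f' (c + t) - f' (c - t)‖ ≤ 2 * B * s := by
    intro t ht
    have := (convex_Icc (c - s) (c + s)).norm_image_sub_le_of_norm_hasDerivWithin_le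
      (fun x hx => (h2 x hx).hasDerivWithinAt) hB (m2 t ht) (m1 t ht)
    refine this.trans ?_
    rw [show c + t - (c - t) = 2 * t by ring, Real.norm_of_nonneg (by linarith [ht.1])]
    nlinarith [ht.2]
  have key := (convex_Icc 0 s).norm_image_sub_le_of_norm_hasDerivWithin_le
    (f := fun t => f (c + t) + f (c - t)) (f' := fun t => f' (c + t) - f' (c - t))
    (fun t ht => by
      have a1 := (h1 _ (m1 t ht)).scomp t ((hasDerivAt_id t).const_add c)
      have a2 := (h1 _ (m2 t ht)).scomp t ((hasDerivAt_id t).const_sub c)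
      simpa [sub_eq_add_neg] using! (a1.add a2).hasDerivWithinAt) d1
    (left_mem_Icc.2 hs) (right_mem_Icc.2 hs)
  simp only [add_zero, sub_zero, ← two_smul ℝ (f c)] at key
  rw [Real.norm_of_nonneg hs] at key
  refine key.trans (le_of_eq (by ring))

/-! ### Riemann sums with a power-law weight -/

/-- The weight `s ^ (-α) min(1, s²)`, integrable on `(0, ∞)` for `1 < α < 3`. -/
def tailWeight (α s : ℝ) : ℝ := s ^ (-α) * min 1 (s ^ 2)

lemma tailWeight_nonneg {α s : ℝ} (hs : 0 ≤ s) : 0 ≤ tailWeight α s := by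
  unfold tailWeight
  positivity

lemma continuousOn_tailWeight (α : ℝ) : ContinuousOn (tailWeight α) (Ioi 0) := by
  intro s hs
  have : s ≠ 0 := (mem_Ioi.1 hs).ne'
  unfold tailWeight
  apply ContinuousAt.continuousWithinAt
  have h1 : ContinuousAt (fun s : ℝ => s ^ (-α)) s := Real.continuousAt_rpow_const _ _ (Or.inl this)
  exact h1.mul (by fun_prop)

lemma tailWeight_le_rpow {α s : ℝ} (hs : 0 < s) : tailWeight α s ≤ s ^ (2 - α) := by
  unfold tailWeight
  rw [show 2 - α = -α + (2 : ℕ) by push_cast; ring, Real.rpow_add_natCast hs.ne']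
  exact mul_le_mul_of_nonneg_left (min_le_right _ _) (Real.rpow_nonneg hs.le _)

lemma tailWeight_le_rpow_neg {α s : ℝ} (hs : 0 < s) : tailWeight α s ≤ s ^ (-α) :=
  mul_le_of_le_one_right (Real.rpow_nonneg hs.le _) (min_le_left _ _)

lemma integrableOn_rpow_Ioc {a b : ℝ} (ha : -1 < a) (hb : 0 ≤ b) :
    IntegrableOn (fun s : ℝ => s ^ a) (Ioc 0 b) :=
  (intervalIntegrable_iff_integrableOn_Ioc_of_le hb).1
    (intervalIntegral.intervalIntegrable_rpow' ha)

lemma integrableOn_tailWeight {α : ℝ} (hα : α ∈ Ioo (1 : ℝ) 3) :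
    IntegrableOn (tailWeight α) (Ioi 0) := by
  have hm : ∀ s ⊆ Ioi (0 : ℝ), MeasurableSet s →
      AEStronglyMeasurable (tailWeight α) (volume.restrict s) := fun s hs hsm =>
    ((continuousOn_tailWeight α).mono hs).aestronglyMeasurable hsm
  rw [← Ioc_union_Ioi_eq_Ioi (zero_le_one (α := ℝ))]
  refine IntegrableOn.union ?_ ?_
  · refine (integrableOn_rpow_Ioc (a := 2 - α) (by linarith [hα.2]) zero_le_one).mono'
      (hm _ (fun s hs => hs.1) measurableSet_Ioc) ?_
    refine (ae_restrict_iff' measurableSet_Ioc).2 (ae_of_all _ fun s hs => ?_)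
    rw [Real.norm_of_nonneg (tailWeight_nonneg hs.1.le)]
    exact tailWeight_le_rpow hs.1
  · refine (integrableOn_Ioi_rpow_of_lt (a := -α) (by linarith [hα.1]) one_pos).mono'
      (hm _ (fun s hs => one_pos.trans (mem_Ioi.1 hs)) measurableSet_Ioi) ?_
    refine (ae_restrict_iff' measurableSet_Ioi).2 (ae_of_all _ fun s hs => ?_)
    have h0 : (0 : ℝ) < s := one_pos.trans hs
    rw [Real.norm_of_nonneg (tailWeight_nonneg h0.le)]
    exact tailWeight_le_rpow_neg h0

/-- The integral over `(κ / 2, ∞)` as a sum over the cells centred at the multiples of `κ`. -/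
lemma hasSum_integral_midpoint_cells {g : ℝ → ℝ} (hg : IntegrableOn g (Ioi 0)) {κ : ℝ}
    (hκ : 0 < κ) :
    HasSum (fun n : ℕ => ∫ s in Ioc (((n : ℝ) + 1 / 2) * κ) (((n : ℝ) + 3 / 2) * κ), g s)
      (∫ s in Ioi (κ / 2), g s) := by
  have hU : (⋃ n : ℕ, Ioc (((n : ℝ) + 1 / 2) * κ) (((n : ℝ) + 3 / 2) * κ)) = Ioi (κ / 2) := by
    ext s
    simp only [mem_iUnion, mem_Ioc, mem_Ioi]
    constructor
    · rintro ⟨n, h1, _⟩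
      have : (0 : ℝ) ≤ n := n.cast_nonneg
      nlinarith
    · intro hs
      have hx : 0 < s / κ - 1 / 2 := by
        rw [sub_pos, lt_div_iff₀ hκ]; linarith
      refine ⟨⌈s / κ - 1 / 2⌉₊ - 1, ?_⟩
      have hpos : 0 < ⌈s / κ - 1 / 2⌉₊ := Nat.ceil_pos.2 hx
      have hcast : ((⌈s / κ - 1 / 2⌉₊ - 1 : ℕ) : ℝ) = (⌈s / κ - 1 / 2⌉₊ : ℝ) - 1 := by
        rw [Nat.cast_sub hpos]; simp
      have h1 := Nat.ceil_lt_add_one hx.le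
      have h2 := Nat.le_ceil (s / κ - 1 / 2)
      rw [hcast]
      constructor
      · rw [← lt_div_iff₀ hκ]; linarith
      · rw [← div_le_iff₀ hκ]; linarith
  rw [← hU]
  apply hasSum_integral_iUnion (fun n => measurableSet_Ioc)
  · have key : ∀ i j : ℕ, i < j → Disjoint (Ioc (((i : ℝ) + 1 / 2) * κ) (((i : ℝ) + 3 / 2) * κ))
        (Ioc (((j : ℝ) + 1 / 2) * κ) (((j : ℝ) + 3 / 2) * κ)) := by
      intro i j h
      rw [Set.disjoint_left]
      rintro x ⟨_, h1⟩ ⟨h2, _⟩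
      have : (i : ℝ) + 1 ≤ j := by exact_mod_cast h
      nlinarith
    intro i j hij
    rcases lt_or_gt_of_ne hij with h | h
    · exact key i j h
    · exact (key j i h).symm
  · rw [hU]
    exact hg.mono_set (Ioi_subset_Ioi (by positivity))

/-- Terms bounded by cell integrals sum to at most the whole integral. -/
lemma summable_tsum_le_of_cells {g : ℝ → ℝ} (hg : IntegrableOn g (Ioi 0)) (h0 : ∀ s, 0 < s → 0 ≤ g s)
    {κ : ℝ} (hκ : 0 < κ) {a : ℕ → ℝ} (ha : ∀ n, 0 ≤ a n)
    (hle : ∀ n : ℕ, a n ≤ ∫ s in Ioc (((n : ℝ) + 1 / 2) * κ) (((n : ℝ) + 3 / 2) * κ), g s) :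
    Summable a ∧ ∑' n, a n ≤ ∫ s in Ioi 0, g s := by
  have hs := hasSum_integral_midpoint_cells hg hκ
  have hsum : Summable a := .of_nonneg_of_le ha hle hs.summable
  refine ⟨hsum, ?_⟩
  calc ∑' n, a n ≤ ∫ s in Ioi (κ / 2), g s := hsum.tsum_le_tsum hle hs.summable |>.trans_eq hs.tsum_eq
    _ ≤ ∫ s in Ioi 0, g s := by
      apply setIntegral_mono_set hg
      · exact (ae_restrict_iff' measurableSet_Ioi).2 (ae_of_all _ h0)
      · exact (Ioi_subset_Ioi (by positivity)).eventuallyLE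

lemma summable_rpow_neg {α : ℝ} (hα : 1 < α) : Summable fun n : ℕ => ((n : ℝ) + 1) ^ (-α) := by
  have h := (summable_nat_add_iff 1).2 (Real.summable_nat_rpow.2 (by linarith : -α < -1))
  simpa using h

/-- The sum `∑ m ^ (-α) min(1, (mε)²)` is of order `ε ^ (α - 1)`. -/
lemma summable_tsum_tailWeight_le {α : ℝ} (hα : α ∈ Ioo (1 : ℝ) 3) {ε : ℝ} (hε : 0 < ε) :
    Summable (fun n : ℕ => ((n : ℝ) + 1) ^ (-α) * min 1 ((((n : ℝ) + 1) * ε) ^ 2)) ∧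
    ∑' n : ℕ, ((n : ℝ) + 1) ^ (-α) * min 1 ((((n : ℝ) + 1) * ε) ^ 2)
      ≤ (4 * 2 ^ α * ∫ s in Ioi 0, tailWeight α s) * ε ^ (α - 1) := by
  have hC : (0 : ℝ) < 4 * 2 ^ α := by positivity
  have hterm : ∀ n : ℕ, ((n : ℝ) + 1) ^ (-α) * min 1 ((((n : ℝ) + 1) * ε) ^ 2)
      = ε ^ (α - 1) * (ε * tailWeight α (((n : ℝ) + 1) * ε)) := by
    intro n
    rw [tailWeight, Real.mul_rpow (by positivity) hε.le, Real.rpow_sub_one hε.ne', Real.rpow_neg hε.le]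
    have := (Real.rpow_pos_of_pos hε α).ne'
    field_simp
  have key := summable_tsum_le_of_cells (a := fun n : ℕ => ε * tailWeight α (((n : ℝ) + 1) * ε))
    ((integrableOn_tailWeight hα).const_mul (4 * 2 ^ α))
    (fun s hs => mul_nonneg hC.le (tailWeight_nonneg hs.le)) hε
    (fun n => mul_nonneg hε.le (tailWeight_nonneg (by positivity))) (by
      intro n
      have hn : (0 : ℝ) ≤ n := n.cast_nonneg
      set b := ((n : ℝ) + 1) * ε with hb
      have hb0 : 0 < b := by positivity
      have hcell : ∀ s ∈ Ioc (((n : ℝ) + 1 / 2) * ε) (((n : ℝ) + 3 / 2) * ε),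
          tailWeight α b ≤ 4 * 2 ^ α * tailWeight α s := by
        rintro s ⟨h1, h2⟩
        have hs0 : 0 < s := lt_of_le_of_lt (by positivity) h1
        have hsb : s ≤ 2 * b := by nlinarith
        have hbs : b ≤ 2 * s := by nlinarith
        have e1 : b ^ (-α) ≤ 2 ^ α * s ^ (-α) := by
          have : (2 * b) ^ (-α) ≤ s ^ (-α) :=
            Real.rpow_le_rpow_of_nonpos hs0 hsb (by linarith [hα.1])
          rw [Real.mul_rpow (by norm_num) hb0.le, Real.rpow_neg (by norm_num)] at this
          have h2α : (0 : ℝ) < 2 ^ α := by positivity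
          rwa [inv_mul_le_iff₀ h2α] at this
        have e2 : min 1 (b ^ 2) ≤ 4 * min 1 (s ^ 2) := by
          rcases le_total 1 (s ^ 2) with h | h
          · rw [min_eq_left h]; linarith [min_le_left 1 (b ^ 2)]
          · rw [min_eq_right h]
            refine (min_le_right _ _).trans ?_
            nlinarith
        unfold tailWeight
        calc b ^ (-α) * min 1 (b ^ 2) ≤ (2 ^ α * s ^ (-α)) * (4 * min 1 (s ^ 2)) := by gcongr
          _ = _ := by ring
      have hint : IntegrableOn (fun s => 4 * 2 ^ α * tailWeight α s)
          (Ioc (((n : ℝ) + 1 / 2) * ε) (((n : ℝ) + 3 / 2) * ε)) :=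
        ((integrableOn_tailWeight hα).mono_set
          (fun s hs => lt_of_le_of_lt (by positivity) hs.1)).const_mul _
      have := setIntegral_mono_on (integrableOn_const (by simp)) hint measurableSet_Ioc hcell
      refine le_trans (le_of_eq ?_) this
      rw [setIntegral_const, smul_eq_mul, Real.volume_real_Ioc_of_le (by nlinarith)]
      ring)
  simp only [hterm]
  refine ⟨key.1.mul_left _, ?_⟩
  rw [tsum_mul_left, mul_comm]
  have := key.2
  rw [integral_const_mul] at this
  gcongr

/-- The profile `(1 - sinc²(s/2)) / s ^ α`, in the form `(s² - 2 + 2 cos s) s ^ (-α - 2)`. -/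
def dispersionProfile (α s : ℝ) : ℝ := (s ^ 2 - 2 + 2 * Real.cos s) * s ^ (-(α + 2))

lemma dispersionProfile_eq {α s : ℝ} (hs : 0 < s) :
    dispersionProfile α s = (1 - Real.sinc (s / 2) ^ 2) / s ^ α := by
  have h2 : Real.cos s = 1 - 2 * Real.sin (s / 2) ^ 2 := by
    have := Real.cos_two_mul (s / 2)
    rw [show 2 * (s / 2) = s by ring] at this
    nlinarith [Real.sin_sq_add_cos_sq (s / 2)]
  rw [dispersionProfile, Real.sinc_of_ne_zero (by positivity), h2, neg_add, Real.rpow_add hs,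
    Real.rpow_neg hs.le, Real.rpow_neg hs.le, Real.rpow_ofNat]
  have := (Real.rpow_pos_of_pos hs α).ne'
  field_simp
  ring

lemma two_sub_two_cos_mem {s : ℝ} : 0 ≤ 2 - 2 * Real.cos s ∧ 2 - 2 * Real.cos s ≤ s ^ 2 := by
  constructor
  · linarith [Real.cos_le_one s]
  · linarith [Real.one_sub_sq_div_two_le_cos (x := s)]

lemma abs_two_mul_sub_sin_le {s : ℝ} (hs : 0 ≤ s) : |2 * s - 2 * Real.sin s| ≤ s ^ 3 := by
  have key := (convex_Icc 0 s).norm_image_sub_le_of_norm_hasDerivWithin_le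
    (f := fun t => 2 * t - 2 * Real.sin t) (f' := fun t => 2 - 2 * Real.cos t) (C := s ^ 2)
    (fun t _ => by
      simpa using! (((hasDerivAt_id t).const_mul 2).sub ((Real.hasDerivAt_sin t).const_mul 2)).hasDerivWithinAt)
    (fun t ht => by
      rw [Real.norm_of_nonneg two_sub_two_cos_mem.1]
      exact two_sub_two_cos_mem.2.trans (pow_le_pow_left₀ ht.1 ht.2 2))
    (left_mem_Icc.2 hs) (right_mem_Icc.2 hs)
  simp only [mul_zero, Real.sin_zero, sub_zero, Real.norm_eq_abs, abs_of_nonneg hs] at key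
  exact key.trans (le_of_eq (by ring))

lemma abs_sq_sub_two_add_cos_le {s : ℝ} (hs : 0 ≤ s) : |s ^ 2 - 2 + 2 * Real.cos s| ≤ s ^ 4 := by
  have key := (convex_Icc 0 s).norm_image_sub_le_of_norm_hasDerivWithin_le
    (f := fun t => t ^ 2 + 2 * Real.cos t) (f' := fun t => 2 * t - 2 * Real.sin t) (C := s ^ 3)
    (fun t _ => by
      simpa [sub_eq_add_neg] using!
        (((hasDerivAt_id t).pow 2).add ((Real.hasDerivAt_cos t).const_mul 2)).hasDerivWithinAt)
    (fun t ht => (abs_two_mul_sub_sin_le ht.1).trans (pow_le_pow_left₀ ht.1 ht.2 3))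
    (left_mem_Icc.2 hs) (right_mem_Icc.2 hs)
  simp only [Real.cos_zero, sub_zero, Real.norm_eq_abs, abs_of_nonneg hs] at key
  rw [show s ^ 2 - 2 + 2 * Real.cos s = s ^ 2 + 2 * Real.cos s - (0 ^ 2 + 2 * 1) by ring]
  exact key.trans (le_of_eq (by ring))

lemma sq_sub_two_add_cos_nonneg (s : ℝ) : 0 ≤ s ^ 2 - 2 + 2 * Real.cos s := by
  linarith [two_sub_two_cos_mem (s := s)]

lemma dispersionProfile_nonneg {α s : ℝ} (hs : 0 ≤ s) : 0 ≤ dispersionProfile α s :=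
  mul_nonneg (sq_sub_two_add_cos_nonneg s) (Real.rpow_nonneg hs _)

lemma dispersionProfile_le_tailWeight {α s : ℝ} (hs : 0 < s) :
    dispersionProfile α s ≤ tailWeight α s := by
  have h1 := (le_abs_self _).trans (abs_sq_sub_two_add_cos_le hs.le)
  have h2 := Real.cos_le_one s
  unfold dispersionProfile tailWeight
  rw [neg_add, Real.rpow_add hs, Real.rpow_neg hs.le 2, Real.rpow_ofNat]
  have h3 : (s ^ 2 - 2 + 2 * Real.cos s) * (s ^ 2)⁻¹ ≤ min 1 (s ^ 2) := by
    rw [mul_inv_le_iff₀ (by positivity), min_mul_of_nonneg _ _ (by positivity)]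
    exact le_min (by linarith) (by nlinarith)
  calc _ = s ^ (-α) * ((s ^ 2 - 2 + 2 * Real.cos s) * (s ^ 2)⁻¹) := by ring
    _ ≤ _ := by gcongr

lemma continuousOn_dispersionProfile (α : ℝ) : ContinuousOn (dispersionProfile α) (Ioi 0) := by
  intro s hs
  have : s ≠ 0 := (mem_Ioi.1 hs).ne'
  have h1 : ContinuousAt (fun s : ℝ => s ^ (-(α + 2))) s :=
    Real.continuousAt_rpow_const _ _ (Or.inl this)
  have h2 : ContinuousAt (fun s : ℝ => s ^ 2 - 2 + 2 * Real.cos s) s := by fun_prop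
  exact (h2.mul h1).continuousWithinAt

lemma integrableOn_dispersionProfile {α : ℝ} (hα : α ∈ Ioo (1 : ℝ) 3) :
    IntegrableOn (dispersionProfile α) (Ioi 0) := by
  refine (integrableOn_tailWeight hα).mono'
    ((continuousOn_dispersionProfile α).aestronglyMeasurable measurableSet_Ioi) ?_
  refine (ae_restrict_iff' measurableSet_Ioi).2 (ae_of_all _ fun s hs => ?_)
  have hs' := mem_Ioi.1 hs
  rw [Real.norm_of_nonneg (dispersionProfile_nonneg hs'.le)]
  exact dispersionProfile_le_tailWeight hs'

/-- The bound `|g''(s)| ≤ C s ^ (-α)` for the dispersion profile `g`, with its derivatives. -/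
lemma exists_deriv_dispersionProfile {α : ℝ} (hα : 0 < α) :
    ∃ B : ℝ, 0 ≤ B ∧ ∃ g' g'' : ℝ → ℝ, ∀ s, 0 < s →
      HasDerivAt (dispersionProfile α) (g' s) s ∧ HasDerivAt g' (g'' s) s ∧
      |g'' s| ≤ B * s ^ (-α) := by
  set β := α + 2 with hβ
  refine ⟨1 + 2 * β + β * (β + 1), by positivity,
    fun s => (2 * s - 2 * Real.sin s) * s ^ (-β) + (s ^ 2 - 2 + 2 * Real.cos s) * (-β * s ^ (-β - 1)),
    fun s => ((2 - 2 * Real.cos s) * s ^ (-β) + (2 * s - 2 * Real.sin s) * (-β * s ^ (-β - 1)))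
      + ((2 * s - 2 * Real.sin s) * (-β * s ^ (-β - 1))
        + (s ^ 2 - 2 + 2 * Real.cos s) * (-β * ((-β - 1) * s ^ (-β - 1 - 1)))), ?_⟩
  intro s hs
  have p1 := Real.hasDerivAt_rpow_const (x := s) (p := -β) (Or.inl hs.ne')
  have p2 := Real.hasDerivAt_rpow_const (x := s) (p := -β - 1) (Or.inl hs.ne')
  have n1 : HasDerivAt (fun s => s ^ 2 - 2 + 2 * Real.cos s) (2 * s - 2 * Real.sin s) s := by
    have := (((hasDerivAt_id s).pow 2).sub_const 2).add ((Real.hasDerivAt_cos s).const_mul 2)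
    simpa [sub_eq_add_neg] using! this
  have n2 : HasDerivAt (fun s => 2 * s - 2 * Real.sin s) (2 - 2 * Real.cos s) s := by
    simpa using! ((hasDerivAt_id s).const_mul 2).sub ((Real.hasDerivAt_sin s).const_mul 2)
  refine ⟨n1.mul p1, (n2.mul p1).add (n1.mul (p2.const_mul (-β))), ?_⟩
  have e0 : s ^ (-β) = s ^ (-α) * (s ^ 2)⁻¹ := by
    rw [hβ, neg_add, Real.rpow_add hs, Real.rpow_neg hs.le 2, Real.rpow_ofNat]
  have e1 : s ^ (-β - 1) = s ^ (-α) * (s ^ 3)⁻¹ := by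
    rw [Real.rpow_sub_one hs.ne', e0]; field_simp
  have e2 : s ^ (-β - 1 - 1) = s ^ (-α) * (s ^ 4)⁻¹ := by
    rw [Real.rpow_sub_one hs.ne', e1]; field_simp
  have b0 : |(2 - 2 * Real.cos s) * (s ^ 2)⁻¹| ≤ 1 := by
    rw [abs_mul, abs_of_nonneg two_sub_two_cos_mem.1, abs_of_pos (by positivity),
      mul_inv_le_iff₀ (by positivity), one_mul]
    exact two_sub_two_cos_mem.2
  have b1 : |(2 * s - 2 * Real.sin s) * (s ^ 3)⁻¹| ≤ 1 := by
    rw [abs_mul, abs_of_pos (inv_pos.2 (pow_pos hs 3)), mul_inv_le_iff₀ (by positivity), one_mul]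
    exact abs_two_mul_sub_sin_le hs.le
  have b2 : |(s ^ 2 - 2 + 2 * Real.cos s) * (s ^ 4)⁻¹| ≤ 1 := by
    rw [abs_mul, abs_of_pos (inv_pos.2 (pow_pos hs 4)), mul_inv_le_iff₀ (by positivity), one_mul]
    exact abs_sq_sub_two_add_cos_le hs.le
  have hβ0 : 0 < β := by positivity
  have hpow : 0 ≤ s ^ (-α) := Real.rpow_nonneg hs.le _
  beta_reduce
  rw [e0, e1, e2]
  have e : ((2 - 2 * Real.cos s) * (s ^ (-α) * (s ^ 2)⁻¹)
      + (2 * s - 2 * Real.sin s) * (-β * (s ^ (-α) * (s ^ 3)⁻¹)))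
      + ((2 * s - 2 * Real.sin s) * (-β * (s ^ (-α) * (s ^ 3)⁻¹))
        + (s ^ 2 - 2 + 2 * Real.cos s) * (-β * ((-β - 1) * (s ^ (-α) * (s ^ 4)⁻¹))))
      = ((2 - 2 * Real.cos s) * (s ^ 2)⁻¹ - 2 * β * ((2 * s - 2 * Real.sin s) * (s ^ 3)⁻¹)
        + β * (β + 1) * ((s ^ 2 - 2 + 2 * Real.cos s) * (s ^ 4)⁻¹)) * s ^ (-α) := by ring
  rw [e, abs_mul, abs_of_nonneg hpow]
  refine mul_le_mul_of_nonneg_right ?_ hpow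
  rw [abs_le] at b0 b1 b2 ⊢
  have hββ : 0 < β * (β + 1) := by positivity
  constructor <;> nlinarith

/-- The integral of the dispersion profile, so that `κ₃ = α (α + 1) dispersionConst α`. -/
def dispersionConst (α : ℝ) : ℝ := ∫ s in Ioi 0, dispersionProfile α s

lemma kappa₃_eq (α : ℝ) : kappa₃ α = α * (α + 1) * dispersionConst α := by
  unfold kappa₃ dispersionConst
  rw [setIntegral_congr_fun measurableSet_Ioi (fun s hs => (dispersionProfile_eq hs).symm)]

/-- The midpoint rule on a cell, with its error. -/
lemma abs_integral_cell_sub_le {g g' g'' : ℝ → ℝ} {c κ B : ℝ} (hκ : 0 ≤ κ)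
    (h1 : ∀ x ∈ Icc (c - κ / 2) (c + κ / 2), HasDerivAt g (g' x) x)
    (h2 : ∀ x ∈ Icc (c - κ / 2) (c + κ / 2), HasDerivAt g' (g'' x) x)
    (hB : ∀ x ∈ Icc (c - κ / 2) (c + κ / 2), |g'' x| ≤ B) :
    |(∫ x in (c - κ / 2)..(c + κ / 2), g x) - κ * g c| ≤ B * κ ^ 3 := by
  have hB0 : 0 ≤ B := (abs_nonneg _).trans (hB c ⟨by linarith, by linarith⟩)
  have hc : ContinuousOn g (Icc (c - κ / 2) (c + κ / 2)) := fun x hx =>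
    (h1 x hx).continuousAt.continuousWithinAt
  have i1 : IntervalIntegrable g volume (c - κ / 2) c :=
    (hc.mono (Icc_subset_Icc_right (by linarith))).intervalIntegrable_of_Icc (by linarith)
  have i2 : IntervalIntegrable g volume c (c + κ / 2) :=
    (hc.mono (Icc_subset_Icc_left (by linarith))).intervalIntegrable_of_Icc (by linarith)
  have j1 : IntervalIntegrable (fun s => g (c - s)) volume 0 (κ / 2) := by
    simpa using (i1.comp_sub_left c).symm
  have j2 : IntervalIntegrable (fun s => g (c + s)) volume 0 (κ / 2) := by
    simpa using i2.comp_add_left c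
  have e : (∫ x in (c - κ / 2)..(c + κ / 2), g x) - κ * g c
      = ∫ s in (0 : ℝ)..(κ / 2), (g (c + s) + g (c - s) - (2 : ℝ) • g c) := by
    rw [intervalIntegral.integral_sub (j2.add j1) (by simp), intervalIntegral.integral_add j2 j1,
      intervalIntegral.integral_comp_add_left (fun x => g x),
      intervalIntegral.integral_comp_sub_left (fun x => g x), intervalIntegral.integral_const,
      ← intervalIntegral.integral_add_adjacent_intervals i1 i2]
    simp only [add_zero, sub_zero, smul_eq_mul]
    ring
  rw [e, ← Real.norm_eq_abs]
  refine (intervalIntegral.norm_integral_le_of_norm_le_const (C := 2 * B * (κ / 2) ^ 2) ?_).trans ?_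
  · intro s hs
    rw [uIoc_of_le (by linarith)] at hs
    refine (norm_second_difference_le hs.1.le (fun x hx => h1 x ?_) (fun x hx => h2 x ?_)
      (fun x hx => hB x ?_)).trans ?_
    · exact ⟨by linarith [hs.2, hx.1], by linarith [hs.2, hx.2]⟩
    · exact ⟨by linarith [hs.2, hx.1], by linarith [hs.2, hx.2]⟩
    · exact ⟨by linarith [hs.2, hx.1], by linarith [hs.2, hx.2]⟩
    · have := pow_le_pow_left₀ hs.1.le hs.2 2
      gcongr
  · rw [sub_zero, abs_of_nonneg (by linarith)]
    have : 0 ≤ B * κ ^ 3 := by positivity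
    nlinarith

/-- The dispersion relation of the lattice: `∑ m ^ (-α) (1 - sinc²(mκ/2))` agrees with its leading
term, a multiple of `κ ^ (α - 1)`, up to an error `O(κ²)`. -/
lemma exists_dispersion_sum_error {α : ℝ} (hα : α ∈ Ioo (1 : ℝ) 3) :
    ∃ C : ℝ, 0 ≤ C ∧ ∀ κ : ℝ, 0 < κ →
      |∑' n : ℕ, ((n : ℝ) + 1) ^ (-α) * (1 - Real.sinc (((n : ℝ) + 1) * κ / 2) ^ 2)
        - dispersionConst α * κ ^ (α - 1)| ≤ C * κ ^ 2 := by
  obtain ⟨h1α, h3α⟩ := hα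
  obtain ⟨B, hB0, g', g'', hg⟩ := exists_deriv_dispersionProfile (α := α) (by linarith)
  have hgi := integrableOn_dispersionProfile ⟨h1α, h3α⟩
  set Z := ∑' n : ℕ, ((n : ℝ) + 1) ^ (-α) with hZ
  have hZs := summable_rpow_neg h1α
  have hZ0 : 0 ≤ Z := tsum_nonneg fun n => by positivity
  refine ⟨B * 2 ^ α * Z + 1 / (3 - α), by
    have : 0 < 3 - α := by linarith
    positivity, ?_⟩
  intro κ hκ
  have hcells := hasSum_integral_midpoint_cells hgi hκ
  have hterm : ∀ n : ℕ, ((n : ℝ) + 1) ^ (-α) * (1 - Real.sinc (((n : ℝ) + 1) * κ / 2) ^ 2)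
      = κ ^ (α - 1) * (κ * dispersionProfile α (((n : ℝ) + 1) * κ)) := by
    intro n
    rw [dispersionProfile_eq (by positivity), Real.mul_rpow (by positivity) hκ.le,
      Real.rpow_sub_one hκ.ne', Real.rpow_neg (by positivity)]
    have := (Real.rpow_pos_of_pos hκ α).ne'
    field_simp
  have herr : ∀ n : ℕ, ‖κ * dispersionProfile α (((n : ℝ) + 1) * κ)
      - ∫ s in Ioc (((n : ℝ) + 1 / 2) * κ) (((n : ℝ) + 3 / 2) * κ), dispersionProfile α s‖
      ≤ (B * 2 ^ α * κ ^ (3 - α)) * ((n : ℝ) + 1) ^ (-α) := by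
    intro n
    have hn : (0 : ℝ) ≤ n := n.cast_nonneg
    have l1 : ((n : ℝ) + 1 / 2) * κ = ((n : ℝ) + 1) * κ - κ / 2 := by ring
    have l2 : ((n : ℝ) + 3 / 2) * κ = ((n : ℝ) + 1) * κ + κ / 2 := by ring
    have hpos : ∀ x ∈ Icc (((n : ℝ) + 1) * κ - κ / 2) (((n : ℝ) + 1) * κ + κ / 2), 0 < x := by
      intro x hx
      refine lt_of_lt_of_le ?_ hx.1
      nlinarith
    rw [l1, l2, ← intervalIntegral.integral_of_le (by linarith), norm_sub_rev, Real.norm_eq_abs]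
    refine (abs_integral_cell_sub_le (B := B * (((n : ℝ) + 1) * κ / 2) ^ (-α)) hκ.le
      (fun x hx => (hg x (hpos x hx)).1) (fun x hx => (hg x (hpos x hx)).2.1)
      (fun x hx => (hg x (hpos x hx)).2.2.trans ?_)).trans (le_of_eq ?_)
    · refine mul_le_mul_of_nonneg_left ?_ hB0
      refine Real.rpow_le_rpow_of_nonpos (by positivity) ?_ (by linarith)
      refine le_trans ?_ hx.1
      nlinarith
    · rw [Real.div_rpow (by positivity) (by norm_num), Real.mul_rpow (by positivity) hκ.le,
        Real.rpow_neg (by norm_num : (0 : ℝ) ≤ 2), show (3 - α : ℝ) = -α + (3 : ℕ) by push_cast; ring,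
        Real.rpow_add_natCast hκ.ne']
      field_simp
  have herrs : Summable fun n : ℕ => κ * dispersionProfile α (((n : ℝ) + 1) * κ)
      - ∫ s in Ioc (((n : ℝ) + 1 / 2) * κ) (((n : ℝ) + 3 / 2) * κ), dispersionProfile α s :=
    .of_norm_bounded (hZs.mul_left _) herr
  have herrle := tsum_of_norm_bounded (hZs.hasSum.mul_left (B * 2 ^ α * κ ^ (3 - α))) herr
  have hsum : Summable fun n : ℕ => κ * dispersionProfile α (((n : ℝ) + 1) * κ) := by
    simpa using herrs.add hcells.summable
  have htail : |∫ s in Ioc 0 (κ / 2), dispersionProfile α s| ≤ κ ^ (3 - α) / (3 - α) := by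
    rw [abs_of_nonneg (setIntegral_nonneg measurableSet_Ioc fun s hs => dispersionProfile_nonneg hs.1.le)]
    calc ∫ s in Ioc 0 (κ / 2), dispersionProfile α s ≤ ∫ s in Ioc 0 κ, dispersionProfile α s := by
          apply setIntegral_mono_set (hgi.mono_set fun s hs => hs.1)
          · exact (ae_restrict_iff' measurableSet_Ioc).2
              (ae_of_all _ fun s hs => dispersionProfile_nonneg hs.1.le)
          · exact (Ioc_subset_Ioc_right (by linarith)).eventuallyLE
      _ ≤ ∫ s in Ioc 0 κ, s ^ (2 - α) := by
          apply setIntegral_mono_on (hgi.mono_set fun s hs => hs.1)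
            (integrableOn_rpow_Ioc (by linarith) hκ.le) measurableSet_Ioc
          exact fun s hs => (dispersionProfile_le_tailWeight hs.1).trans (tailWeight_le_rpow hs.1)
      _ = κ ^ (3 - α) / (3 - α) := by
          rw [← intervalIntegral.integral_of_le hκ.le, integral_rpow (Or.inl (by linarith))]
          rw [show 2 - α + 1 = 3 - α by ring, Real.zero_rpow (by linarith), sub_zero]
  have hsplit : dispersionConst α = (∫ s in Ioc 0 (κ / 2), dispersionProfile α s)
      + ∫ s in Ioi (κ / 2), dispersionProfile α s := by
    unfold dispersionConst
    rw [← setIntegral_union (Ioc_disjoint_Ioi le_rfl) measurableSet_Ioi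
      (hgi.mono_set fun s hs => hs.1) (hgi.mono_set (Ioi_subset_Ioi (by positivity))),
      Ioc_union_Ioi_eq_Ioi (by positivity)]
  rw [hsum.tsum_sub hcells.summable, hcells.tsum_eq, Real.norm_eq_abs] at herrle
  simp only [hterm]
  rw [tsum_mul_left, mul_comm (dispersionConst α), ← mul_sub, abs_mul,
    abs_of_pos (Real.rpow_pos_of_pos hκ _)]
  have e3 : κ ^ (α - 1) * κ ^ (3 - α) = κ ^ 2 := by
    rw [← Real.rpow_add hκ, show α - 1 + (3 - α) = (2 : ℕ) by push_cast; ring, Real.rpow_natCast]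
  have hfin : |∑' n : ℕ, κ * dispersionProfile α (((n : ℝ) + 1) * κ) - dispersionConst α|
      ≤ (B * 2 ^ α * Z + 1 / (3 - α)) * κ ^ (3 - α) := by
    rw [hsplit]
    rw [abs_le] at herrle htail ⊢
    have : (B * 2 ^ α * Z + 1 / (3 - α)) * κ ^ (3 - α)
      = B * 2 ^ α * κ ^ (3 - α) * Z + κ ^ (3 - α) / (3 - α) := by ring
    constructor <;> linarith [herrle.1, herrle.2, htail.1, htail.2]
  calc _ ≤ κ ^ (α - 1) * ((B * 2 ^ α * Z + 1 / (3 - α)) * κ ^ (3 - α)) := by gcongr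
    _ = (B * 2 ^ α * Z + 1 / (3 - α)) * (κ ^ (α - 1) * κ ^ (3 - α)) := by ring
    _ = _ := by rw [e3]

/-! ### The singular integral for `|k| ^ (α - 1)` -/

/-- The constant in `∫₀^∞ (1 - cos(ks)) s ^ (-α) ds = fracConst α * |k| ^ (α - 1)`. -/
def fracConst (α : ℝ) : ℝ := ∫ s in Ioi 0, s ^ (-α) * (1 - Real.cos s)

lemma one_sub_cos_le (s : ℝ) : 1 - Real.cos s ≤ 2 * min 1 (s ^ 2) := by
  rw [mul_min_of_nonneg _ _ zero_le_two]
  refine le_min (by linarith [Real.neg_one_le_cos s]) ?_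
  nlinarith [two_sub_two_cos_mem (s := s), sq_nonneg s]

lemma integrableOn_rpow_mul_of_abs_le {α : ℝ} (hα : α ∈ Ioo (1 : ℝ) 3) {G : ℝ → ℝ}
    (hG : Continuous G) {B : ℝ} (hB : ∀ s, 0 < s → |G s| ≤ B * min 1 (s ^ 2)) :
    IntegrableOn (fun s => s ^ (-α) * G s) (Ioi 0) := by
  refine ((integrableOn_tailWeight hα).const_mul B).mono' ?_ ?_
  · refine ContinuousOn.aestronglyMeasurable (fun s hs => ?_) measurableSet_Ioi
    exact ((Real.continuousAt_rpow_const _ _ (Or.inl (mem_Ioi.1 hs).ne')).mul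
      hG.continuousAt).continuousWithinAt
  · refine (ae_restrict_iff' measurableSet_Ioi).2 (ae_of_all _ fun s hs => ?_)
    have h0 : 0 ≤ s ^ (-α) := Real.rpow_nonneg (mem_Ioi.1 hs).le _
    rw [norm_mul, Real.norm_of_nonneg h0, Real.norm_eq_abs]
    calc s ^ (-α) * |G s| ≤ s ^ (-α) * (B * min 1 (s ^ 2)) := by gcongr; exact hB s hs
      _ = B * tailWeight α s := by unfold tailWeight; ring

lemma fracConst_pos {α : ℝ} (hα : α ∈ Ioo (1 : ℝ) 3) : 0 < fracConst α := by
  have hi : IntegrableOn (fun s => s ^ (-α) * (1 - Real.cos s)) (Ioi 0) :=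
    integrableOn_rpow_mul_of_abs_le hα (by fun_prop) (B := 2) fun s _ => by
      rw [abs_of_nonneg (by linarith [Real.cos_le_one s])]
      exact one_sub_cos_le s
  have h0 : 0 ≤ᵐ[volume.restrict (Ioi 0)] fun s : ℝ => s ^ (-α) * (1 - Real.cos s) :=
    (ae_restrict_iff' measurableSet_Ioi).2 (ae_of_all _ fun s hs =>
      mul_nonneg (Real.rpow_nonneg (mem_Ioi.1 hs).le _) (by linarith [Real.cos_le_one s]))
  rw [fracConst, setIntegral_pos_iff_support_of_nonneg_ae h0 hi]
  refine lt_of_lt_of_le ?_ (measure_mono (s := Ioo (0 : ℝ) 1) ?_)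
  · simp
  · intro s hs
    refine ⟨?_, hs.1⟩
    rw [Function.mem_support]
    have h1 : 0 < s ^ (-α) := Real.rpow_pos_of_pos hs.1 _
    have h2 : Real.cos s < 1 := by
      rw [← Real.cos_zero]
      exact Real.cos_lt_cos_of_nonneg_of_le_pi le_rfl (by linarith [hs.2, Real.pi_gt_three]) hs.1
    have h3 : 0 < 1 - Real.cos s := by linarith
    positivity

lemma integral_rpow_mul_one_sub_cos {α : ℝ} (hα : α ∈ Ioo (1 : ℝ) 3) (k : ℝ) :
    ∫ s in Ioi 0, s ^ (-α) * (1 - Real.cos (k * s)) = fracConst α * |k| ^ (α - 1) := by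
  rcases eq_or_ne k 0 with rfl | hk
  · have : α - 1 ≠ 0 := by linarith [hα.1]
    simp [Real.zero_rpow this]
  · have hk' : 0 < |k| := abs_pos.2 hk
    have := integral_comp_mul_left_Ioi (fun s => s ^ (-α) * (1 - Real.cos s)) 0 hk'
    rw [mul_zero, eq_inv_smul_iff₀ hk'.ne', smul_eq_mul] at this
    rw [fracConst, ← this, mul_comm, ← mul_assoc, ← integral_const_mul]
    refine setIntegral_congr_fun measurableSet_Ioi fun s hs => ?_
    have hs' := (mem_Ioi.1 hs)
    rw [Real.mul_rpow hk'.le hs'.le, show |k| * s = |k * s| by rw [abs_mul, abs_of_pos hs'],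
      Real.cos_abs, Real.rpow_sub_one hk'.ne', Real.rpow_neg hk'.le]
    have := (Real.rpow_pos_of_pos hk' α).ne'
    field_simp

/-! ### Square-summable families -/

section EllTwoFacts

variable {ι : Type*}

lemma lp_two_hasSum_sq (x : lp (fun _ : ι => ℝ) 2) : HasSum (fun i => x i ^ 2) (‖x‖ ^ 2) := by
  have h := lp.hasSum_inner (𝕜 := ℝ) x x
  rw [real_inner_self_eq_norm_sq] at h
  simpa [pow_two] using h

lemma memℓp_two_of_summable_sq {f : ι → ℝ} (h : Summable fun i => f i ^ 2) : Memℓp f 2 := by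
  apply memℓp_gen
  simpa using h

lemma lp_two_abs_apply_le (x : lp (fun _ : ι => ℝ) 2) (i : ι) : |x i| ≤ ‖x‖ := by
  simpa using lp.norm_apply_le_norm (by norm_num) x i

lemma memℓp_two_of_abs_le {f : ι → ℝ} (y : lp (fun _ : ι => ℝ) 2) {C : ℝ}
    (h : ∀ i, |f i| ≤ C * |y i|) : Memℓp f 2 := by
  apply memℓp_two_of_summable_sq
  refine .of_nonneg_of_le (fun i => sq_nonneg _) (fun i => ?_)
    ((lp_two_hasSum_sq y).summable.mul_left (C ^ 2))
  have := pow_le_pow_left₀ (abs_nonneg _) (h i) 2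
  rwa [sq_abs, mul_pow, sq_abs] at this

lemma lp_two_norm_le_of_hasSum {x : lp (fun _ : ι => ℝ) 2} {C : ℝ} (hC : 0 ≤ C)
    (h : ∀ F : Finset ι, ∑ i ∈ F, x i ^ 2 ≤ C ^ 2) : ‖x‖ ≤ C := by
  have := (lp_two_hasSum_sq x).summable.tsum_le_of_sum_le h
  rw [(lp_two_hasSum_sq x).tsum_eq] at this
  exact (pow_le_pow_iff_left₀ (norm_nonneg _) hC two_ne_zero).1 this

lemma lp_two_norm_le_of_abs_le {x y : lp (fun _ : ι => ℝ) 2} {C : ℝ} (hC : 0 ≤ C)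
    (h : ∀ i, |x i| ≤ C * |y i|) : ‖x‖ ≤ C * ‖y‖ := by
  have : ‖x‖ ^ 2 ≤ (C * ‖y‖) ^ 2 := by
    rw [mul_pow]
    refine hasSum_le (fun i => ?_) (lp_two_hasSum_sq x) ((lp_two_hasSum_sq y).mul_left (C ^ 2))
    have := pow_le_pow_left₀ (abs_nonneg _) (h i) 2
    rwa [sq_abs, mul_pow, sq_abs] at this
  exact (pow_le_pow_iff_left₀ (norm_nonneg _) (by positivity) two_ne_zero).1 this

lemma lp_two_hasSum_inner (x y : lp (fun _ : ι => ℝ) 2) :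
    HasSum (fun i => x i * y i) (inner ℝ x y) := by
  have h := lp.hasSum_inner (𝕜 := ℝ) x y
  simpa [mul_comm] using h

end EllTwoFacts

/-! ### Shifts, averages and bond strains -/

lemma hasSum_sq_shift (n : ℤ) (x : EllTwo) : HasSum (fun j => x (j + n) ^ 2) (‖x‖ ^ 2) :=
  ((Equiv.addRight n).hasSum_iff (f := fun j => x j ^ 2)).2 (lp_two_hasSum_sq x)

/-- The shift `(T^n x)_j = x_{j+n}` on `ℓ²(ℤ)`. -/
def ellShift (n : ℤ) : EllTwo →ₗᵢ[ℝ] EllTwo where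
  toFun x := ⟨fun j => x (j + n), memℓp_two_of_summable_sq (hasSum_sq_shift n x).summable⟩
  map_add' x y := rfl
  map_smul' c x := rfl
  norm_map' x := by
    have h1 := lp_two_hasSum_sq (⟨fun j => x (j + n),
      memℓp_two_of_summable_sq (hasSum_sq_shift n x).summable⟩ : EllTwo)
    have := h1.unique (hasSum_sq_shift n x)
    exact (pow_left_inj₀ (norm_nonneg _) (norm_nonneg _) two_ne_zero).1 this

/-- The difference operator `(D x)_j = x_{j+1} - x_j`. -/
def ellDiff : EllTwo →L[ℝ] EllTwo :=
  (ellShift 1).toContinuousLinearMap - ContinuousLinearMap.id ℝ EllTwo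

lemma ellDiff_apply (x : EllTwo) (j : ℤ) : ellDiff x j = x (j + 1) - x j := rfl

/-- The average of `n + 1` consecutive terms, `(x_j + ⋯ + x_{j+n}) / (n + 1)`. -/
def ellAvg (n : ℕ) : EllTwo →L[ℝ] EllTwo :=
  ((n : ℝ) + 1)⁻¹ • ∑ i ∈ Finset.range (n + 1), (ellShift i).toContinuousLinearMap

lemma ellAvg_apply (n : ℕ) (x : EllTwo) (j : ℤ) :
    ellAvg n x j = ((n : ℝ) + 1)⁻¹ * ∑ i ∈ Finset.range (n + 1), x (j + i) := by
  simp only [ellAvg, smul_apply, sum_apply, lp.coeFn_smul,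
    lp.coeFn_sum, Pi.smul_apply, Finset.sum_apply, smul_eq_mul]
  rfl

lemma norm_ellAvg_le (n : ℕ) (x : EllTwo) : ‖ellAvg n x‖ ≤ ‖x‖ := by
  have hn : (0 : ℝ) < (n : ℝ) + 1 := by positivity
  simp only [ellAvg, smul_apply, sum_apply, norm_smul]
  rw [Real.norm_of_nonneg (by positivity), inv_mul_le_iff₀ hn]
  refine (norm_sum_le _ _).trans (le_of_eq ?_)
  simp

lemma abs_ellAvg_apply_le {n : ℕ} {x : EllTwo} {B : ℝ} (hB : ∀ j, |x j| ≤ B) (j : ℤ) :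
    |ellAvg n x j| ≤ B := by
  have hn : (0 : ℝ) < (n : ℝ) + 1 := by positivity
  rw [ellAvg_apply, abs_mul, abs_of_pos (inv_pos.2 hn), inv_mul_le_iff₀ hn]
  refine (Finset.abs_sum_le_sum_abs _ _).trans ?_
  refine (Finset.sum_le_sum fun (i : ℕ) _ => hB (j + i)).trans (le_of_eq ?_)
  simp

lemma ellAvg_zero (x : EllTwo) : ellAvg 0 x = x := by
  ext j
  simp [ellAvg_apply]

lemma ellAvg_ellDiff_apply (n : ℕ) (x : EllTwo) (j : ℤ) :
    ellAvg n (ellDiff x) j = ((n : ℝ) + 1)⁻¹ * (x (j + (n + 1)) - x j) := by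
  rw [ellAvg_apply]
  congr 1
  simp only [ellDiff_apply]
  have := Finset.sum_range_sub (fun i : ℕ => x (j + i)) (n + 1)
  simp only [Nat.cast_add, Nat.cast_one, Nat.cast_zero, add_zero] at this
  rw [← this]
  refine Finset.sum_congr rfl fun i _ => ?_
  rw [add_assoc]

/-- Square-summable families indexed by the bonds: `(n, j)` is the bond between the particles `j` and
`j + n + 1`. -/
abbrev BondTwo : Type := lp (fun _ : ℕ × ℤ => ℝ) 2

/-- The weight `m ^ (-α/2)` of the bonds of length `m = n + 1`. -/
def bondWeight (α : ℝ) (n : ℕ) : ℝ := ((n : ℝ) + 1) ^ (-(α / 2))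

lemma bondWeight_pos (α : ℝ) (n : ℕ) : 0 < bondWeight α n := by unfold bondWeight; positivity

lemma bondWeight_sq (α : ℝ) (n : ℕ) : bondWeight α n ^ 2 = ((n : ℝ) + 1) ^ (-α) := by
  rw [bondWeight, ← Real.rpow_natCast, ← Real.rpow_mul (by positivity)]
  congr 1
  push_cast
  ring

lemma zetaSum_eq (α : ℝ) : zetaSum α = ∑' n : ℕ, ((n : ℝ) + 1) ^ (-α) := by
  unfold zetaSum
  congr 1
  ext n
  rw [Real.rpow_neg (by positivity), one_div]

lemma one_le_zetaSum {α : ℝ} (hα : 1 < α) : 1 ≤ zetaSum α := by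
  rw [zetaSum_eq]
  have := (summable_rpow_neg hα).le_tsum 0 (fun n _ => by positivity)
  simpa using this

lemma summable_bond_sq {α : ℝ} (hα : 1 < α) (x : EllTwo) :
    Summable (fun i : ℕ × ℤ => (bondWeight α i.1 * ellAvg i.1 x i.2) ^ 2) ∧
    ∑' i : ℕ × ℤ, (bondWeight α i.1 * ellAvg i.1 x i.2) ^ 2 ≤ zetaSum α * ‖x‖ ^ 2 := by
  have hfib : ∀ n, HasSum (fun j => (bondWeight α n * ellAvg n x j) ^ 2)
      (((n : ℝ) + 1) ^ (-α) * ‖ellAvg n x‖ ^ 2) := by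
    intro n
    simpa only [mul_pow, bondWeight_sq] using (lp_two_hasSum_sq (ellAvg n x)).mul_left _
  have hle : ∀ n : ℕ, ((n : ℝ) + 1) ^ (-α) * ‖ellAvg n x‖ ^ 2 ≤ ((n : ℝ) + 1) ^ (-α) * ‖x‖ ^ 2 := by
    intro n
    have := norm_ellAvg_le n x
    gcongr
  have hout : Summable fun n : ℕ => ((n : ℝ) + 1) ^ (-α) * ‖ellAvg n x‖ ^ 2 :=
    .of_nonneg_of_le (fun n => by positivity) hle ((summable_rpow_neg hα).mul_right _)
  have hs : Summable (fun i : ℕ × ℤ => (bondWeight α i.1 * ellAvg i.1 x i.2) ^ 2) := by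
    rw [summable_prod_of_nonneg (fun i => sq_nonneg _)]
    refine ⟨fun n => (hfib n).summable, ?_⟩
    simpa only [(hfib _).tsum_eq] using hout
  refine ⟨hs, ?_⟩
  rw [hs.tsum_prod]
  simp only [(hfib _).tsum_eq]
  rw [zetaSum_eq, ← tsum_mul_right]
  exact hout.tsum_le_tsum hle ((summable_rpow_neg hα).mul_right _)

/-- The bond strains `m ^ (-α/2) (x_j + ⋯ + x_{j+m-1}) / m` of the relative displacements `x`. They
are square-summable for `α > 1`; the operator is set to `0` otherwise. -/
def bondStrain (α : ℝ) : EllTwo →L[ℝ] BondTwo :=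
  if hα : 1 < α then
    LinearMap.mkContinuous
      { toFun := fun x => ⟨fun i => bondWeight α i.1 * ellAvg i.1 x i.2,
          memℓp_two_of_summable_sq (summable_bond_sq hα x).1⟩
        map_add' := fun x y => by
          ext i
          simp only [map_add, lp.coeFn_add, Pi.add_apply, mul_add]
        map_smul' := fun c x => by
          ext i
          simp only [map_smul, lp.coeFn_smul, Pi.smul_apply, smul_eq_mul, RingHom.id_apply]
          ring }
      (Real.sqrt (zetaSum α)) (fun x => by
        have hz : 0 ≤ zetaSum α := zero_le_one.trans (one_le_zetaSum hα)
        refine lp_two_norm_le_of_hasSum (by positivity) fun F => ?_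
        rw [mul_pow, Real.sq_sqrt hz]
        exact ((summable_bond_sq hα x).1.sum_le_tsum F (fun i _ => sq_nonneg _)).trans
          (summable_bond_sq hα x).2)
  else 0

section Bonds

variable {α : ℝ} (hα : 1 < α)
include hα

lemma bondStrain_apply (x : EllTwo) (i : ℕ × ℤ) :
    bondStrain α x i = bondWeight α i.1 * ellAvg i.1 x i.2 := by
  simp [bondStrain, hα]

lemma norm_sq_bondStrain_le (x : EllTwo) : ‖bondStrain α x‖ ^ 2 ≤ zetaSum α * ‖x‖ ^ 2 := by
  have h := lp_two_hasSum_sq (bondStrain α x)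
  rw [← h.tsum_eq]
  simp only [bondStrain_apply hα]
  exact (summable_bond_sq hα x).2

lemma norm_le_norm_bondStrain (x : EllTwo) : ‖x‖ ≤ ‖bondStrain α x‖ := by
  refine lp_two_norm_le_of_hasSum (norm_nonneg _) fun F => ?_
  have h := lp_two_hasSum_sq (bondStrain α x)
  have := sum_le_hasSum (F.map ⟨fun j => ((0 : ℕ), j), fun a b hab => by simpa using hab⟩)
    (fun i _ => sq_nonneg _) h
  rw [Finset.sum_map] at this
  refine le_trans (Finset.sum_le_sum fun j _ => le_of_eq ?_) this
  have e : bondStrain α x (0, j) = x j := by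
    rw [bondStrain_apply hα]
    simp [ellAvg_zero, bondWeight]
  exact congrArg (· ^ 2) e.symm

lemma abs_bondStrain_apply_le {x : EllTwo} {B : ℝ} (hB : ∀ j, |x j| ≤ B) (i : ℕ × ℤ) :
    |bondStrain α x i| ≤ bondWeight α i.1 * B := by
  rw [bondStrain_apply hα, abs_mul, abs_of_pos (bondWeight_pos α _)]
  exact mul_le_mul_of_nonneg_left (abs_ellAvg_apply_le hB _) (bondWeight_pos α _).le

/-- The components of the transpose of `bondStrain ∘ ellDiff`. -/
lemma hasSum_adjoint_apply (z : BondTwo) (j : ℤ) :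
    HasSum (fun n : ℕ => bondWeight α n * ((n : ℝ) + 1)⁻¹ * (z (n, j - (n + 1)) - z (n, j)))
      ((ContinuousLinearMap.adjoint (bondStrain α ∘L ellDiff) z : EllTwo) j) := by
  set e : EllTwo := lp.single 2 j (1 : ℝ) with he
  have h1 : (ContinuousLinearMap.adjoint (bondStrain α ∘L ellDiff) z : EllTwo) j
      = inner ℝ (bondStrain α (ellDiff e)) z := by
    have := ContinuousLinearMap.adjoint_inner_right (bondStrain α ∘L ellDiff) e z
    rw [he, lp.inner_single_left] at this
    simpa using this
  rw [h1]
  have h2 := lp_two_hasSum_inner (bondStrain α (ellDiff e)) z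
  refine h2.prod_fiberwise fun n => ?_
  simp only [bondStrain_apply hα, ellAvg_ellDiff_apply]
  have e1 : ∀ i : ℤ, e i = if i = j then 1 else 0 := by
    intro i
    rw [he, lp.coeFn_single]
    by_cases h : i = j
    · subst h; simp
    · simp [h]
  have s1 : HasSum (fun i : ℤ => e (i + (n + 1)) * z (n, i)) (z (n, j - (n + 1))) := by
    convert! hasSum_ite_eq (j - ((n : ℤ) + 1)) (z (n, j - (n + 1))) using 2 with i
    rw [e1]
    by_cases h : i + ((n : ℤ) + 1) = j
    · rw [if_pos h, if_pos (by omega), one_mul, ← h]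
      simp
    · rw [if_neg h, if_neg (by omega), zero_mul]
  have s2 : HasSum (fun i : ℤ => e i * z (n, i)) (z (n, j)) := by
    convert! hasSum_ite_eq j (z (n, j)) using 2 with i
    rw [e1]
    by_cases h : i = j
    · subst h; simp
    · simp [h]
  convert! (s1.sub s2).mul_left (bondWeight α n * ((n : ℝ) + 1)⁻¹) using 2 with i
  ring

end Bonds

/-! ### Uniformly convex interaction potentials -/

/-- A force law `f` with `f 0 = 0` and derivative `f'` between the positive constants `c` and `C`,
where `f'` is Lipschitz with constant `L`. -/
structure IsForce (f f' : ℝ → ℝ) (c C L : ℝ) : Prop where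
  zero : f 0 = 0
  deriv : ∀ y, HasDerivAt f (f' y) y
  pos : 0 < c
  lower : ∀ y, c ≤ f' y
  upper : ∀ y, f' y ≤ C
  lip : ∀ x y, |f' x - f' y| ≤ L * |x - y|

namespace IsForce

variable {f f' : ℝ → ℝ} {c C L : ℝ} (hf : IsForce f f' c C L)
include hf

lemma continuous : Continuous f := continuous_iff_continuousAt.2 fun y => (hf.deriv y).continuousAt

lemma C_pos : 0 < C := hf.pos.trans_le ((hf.lower 0).trans (hf.upper 0))

lemma L_nonneg : 0 ≤ L := by
  have := (abs_nonneg _).trans (hf.lip 1 0)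
  simpa using this

lemma abs_deriv_le (y : ℝ) : |f' y| ≤ C := by
  rw [abs_of_pos (hf.pos.trans_le (hf.lower y))]
  exact hf.upper y

lemma abs_sub_le (x y : ℝ) : |f x - f y| ≤ C * |x - y| :=
  convex_univ.norm_image_sub_le_of_norm_hasDerivWithin_le
    (fun x _ => (hf.deriv x).hasDerivWithinAt) (fun x _ => hf.abs_deriv_le x) (mem_univ y) (mem_univ x)

lemma abs_taylor_le (y k : ℝ) : |f (y + k) - f y - f' y * k| ≤ L * k ^ 2 := by
  have := (convex_uIcc y (y + k)).norm_image_sub_le_of_norm_hasDerivWithin_le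
    (f := fun x => f x - f' y * x) (f' := fun x => f' x - f' y) (C := L * |k|)
    (fun x _ => by
      simpa using! ((hf.deriv x).sub ((hasDerivAt_id x).const_mul (f' y))).hasDerivWithinAt)
    (fun x hx => (hf.lip x y).trans (mul_le_mul_of_nonneg_left (by
      have := abs_sub_left_of_mem_uIcc hx
      simpa [abs_sub_comm] using this) hf.L_nonneg)) left_mem_uIcc right_mem_uIcc
  simp only [Real.norm_eq_abs, add_sub_cancel_left] at this
  rw [mul_assoc, ← abs_mul, ← pow_two, abs_of_nonneg (sq_nonneg k)] at this
  refine le_trans (le_of_eq ?_) this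
  congr 1
  ring

lemma strong_mono (x y : ℝ) : c * (x - y) ^ 2 ≤ (f x - f y) * (x - y) := by
  have key : ∀ x y, y ≤ x → c * (x - y) ≤ f x - f y := by
    intro x y h
    have hmono : Monotone fun x => f x - c * x := by
      apply monotone_of_hasDerivAt_nonneg (f' := fun x => f' x - c)
      · intro x
        simpa using! (hf.deriv x).sub ((hasDerivAt_id x).const_mul c)
      · intro x
        simpa using hf.lower x
    have := hmono h
    simp only at this
    linarith
  rcases le_total y x with h | h
  · nlinarith [key x y h]
  · nlinarith [key y x h]

/-- The convexity bounds for the potential `y ↦ ∫₀^y f`. -/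
lemma potential_bounds (a e : ℝ) :
    c / 2 * e ^ 2 ≤ (∫ x in (0 : ℝ)..(a + e), f x) - (∫ x in (0 : ℝ)..a, f x) - f a * e ∧
    (∫ x in (0 : ℝ)..(a + e), f x) - (∫ x in (0 : ℝ)..a, f x) - f a * e ≤ C / 2 * e ^ 2 := by
  have hc := hf.continuous
  have hi : ∀ a b : ℝ, IntervalIntegrable f volume a b := fun a b => hc.intervalIntegrable a b
  have e1 : (∫ x in (0 : ℝ)..(a + e), f x) - (∫ x in (0 : ℝ)..a, f x) - f a * e
      = ∫ t in (0 : ℝ)..1, (f (a + t * e) - f a) * e := by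
    rw [intervalIntegral.integral_interval_sub_left (hi _ _) (hi _ _), intervalIntegral.integral_mul_const,
      intervalIntegral.integral_sub (Continuous.intervalIntegrable (by fun_prop) _ _) (by simp),
      sub_mul, mul_comm (∫ x in (0 : ℝ)..1, f (a + x * e)) e]
    have := intervalIntegral.smul_integral_comp_add_mul (a := 0) (b := 1) f e a
    simp only [smul_eq_mul, mul_zero, add_zero, mul_one] at this
    simp only [mul_comm _ e] at this ⊢
    rw [this]
    simp
  have hsq : ∀ b : ℝ, ∫ t in (0 : ℝ)..1, b * e ^ 2 * t = b / 2 * e ^ 2 := by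
    intro b
    rw [intervalIntegral.integral_const_mul, integral_id]
    ring
  have hint : IntervalIntegrable (fun t => (f (a + t * e) - f a) * e) volume 0 1 :=
    Continuous.intervalIntegrable (by fun_prop) _ _
  rw [e1, ← hsq, ← hsq]
  constructor
  · apply intervalIntegral.integral_mono_on zero_le_one
      (Continuous.intervalIntegrable (by fun_prop) _ _) hint
    intro t ht
    rcases eq_or_lt_of_le ht.1 with h | h
    · simp [← h]
    · have := hf.strong_mono (a + t * e) a
      rw [add_sub_cancel_left] at this
      have h2 : t * (c * e ^ 2 * t) ≤ t * ((f (a + t * e) - f a) * e) := by linarith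
      exact le_of_mul_le_mul_left h2 h
  · apply intervalIntegral.integral_mono_on zero_le_one hint
      (Continuous.intervalIntegrable (by fun_prop) _ _)
    intro t ht
    have := hf.abs_sub_le (a + t * e) a
    rw [add_sub_cancel_left, abs_mul, abs_of_nonneg ht.1] at this
    calc (f (a + t * e) - f a) * e ≤ |(f (a + t * e) - f a)| * |e| := by
          rw [← abs_mul]; exact le_abs_self _
      _ ≤ C * (t * |e|) * |e| := by gcongr
      _ = C * e ^ 2 * t := by rw [← sq_abs e]; ring

/-! ### Forces and potential energy on the bonds -/

lemma abs_weighted_sub_le {s : ℝ} (hs : 0 < s) (x y : ℝ) :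
    |s * f (x / s) - s * f (y / s)| ≤ C * |x - y| := by
  rw [← mul_sub, abs_mul, abs_of_pos hs]
  calc s * |f (x / s) - f (y / s)| ≤ s * (C * |x / s - y / s|) := by
        gcongr; exact hf.abs_sub_le _ _
    _ = C * |x - y| := by
        rw [← sub_div, abs_div, abs_of_pos hs]; field_simp

omit hf in
/-- The forces in the bonds as a function of the strains: `f` rescaled by the weight of the bond. -/
def bondForce (hf : IsForce f f' c C L) (α : ℝ) (y : BondTwo) : BondTwo :=
  ⟨fun i => bondWeight α i.1 * f (y i / bondWeight α i.1),
    memℓp_two_of_abs_le y (C := C) fun i => by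
      have := hf.abs_weighted_sub_le (bondWeight_pos α i.1) (y i) 0
      simpa [hf.zero] using this⟩

lemma bondForce_apply (α : ℝ) (y : BondTwo) (i : ℕ × ℤ) :
    hf.bondForce α y i = bondWeight α i.1 * f (y i / bondWeight α i.1) := rfl

lemma norm_bondForce_sub_le (α : ℝ) (y z : BondTwo) :
    ‖hf.bondForce α y - hf.bondForce α z‖ ≤ C * ‖y - z‖ :=
  lp_two_norm_le_of_abs_le hf.C_pos.le fun i =>
    hf.abs_weighted_sub_le (bondWeight_pos α i.1) (y i) (z i)

omit hf in
/-- The potential energy of the bonds. -/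
def bondEnergy (f : ℝ → ℝ) (α : ℝ) (y : BondTwo) : ℝ :=
  ∑' i : ℕ × ℤ, bondWeight α i.1 ^ 2 * ∫ x in (0 : ℝ)..(y i / bondWeight α i.1), f x

lemma weighted_potential_bounds {s : ℝ} (hs : 0 < s) (a e : ℝ) :
    c / 2 * e ^ 2 ≤ s ^ 2 * (∫ x in (0 : ℝ)..((a + e) / s), f x) - s ^ 2 * (∫ x in (0 : ℝ)..(a / s), f x)
      - s * f (a / s) * e ∧
    s ^ 2 * (∫ x in (0 : ℝ)..((a + e) / s), f x) - s ^ 2 * (∫ x in (0 : ℝ)..(a / s), f x)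
      - s * f (a / s) * e ≤ C / 2 * e ^ 2 := by
  obtain ⟨h1, h2⟩ := hf.potential_bounds (a / s) (e / s)
  rw [← add_div] at h1 h2
  have hs2 : 0 < s ^ 2 := by positivity
  have g1 := mul_le_mul_of_nonneg_left h1 hs2.le
  have g2 := mul_le_mul_of_nonneg_left h2 hs2.le
  have e1 : ∀ b : ℝ, s ^ 2 * (b / 2 * (e / s) ^ 2) = b / 2 * e ^ 2 := by
    intro b; field_simp
  have e2 : s ^ 2 * (f (a / s) * (e / s)) = s * f (a / s) * e := by field_simp
  rw [e1, mul_sub, mul_sub, e2] at g1 g2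
  exact ⟨g1, g2⟩

lemma hasSum_bondEnergy (α : ℝ) (y : BondTwo) :
    HasSum (fun i : ℕ × ℤ => bondWeight α i.1 ^ 2 * ∫ x in (0 : ℝ)..(y i / bondWeight α i.1), f x)
      (bondEnergy f α y) := by
  apply Summable.hasSum
  refine .of_norm_bounded ((lp_two_hasSum_sq y).summable.mul_left (C / 2)) fun i => ?_
  obtain ⟨h1, h2⟩ := hf.weighted_potential_bounds (bondWeight_pos α i.1) 0 (y i)
  simp only [zero_add, zero_div, intervalIntegral.integral_same, mul_zero, sub_zero, hf.zero,
    zero_mul] at h1 h2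
  rw [Real.norm_of_nonneg (le_trans (mul_nonneg (by linarith [hf.pos]) (sq_nonneg _)) h1)]
  exact h2

lemma bondEnergy_bounds (α : ℝ) (y k : BondTwo) :
    c / 2 * ‖k‖ ^ 2 ≤ bondEnergy f α (y + k) - bondEnergy f α y - inner ℝ (hf.bondForce α y) k ∧
    bondEnergy f α (y + k) - bondEnergy f α y - inner ℝ (hf.bondForce α y) k ≤ C / 2 * ‖k‖ ^ 2 := by
  have hs := ((hf.hasSum_bondEnergy α (y + k)).sub (hf.hasSum_bondEnergy α y)).sub
    (lp_two_hasSum_inner (hf.bondForce α y) k)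
  have hk := lp_two_hasSum_sq k
  exact ⟨hasSum_le (fun i => (hf.weighted_potential_bounds (bondWeight_pos α i.1) (y i) (k i)).1)
      (hk.mul_left _) hs,
    hasSum_le (fun i => (hf.weighted_potential_bounds (bondWeight_pos α i.1) (y i) (k i)).2)
      hs (hk.mul_left _)⟩

omit hf in
lemma hasFDerivAt_of_quadratic_remainder {E F : Type*} [NormedAddCommGroup E] [NormedSpace ℝ E]
    [NormedAddCommGroup F] [NormedSpace ℝ F] {g : E → F} {A : E →L[ℝ] F} {x : E} {B : ℝ}
    (h : ∀ k, ‖g (x + k) - g x - A k‖ ≤ B * ‖k‖ ^ 2) : HasFDerivAt g A x := by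
  rw [hasFDerivAt_iff_isLittleO_nhds_zero]
  have h1 : (fun k => g (x + k) - g x - A k) =O[nhds 0] fun k => ‖k‖ ^ 2 :=
    Asymptotics.IsBigO.of_bound B (.of_forall fun k => by simpa using h k)
  refine h1.trans_isLittleO ?_
  have := Asymptotics.isLittleO_pow_id (𝕜 := ℝ) (n := 2) (by norm_num)
  have h2 := (this.comp_tendsto (continuous_norm.tendsto' (0 : E) 0 (by simp)))
  exact h2.of_norm_right

lemma hasFDerivAt_bondEnergy (α : ℝ) (y : BondTwo) :
    HasFDerivAt (bondEnergy f α) (innerSL ℝ (hf.bondForce α y)) y := by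
  refine hasFDerivAt_of_quadratic_remainder (B := C / 2) fun k => ?_
  obtain ⟨h1, h2⟩ := hf.bondEnergy_bounds α y k
  rw [innerSL_apply_apply, Real.norm_of_nonneg (le_trans ?_ h1)]
  · exact h2
  · have := hf.pos
    positivity

omit hf in
/-- The derivative of the bond forces. -/
def bondForceDeriv (hf : IsForce f f' c C L) (α : ℝ) (y : BondTwo) : BondTwo →L[ℝ] BondTwo :=
  LinearMap.mkContinuous
    { toFun := fun k => ⟨fun i => f' (y i / bondWeight α i.1) * k i,
        memℓp_two_of_abs_le k (C := C) fun i => by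
          rw [abs_mul]
          exact mul_le_mul_of_nonneg_right (hf.abs_deriv_le _) (abs_nonneg _)⟩
      map_add' := fun x y => by
        ext i
        simp only [lp.coeFn_add, Pi.add_apply, mul_add]
      map_smul' := fun b x => by
        ext i
        simp only [lp.coeFn_smul, Pi.smul_apply, smul_eq_mul, RingHom.id_apply]
        ring }
    C (fun k => lp_two_norm_le_of_abs_le hf.C_pos.le fun i => by
        simp only [LinearMap.coe_mk, AddHom.coe_mk, abs_mul]
        exact mul_le_mul_of_nonneg_right (hf.abs_deriv_le _) (abs_nonneg _))

lemma bondForceDeriv_apply (α : ℝ) (y k : BondTwo) (i : ℕ × ℤ) :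
    hf.bondForceDeriv α y k i = f' (y i / bondWeight α i.1) * k i := rfl

lemma abs_bondForce_taylor_le (α : ℝ) (y k : BondTwo) (i : ℕ × ℤ) :
    |(hf.bondForce α (y + k) - hf.bondForce α y - hf.bondForceDeriv α y k) i| * bondWeight α i.1
      ≤ L * k i ^ 2 := by
  have hs := bondWeight_pos α i.1
  set s := bondWeight α i.1 with hsdef
  have e : (hf.bondForce α (y + k) - hf.bondForce α y - hf.bondForceDeriv α y k) i
      = s * (f (y i / s + k i / s) - f (y i / s) - f' (y i / s) * (k i / s)) := by
    have h1 : s * (k i / s) = k i := mul_div_cancel₀ _ hs.ne'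
    have : (hf.bondForce α (y + k) - hf.bondForce α y - hf.bondForceDeriv α y k) i
      = s * f ((y i + k i) / s) - s * f (y i / s) - f' (y i / s) * k i := rfl
    rw [this, ← add_div]
    linear_combination f' (y i / s) * h1
  rw [e, abs_mul, abs_of_pos hs]
  have := hf.abs_taylor_le (y i / s) (k i / s)
  calc s * |f (y i / s + k i / s) - f (y i / s) - f' (y i / s) * (k i / s)| * s
      ≤ s * (L * (k i / s) ^ 2) * s := by gcongr
    _ = L * k i ^ 2 := by field_simp

/-- The bond forces are differentiable along displacements of the lattice, since the strains of
these are uniformly small relative to the bond weights. -/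
lemma hasFDerivAt_bondForce_bondStrain {α : ℝ} (hα : 1 < α) (r : EllTwo) :
    HasFDerivAt (fun r => hf.bondForce α (bondStrain α r))
      (hf.bondForceDeriv α (bondStrain α r) ∘L bondStrain α) r := by
  refine hasFDerivAt_of_quadratic_remainder (B := L * ‖bondStrain α‖) fun k => ?_
  have hL := hf.L_nonneg
  rw [map_add]
  have := lp_two_norm_le_of_abs_le (C := L * ‖k‖) (x := hf.bondForce α (bondStrain α r + bondStrain α k)
    - hf.bondForce α (bondStrain α r) - hf.bondForceDeriv α (bondStrain α r) (bondStrain α k))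
    (y := bondStrain α k) (by positivity) (fun i => by
      have hs := bondWeight_pos α i.1
      have h1 := hf.abs_bondForce_taylor_le α (bondStrain α r) (bondStrain α k) i
      have h2 := abs_bondStrain_apply_le hα (lp_two_abs_apply_le k) i
      refine le_of_mul_le_mul_right (h1.trans ?_) hs
      rw [← sq_abs]
      calc L * |bondStrain α k i| ^ 2 = L * |bondStrain α k i| * |bondStrain α k i| := by ring
        _ ≤ L * |bondStrain α k i| * (bondWeight α i.1 * ‖k‖) := by gcongr
        _ = _ := by ring)
  refine this.trans ?_
  have := (bondStrain α).le_opNorm k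
  calc L * ‖k‖ * ‖bondStrain α k‖ ≤ L * ‖k‖ * (‖bondStrain α‖ * ‖k‖) := by gcongr
    _ = _ := by ring

end IsForce

/-! ### Componentwise differentiable curves in `ℓ²` -/

/-- A curve in `ℓ²` whose components are differentiable with `ℓ²`-bounded derivatives is Lipschitz. -/
lemma lp_two_norm_sub_le_of_hasDerivWithinAt {ι : Type*} {z : ℝ → lp (fun _ : ι => ℝ) 2}
    {g : ℝ → ι → ℝ} {S : Set ℝ} (hS : Convex ℝ S) {B : ℝ} (hB : 0 ≤ B)
    (hd : ∀ s ∈ S, ∀ i, HasDerivWithinAt (fun s => z s i) (g s i) S s)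
    (hg : ∀ s ∈ S, ∀ F : Finset ι, ∑ i ∈ F, g s i ^ 2 ≤ B ^ 2) {s t : ℝ} (hs : s ∈ S) (ht : t ∈ S) :
    ‖z s - z t‖ ≤ B * |s - t| := by
  refine lp_two_norm_le_of_hasSum (by positivity) fun F => ?_
  set v : ι → ℝ := fun i => (z s - z t) i with hv
  set N := Real.sqrt (∑ i ∈ F, v i ^ 2) with hN
  have hN2 : N ^ 2 = ∑ i ∈ F, v i ^ 2 := Real.sq_sqrt (Finset.sum_nonneg fun i _ => sq_nonneg _)
  have hN0 : 0 ≤ N := Real.sqrt_nonneg _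
  have key := hS.norm_image_sub_le_of_norm_hasDerivWithin_le
    (f := fun σ => ∑ i ∈ F, v i * z σ i) (f' := fun σ => ∑ i ∈ F, v i * g σ i) (C := N * B)
    (fun σ hσ => by
      have := HasDerivWithinAt.sum (u := F) fun i _ => (hd σ hσ i).const_mul (v i)
      simpa [Finset.sum_fn] using! this)
    (fun σ hσ => by
      have h1 := Finset.sum_mul_sq_le_sq_mul_sq F v (g σ)
      have h2 := hg σ hσ F
      refine abs_le_of_sq_le_sq (h1.trans ?_) (by positivity)
      rw [mul_pow, hN2]
      gcongr) ht hs
  rw [← Finset.sum_sub_distrib] at key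
  have e : ∑ i ∈ F, (v i * z s i - v i * z t i) = N ^ 2 := by
    rw [hN2]
    refine Finset.sum_congr rfl fun i _ => ?_
    simp only [hv, lp.coeFn_sub, Pi.sub_apply]
    ring
  rw [e, Real.norm_of_nonneg (sq_nonneg N), Real.norm_eq_abs] at key
  have hfin : N ≤ B * |s - t| := by
    rcases eq_or_lt_of_le hN0 with h | h
    · rw [← h]; positivity
    · have : N * N ≤ N * (B * |s - t|) := by nlinarith
      exact le_of_mul_le_mul_left this h
  have : N ^ 2 ≤ (B * |s - t|) ^ 2 := pow_le_pow_left₀ hN0 hfin 2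
  rwa [hN2] at this

/-- Componentwise differentiability and a Lipschitz bound give weak differentiability. -/
lemma lp_two_hasDerivAt_inner {ι : Type*} {z : ℝ → lp (fun _ : ι => ℝ) 2}
    {g : lp (fun _ : ι => ℝ) 2} {t B : ℝ}
    (hd : ∀ i, HasDerivAt (fun s => z s i) (g i) t)
    (hB : ∀ᶠ s in nhds t, ‖z s - z t‖ ≤ B * |s - t|) (v : lp (fun _ : ι => ℝ) 2) :
    HasDerivAt (fun s => inner ℝ v (z s)) (inner ℝ v g) t := by
  classical
  rw [hasDerivAt_iff_isLittleO, Asymptotics.isLittleO_iff]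
  intro c hc
  have hB0 : 0 < |B| + ‖g‖ + 1 := by positivity
  obtain ⟨F, hF⟩ : ∃ F : Finset ι, ‖v - ∑ i ∈ F, lp.single 2 i (v i)‖ ≤ c / 2 / (|B| + ‖g‖ + 1) := by
    have h := (lp.hasSum_single (E := fun _ : ι => ℝ) (p := 2) (by norm_num) v)
    have h2 := (tendsto_iff_norm_sub_tendsto_zero.1 h).eventually_le_const
      (show (0 : ℝ) < c / 2 / (|B| + ‖g‖ + 1) by positivity)
    obtain ⟨F, hF⟩ := h2.exists
    exact ⟨F, by rwa [norm_sub_rev]⟩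
  set vF := ∑ i ∈ F, (lp.single 2 i (v i) : lp (fun _ : ι => ℝ) 2) with hvF
  have hin : ∀ x : lp (fun _ : ι => ℝ) 2, inner ℝ vF x = ∑ i ∈ F, v i * x i := by
    intro x
    rw [hvF, sum_inner]
    refine Finset.sum_congr rfl fun i _ => ?_
    rw [lp.inner_single_left]
    simp [mul_comm]
  have hfin : HasDerivAt (fun s => inner ℝ vF (z s)) (inner ℝ vF g) t := by
    simp only [hin]
    have := HasDerivAt.sum (u := F) fun i _ => (hd i).const_mul (v i)
    simpa [Finset.sum_fn] using! this
  rw [hasDerivAt_iff_isLittleO, Asymptotics.isLittleO_iff] at hfin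
  filter_upwards [hfin (half_pos hc), hB] with s h1 h2
  have e : inner ℝ v (z s) - inner ℝ v (z t) - (s - t) • inner ℝ v g
      = (inner ℝ vF (z s) - inner ℝ vF (z t) - (s - t) • inner ℝ vF g)
        + inner ℝ (v - vF) (z s - z t - (s - t) • g) := by
    simp only [inner_sub_left, inner_sub_right, inner_smul_right, smul_eq_mul]
    ring
  rw [e]
  have h3 : ‖z s - z t - (s - t) • g‖ ≤ (|B| + ‖g‖ + 1) * |s - t| := by
    refine (norm_sub_le _ _).trans ?_
    rw [norm_smul, Real.norm_eq_abs]
    have := mul_le_mul_of_nonneg_right (le_abs_self B) (abs_nonneg (s - t))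
    nlinarith [abs_nonneg (s - t)]
  have h4 : ‖inner ℝ (v - vF) (z s - z t - (s - t) • g)‖ ≤ c / 2 * |s - t| := by
    refine (norm_inner_le_norm _ _).trans ?_
    calc ‖v - vF‖ * ‖z s - z t - (s - t) • g‖
        ≤ (c / 2 / (|B| + ‖g‖ + 1)) * ((|B| + ‖g‖ + 1) * |s - t|) := by gcongr
      _ = c / 2 * |s - t| := by field_simp
  rw [Real.norm_eq_abs (s - t)] at h1 ⊢
  refine (norm_add_le _ _).trans ?_
  linarith

lemma lp_two_hasDerivAt_norm_sq {ι : Type*} {z : ℝ → lp (fun _ : ι => ℝ) 2}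
    {g : lp (fun _ : ι => ℝ) 2} {t B : ℝ}
    (hd : ∀ i, HasDerivAt (fun s => z s i) (g i) t)
    (hB : ∀ᶠ s in nhds t, ‖z s - z t‖ ≤ B * |s - t|) :
    HasDerivAt (fun s => ‖z s‖ ^ 2) (2 * inner ℝ (z t) g) t := by
  have h1 := (lp_two_hasDerivAt_inner hd hB (z t)).const_mul 2
  have h2 : HasDerivAt (fun s => ‖z s - z t‖ ^ 2) 0 t := by
    rw [hasDerivAt_iff_isLittleO]
    have e : (fun s => ‖z s - z t‖ ^ 2 - ‖z t - z t‖ ^ 2 - (s - t) • (0 : ℝ))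
        = fun s => ‖z s - z t‖ ^ 2 := by ext s; simp
    rw [e]
    have hO : (fun s => ‖z s - z t‖ ^ 2) =O[nhds t] fun s => |s - t| ^ 2 := by
      refine Asymptotics.IsBigO.of_bound (B ^ 2) ?_
      filter_upwards [hB] with s hs
      rw [Real.norm_of_nonneg (by positivity), Real.norm_of_nonneg (by positivity), ← mul_pow]
      exact pow_le_pow_left₀ (norm_nonneg _) hs 2
    refine hO.trans_isLittleO ?_
    simp only [sq_abs]
    have := (Asymptotics.isLittleO_pow_id (𝕜 := ℝ) (n := 2) (by norm_num)).comp_tendsto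
      ((continuous_sub_right t).tendsto' t 0 (by simp))
    exact this
  have h3 := (h1.add h2).sub_const (‖z t‖ ^ 2)
  rw [add_zero] at h3
  refine h3.congr_of_eventuallyEq (.of_forall fun s => ?_)
  simp only [Pi.add_apply]
  rw [norm_sub_sq_real, real_inner_comm]
  ring

/-- A componentwise derivative which is continuous at a point is a derivative there. -/
lemma lp_two_hasDerivAt_of_components {ι : Type*} {z g : ℝ → lp (fun _ : ι => ℝ) 2} {S : Set ℝ}
    (hS : Convex ℝ S) (hd : ∀ s ∈ S, ∀ i, HasDerivAt (fun s => z s i) (g s i) s)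
    {B : ℝ} (hB : 0 ≤ B) (hg : ∀ s ∈ S, ∀ t ∈ S, ‖g s - g t‖ ≤ B * |s - t|) {t : ℝ} (hSt : S ∈ nhds t) :
    HasDerivAt z (g t) t := by
  have htS := mem_of_mem_nhds hSt
  rw [hasDerivAt_iff_isLittleO]
  have hO : (fun s => z s - z t - (s - t) • g t) =O[nhds t] fun s => |s - t| ^ 2 := by
    refine Asymptotics.IsBigO.of_bound B ?_
    obtain ⟨δ, hδ, hball⟩ := Metric.mem_nhds_iff.1 hSt
    filter_upwards [Metric.ball_mem_nhds t hδ] with s hs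
    have hsS := hball hs
    rw [Real.norm_of_nonneg (by positivity)]
    have hsub : uIcc t s ⊆ S := by
      rw [← segment_eq_uIcc]
      exact hS.segment_subset htS hsS
    have := lp_two_norm_sub_le_of_hasDerivWithinAt (z := fun σ => z σ - σ • g t)
      (g := fun σ i => (g σ - g t) i) (convex_uIcc t s) (B := B * |s - t|) (by positivity)
      (fun σ hσ i => by
        have h := (hd σ (hsub hσ) i).sub ((hasDerivAt_id σ).mul_const (g t i))
        rw [one_mul] at h
        exact h.hasDerivWithinAt)
      (fun σ hσ F => by
        have h1 := sum_le_hasSum F (fun i _ => sq_nonneg _) (lp_two_hasSum_sq (g σ - g t))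
        refine h1.trans (pow_le_pow_left₀ (norm_nonneg _) ((hg σ (hsub hσ) t htS).trans ?_) 2)
        exact mul_le_mul_of_nonneg_left (abs_sub_left_of_mem_uIcc hσ) hB)
      right_mem_uIcc left_mem_uIcc
    calc ‖z s - z t - (s - t) • g t‖ = ‖(z s - s • g t) - (z t - t • g t)‖ := by
          congr 1; module
      _ ≤ B * |s - t| * |s - t| := this
      _ = B * |s - t| ^ 2 := by ring
  refine hO.trans_isLittleO ?_
  simp only [sq_abs]
  exact (Asymptotics.isLittleO_pow_id (𝕜 := ℝ) (n := 2) (by norm_num)).comp_tendsto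
    ((continuous_sub_right t).tendsto' t 0 (by simp))

/-! ### Stability of the lattice dynamics -/

lemma abs_deriv_gronwall {E E' : ℝ → ℝ} {T a b : ℝ} (ha : 0 ≤ a) (hb : 0 ≤ b) (h0 : 0 ≤ E 0)
    (hc : ContinuousOn E (Icc (-T) T)) (hd : ∀ t ∈ Ioo (-T) T, HasDerivAt E (E' t) t)
    (hle : ∀ t ∈ Ioo (-T) T, |E' t| ≤ a * E t + b) (t : ℝ) (ht : t ∈ Icc (-T) T) :
    E t ≤ (E 0 + b * T) * Real.exp (a * T) := by
  have hT : 0 ≤ T := by linarith [ht.1, ht.2]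
  -- forward in time
  have key : ∀ E E' : ℝ → ℝ, ContinuousOn E (Icc (-T) T) → (∀ t ∈ Ioo (-T) T, HasDerivAt E (E' t) t) →
      (∀ t ∈ Ioo (-T) T, |E' t| ≤ a * E t + b) → 0 ≤ E 0 → ∀ t ∈ Icc 0 T,
      E t ≤ (E 0 + b * T) * Real.exp (a * T) := by
    intro E E' hc hd hle h0 t ht
    set φ : ℝ → ℝ := fun s => E s * Real.exp (-(a * s)) - b * s with hφ
    have hanti : AntitoneOn φ (Icc 0 T) := by
      apply antitoneOn_of_deriv_nonpos (convex_Icc 0 T)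
      · refine ((hc.mono (Icc_subset_Icc_left (by linarith))).mul ?_).sub ?_ <;> fun_prop
      · rw [interior_Icc]
        intro s hs
        have hs' : s ∈ Ioo (-T) T := ⟨by linarith [hs.1, hs.2], hs.2⟩
        have h1 := ((hd s hs').mul (((hasDerivAt_id s).const_mul a).neg.exp)).sub
          ((hasDerivAt_id s).const_mul b)
        exact h1.differentiableAt.differentiableWithinAt
      · rw [interior_Icc]
        intro s hs
        have hs' : s ∈ Ioo (-T) T := ⟨by linarith [hs.1, hs.2], hs.2⟩
        have h1 : HasDerivAt φ (E' s * Real.exp (-(a * s)) + E s * (Real.exp (-(a * s)) * (-(a * 1)))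
            - b * 1) s :=
          ((hd s hs').mul (((hasDerivAt_id s).const_mul a).neg.exp)).sub
          ((hasDerivAt_id s).const_mul b)
        rw [h1.deriv]
        have h2 := (le_abs_self _).trans (hle s hs')
        have h3 := Real.exp_pos (-(a * s))
        have h4 : Real.exp (-(a * s)) ≤ 1 := by
          rw [Real.exp_le_one_iff]
          nlinarith [hs.1]
        nlinarith
    have h1 := hanti (left_mem_Icc.2 hT) ht ht.1
    simp only [hφ, mul_zero, neg_zero, Real.exp_zero, mul_one, sub_zero] at h1
    have h2 : E t = (E t * Real.exp (-(a * t))) * Real.exp (a * t) := by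
      rw [mul_assoc, ← Real.exp_add]; simp
    have hEt : E t * Real.exp (-(a * t)) ≤ E 0 + b * T := by nlinarith [ht.2]
    rw [h2]
    have : Real.exp (a * t) ≤ Real.exp (a * T) := Real.exp_le_exp.2 (by nlinarith [ht.2])
    calc _ ≤ (E 0 + b * T) * Real.exp (a * t) := by gcongr
      _ ≤ _ := by gcongr
  rcases le_total 0 t with h | h
  · exact key E E' hc hd hle h0 t ⟨h, ht.2⟩
  · have hm : ∀ s : ℝ, s ∈ Ioo (-T) T → -s ∈ Ioo (-T) T := fun s hs => ⟨by linarith [hs.2], by linarith [hs.1]⟩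
    have := key (fun s => E (-s)) (fun s => -E' (-s))
      (hc.comp continuous_neg.continuousOn fun s hs => ⟨by linarith [hs.2], by linarith [hs.1]⟩)
      (fun s hs => by
        have := (hd (-s) (hm s hs)).scomp s (hasDerivAt_neg s)
        simpa using! this)
      (fun s hs => by rw [abs_neg]; exact hle (-s) (hm s hs)) (by simpa using h0) (-t) ⟨by linarith, by linarith [ht.1]⟩
    simpa using this

/-- The acceleration produced by the bond forces, `-(J D)† N(J r)` with `J` the bond strain, `D` the
difference operator and `N` the bond force. -/
def IsForce.accel {f f' : ℝ → ℝ} {c C L : ℝ} (hf : IsForce f f' c C L) (α : ℝ) (r : EllTwo) : EllTwo :=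
  -ContinuousLinearMap.adjoint (bondStrain α ∘L ellDiff) (hf.bondForce α (bondStrain α r))

/-- **Stability.** An approximate solution `(rt, pt)` of the lattice equations `r' = D p`,
`p' = accel r` with residual at most `ρ` stays close to an exact solution `(r, p)`. The relative
energy `|p - pt|² / 2 + W(J r) - W(J rt) - ⟨N(J rt), J (r - rt)⟩` controls the distance and grows at a
rate proportional to the strain rate `σ` of the approximate solution. -/
theorem IsForce.stability {f f' : ℝ → ℝ} {c C L : ℝ} (hf : IsForce f f' c C L) {α : ℝ} (hα : 1 < α)
    {T : ℝ} {r p rt pt g : ℝ → EllTwo} {B σ ρ l : ℝ}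
    (hr : ∀ t ∈ Icc (-T) T, HasDerivWithinAt r (ellDiff (p t)) (Icc (-T) T) t)
    (hp : ∀ t ∈ Icc (-T) T, HasDerivWithinAt p (hf.accel α (r t)) (Icc (-T) T) t)
    (hrtc : ContinuousOn rt (Icc (-T) T))
    (hrt : ∀ t ∈ Ioo (-T) T, ∀ j, HasDerivAt (fun s => rt s j) (ellDiff (pt t) j) t)
    (hB : 0 ≤ B) (hptB : ∀ s ∈ Icc (-T) T, ∀ t ∈ Icc (-T) T, ‖pt s - pt t‖ ≤ B * |s - t|)
    (hpt : ∀ t ∈ Ioo (-T) T, ∀ j, HasDerivAt (fun s => pt s j) (g t j) t)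
    (hρ : ∀ t ∈ Ioo (-T) T, ‖g t - hf.accel α (rt t)‖ ≤ ρ)
    (hσ0 : 0 ≤ σ) (hσ : ∀ t ∈ Ioo (-T) T, ∀ j, |ellDiff (pt t) j| ≤ σ) (hl : 0 < l)
    {t : ℝ} (ht : t ∈ Icc (-T) T) :
    1 / 2 * ‖p t - pt t‖ ^ 2 + c / 2 * ‖r t - rt t‖ ^ 2 ≤
      (1 / 2 * ‖p 0 - pt 0‖ ^ 2 + C / 2 * zetaSum α * ‖r 0 - rt 0‖ ^ 2 + ρ ^ 2 / (2 * l) * T)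
        * Real.exp ((2 * L * σ / c + l) * T) := by
  have hc := hf.pos
  have hL := hf.L_nonneg
  have hT : 0 ≤ T := by linarith [ht.1, ht.2]
  set J := bondStrain α with hJ
  set N := hf.bondForce α with hN
  set E : ℝ → ℝ := fun t => 1 / 2 * ‖p t - pt t‖ ^ 2 +
    (bondEnergy f α (J (r t)) - bondEnergy f α (J (rt t)) - inner ℝ (N (J (rt t))) (J (r t - rt t)))
    with hE
  have hbd : ∀ t, c / 2 * ‖J (r t - rt t)‖ ^ 2 ≤
      bondEnergy f α (J (r t)) - bondEnergy f α (J (rt t)) - inner ℝ (N (J (rt t))) (J (r t - rt t)) ∧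
      bondEnergy f α (J (r t)) - bondEnergy f α (J (rt t)) - inner ℝ (N (J (rt t))) (J (r t - rt t))
        ≤ C / 2 * ‖J (r t - rt t)‖ ^ 2 := by
    intro t
    have := hf.bondEnergy_bounds α (J (rt t)) (J (r t - rt t))
    rwa [← map_add, add_sub_cancel] at this
  have hElow : ∀ t, 1 / 2 * ‖p t - pt t‖ ^ 2 + c / 2 * ‖J (r t - rt t)‖ ^ 2 ≤ E t := fun t => by
    have := (hbd t).1
    simp only [hE]
    linarith
  have hrc : ContinuousOn r (Icc (-T) T) := fun t ht => (hr t ht).continuousWithinAt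
  have hpc : ContinuousOn p (Icc (-T) T) := fun t ht => (hp t ht).continuousWithinAt
  have hptc : ContinuousOn pt (Icc (-T) T) := by
    refine (LipschitzOnWith.of_dist_le_mul (K := ⟨B, hB⟩) fun s hs t ht => ?_).continuousOn
    rw [dist_eq_norm, Real.dist_eq]
    exact hptB s hs t ht
  have hWc : Continuous (bondEnergy f α) := continuous_iff_continuousAt.2 fun y =>
    (hf.hasFDerivAt_bondEnergy α y).continuousAt
  have hNJc : Continuous fun r => N (J r) := continuous_iff_continuousAt.2 fun y =>
    (hf.hasFDerivAt_bondForce_bondStrain hα y).continuousAt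
  have hEc : ContinuousOn E (Icc (-T) T) := by
    refine (continuousOn_const.mul ((hpc.sub hptc).norm.pow 2)).add (((hWc.comp_continuousOn
      (J.continuous.comp_continuousOn hrc)).sub (hWc.comp_continuousOn
      (J.continuous.comp_continuousOn hrtc))).sub ?_)
    exact (hNJc.comp_continuousOn hrtc).inner (𝕜 := ℝ) (J.continuous.comp_continuousOn (hrc.sub hrtc))
  have hconv : Convex ℝ (Ioo (-T) T) := convex_Ioo _ _
  -- the derivative of the energy
  set E' : ℝ → ℝ := fun t => -inner ℝ (p t - pt t) (g t - hf.accel α (rt t)) +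
    inner ℝ (N (J (r t)) - N (J (rt t)) - hf.bondForceDeriv α (J (rt t)) (J (r t - rt t)))
      (J (ellDiff (pt t))) with hE'
  have hEd : ∀ t ∈ Ioo (-T) T, HasDerivAt E (E' t) t := by
    intro t ht
    have hmem : Icc (-T) T ∈ nhds t := Icc_mem_nhds ht.1 ht.2
    have htc := Ioo_subset_Icc_self ht
    have dr := (hr t htc).hasDerivAt hmem
    have dp := (hp t htc).hasDerivAt hmem
    have drt : HasDerivAt rt (ellDiff (pt t)) t := by
      refine lp_two_hasDerivAt_of_components (g := fun s => ellDiff (pt s)) (B := ‖ellDiff‖ * B) hconv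
        hrt (by positivity) (fun s hs t ht => ?_) (isOpen_Ioo.mem_nhds ht)
      rw [← map_sub]
      refine (ellDiff.le_opNorm _).trans ?_
      rw [mul_assoc]
      exact mul_le_mul_of_nonneg_left (hptB s (Ioo_subset_Icc_self hs) t (Ioo_subset_Icc_self ht))
        (norm_nonneg _)
    have dν : HasDerivAt (fun s => ‖p s - pt s‖ ^ 2)
        (2 * inner ℝ (p t - pt t) (hf.accel α (r t) - g t)) t := by
      obtain ⟨K, hK⟩ := dp.isBigO_sub.bound
      have hpl : ∀ i, HasDerivAt (fun s => p s i) (hf.accel α (r t) i) t := fun i => by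
        have := (lp.evalCLM ℝ (fun _ : ℤ => ℝ) 2 i).hasFDerivAt.comp_hasDerivAt t dp
        exact this
      refine lp_two_hasDerivAt_norm_sq (z := fun s => p s - pt s) (B := K + B)
        (fun i => (hpl i).sub (hpt t ht i)) ?_
      filter_upwards [hK, hmem] with s hs hsI
      have := hptB s hsI t htc
      rw [Real.norm_eq_abs] at hs
      calc ‖p s - pt s - (p t - pt t)‖ = ‖(p s - p t) - (pt s - pt t)‖ := by congr 1; abel
        _ ≤ ‖p s - p t‖ + ‖pt s - pt t‖ := norm_sub_le _ _
        _ ≤ (K + B) * |s - t| := by linarith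
    have dJr : HasDerivAt (fun s => J (r s)) (J (ellDiff (p t))) t := J.hasFDerivAt.comp_hasDerivAt t dr
    have dJrt : HasDerivAt (fun s => J (rt s)) (J (ellDiff (pt t))) t :=
      J.hasFDerivAt.comp_hasDerivAt t drt
    have dJμ : HasDerivAt (fun s => J (r s - rt s)) (J (ellDiff (p t) - ellDiff (pt t))) t :=
      J.hasFDerivAt.comp_hasDerivAt t (dr.sub drt)
    have dN : HasDerivAt (fun s => N (J (rt s))) (hf.bondForceDeriv α (J (rt t)) (J (ellDiff (pt t)))) t :=
      (hf.hasFDerivAt_bondForce_bondStrain hα (rt t)).comp_hasDerivAt t drt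
    have dW := (hf.hasFDerivAt_bondEnergy α (J (r t))).comp_hasDerivAt t dJr
    have dWt := (hf.hasFDerivAt_bondEnergy α (J (rt t))).comp_hasDerivAt t dJrt
    have dtot := (dν.const_mul (1 / 2)).add ((dW.sub dWt).sub (dN.inner ℝ dJμ))
    refine dtot.congr_deriv ?_
    have hadj : ∀ (v : EllTwo) (r : EllTwo), inner ℝ v (hf.accel α r) = -inner ℝ (J (ellDiff v)) (N (J r)) := by
      intro v r
      rw [IsForce.accel, inner_neg_right, ContinuousLinearMap.adjoint_inner_right]
      rfl
    have hsymm : inner ℝ (hf.bondForceDeriv α (J (rt t)) (J (ellDiff (pt t)))) (J (r t - rt t))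
        = inner ℝ (hf.bondForceDeriv α (J (rt t)) (J (r t - rt t))) (J (ellDiff (pt t))) := by
      have h1 := lp_two_hasSum_inner (hf.bondForceDeriv α (J (rt t)) (J (ellDiff (pt t)))) (J (r t - rt t))
      have h2 := lp_two_hasSum_inner (hf.bondForceDeriv α (J (rt t)) (J (r t - rt t))) (J (ellDiff (pt t)))
      refine h1.unique ?_
      convert h2 using 2 with i
      simp only [hf.bondForceDeriv_apply]
      ring
    simp only [innerSL_apply_apply, hsymm, hE', ← hN]
    simp only [inner_sub_right, inner_sub_left, hadj, map_sub]
    simp only [real_inner_comm (J (ellDiff (p t))), real_inner_comm (J (ellDiff (pt t)))]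
    ring
  have hEle : ∀ t ∈ Ioo (-T) T, |E' t| ≤ (2 * L * σ / c + l) * E t + ρ ^ 2 / (2 * l) := by
    intro t ht
    have h1 : |inner ℝ (p t - pt t) (g t - hf.accel α (rt t))| ≤ l * (1 / 2 * ‖p t - pt t‖ ^ 2) + ρ ^ 2 / (2 * l) := by
      refine (abs_real_inner_le_norm _ _).trans ?_
      have h2 := mul_le_mul_of_nonneg_left (hρ t ht) (norm_nonneg (p t - pt t))
      refine h2.trans ?_
      have h3 : 0 ≤ (l * ‖p t - pt t‖ - ρ) ^ 2 / (2 * l) := by positivity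
      have h4 : (l * ‖p t - pt t‖ - ρ) ^ 2 / (2 * l)
          = l * (1 / 2 * ‖p t - pt t‖ ^ 2) + ρ ^ 2 / (2 * l) - ‖p t - pt t‖ * ρ := by
        field_simp
        ring
      linarith
    have h2 : |inner ℝ (N (J (r t)) - N (J (rt t)) - hf.bondForceDeriv α (J (rt t)) (J (r t - rt t)))
        (J (ellDiff (pt t)))| ≤ L * σ * ‖J (r t - rt t)‖ ^ 2 := by
      have hs := lp_two_hasSum_inner
        (N (J (r t)) - N (J (rt t)) - hf.bondForceDeriv α (J (rt t)) (J (r t - rt t))) (J (ellDiff (pt t)))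
      have hs2 := (lp_two_hasSum_sq (J (r t - rt t))).mul_left (L * σ)
      rw [← hs.tsum_eq, ← Real.norm_eq_abs]
      refine tsum_of_norm_bounded hs2 fun i => ?_
      rw [Real.norm_eq_abs, abs_mul]
      have a1 := hf.abs_bondForce_taylor_le α (J (rt t)) (J (r t - rt t)) i
      rw [← map_add, add_sub_cancel] at a1
      have a2 := abs_bondStrain_apply_le hα (hσ t ht) i
      calc _ ≤ |(N (J (r t)) - N (J (rt t)) - hf.bondForceDeriv α (J (rt t)) (J (r t - rt t))) i|
            * (bondWeight α i.1 * σ) := by gcongr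
        _ = (|(N (J (r t)) - N (J (rt t)) - hf.bondForceDeriv α (J (rt t)) (J (r t - rt t))) i|
            * bondWeight α i.1) * σ := by ring
        _ ≤ (L * J (r t - rt t) i ^ 2) * σ := by gcongr
        _ = _ := by ring
    have h3 : |E' t| ≤ _ := (abs_add_le _ _).trans (add_le_add ((abs_neg _).trans_le h1) h2)
    refine h3.trans ?_
    have h4 := hElow t
    have h5 : L * σ * ‖J (r t - rt t)‖ ^ 2 = 2 * L * σ / c * (c / 2 * ‖J (r t - rt t)‖ ^ 2) := by
      field_simp
    rw [h5]
    have h6 : 0 ≤ 2 * L * σ / c := by positivity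
    have n1 : 0 ≤ 1 / 2 * ‖p t - pt t‖ ^ 2 := by positivity
    have n2 : 0 ≤ c / 2 * ‖J (r t - rt t)‖ ^ 2 := by positivity
    have e1 := mul_le_mul_of_nonneg_left (show c / 2 * ‖J (r t - rt t)‖ ^ 2 ≤ E t by linarith) h6
    have e2 := mul_le_mul_of_nonneg_left (show 1 / 2 * ‖p t - pt t‖ ^ 2 ≤ E t by linarith) hl.le
    linarith
  have hE0 : 0 ≤ E 0 := le_trans (by positivity) (hElow 0)
  have hgr := abs_deriv_gronwall (by positivity) (by positivity) hE0 hEc hEd hEle t ht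
  have hlow := hElow t
  have hJlow := norm_le_norm_bondStrain hα (r t - rt t)
  have h1 : c / 2 * ‖r t - rt t‖ ^ 2 ≤ c / 2 * ‖J (r t - rt t)‖ ^ 2 := by gcongr
  have hE0le : E 0 ≤ 1 / 2 * ‖p 0 - pt 0‖ ^ 2 + C / 2 * zetaSum α * ‖r 0 - rt 0‖ ^ 2 := by
    have h2 := (hbd 0).2
    have h3 := mul_le_mul_of_nonneg_left (norm_sq_bondStrain_le hα (r 0 - rt 0))
      (show 0 ≤ C / 2 by linarith [hf.C_pos])
    simp only [hE]
    linarith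
  calc _ ≤ E t := by linarith
    _ ≤ _ := hgr
    _ ≤ _ := by gcongr

/-! ### The truncated Calogero-Moser force -/

/-- The relative bond length `1 + y`, cut off to `[d, 1/d]`. -/
def clampLen (d y : ℝ) : ℝ := max d (min d⁻¹ (1 + y))

/-- The second derivative of the potential `(1 + y) ^ (-α)`, cut off outside `1 + y ∈ [d, 1/d]`. -/
def cmSlope (α d y : ℝ) : ℝ := α * (α + 1) * clampLen d y ^ (-(α + 2))

/-- The force law `α - α (1 + y) ^ (-α - 1)`, continued affinely outside `1 + y ∈ [d, 1/d]`. -/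
def cmForce (α d y : ℝ) : ℝ := ∫ x in (0 : ℝ)..y, cmSlope α d x

lemma le_clampLen (d y : ℝ) : d ≤ clampLen d y := le_max_left _ _

lemma clampLen_le {d : ℝ} (hd : d ∈ Ioo (0 : ℝ) 1) (y : ℝ) : clampLen d y ≤ d⁻¹ :=
  max_le (hd.2.le.trans ((one_le_inv₀ hd.1).2 hd.2.le)) (min_le_left _ _)

lemma clampLen_of_mem {d y : ℝ} (hy : 1 + y ∈ Icc d d⁻¹) : clampLen d y = 1 + y := by
  rw [clampLen, min_eq_right hy.2, max_eq_right hy.1]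

lemma abs_clampLen_sub_le (d x y : ℝ) : |clampLen d x - clampLen d y| ≤ |x - y| := by
  unfold clampLen
  refine (abs_max_sub_max_le_max _ _ _ _).trans ?_
  rw [sub_self, abs_zero, max_eq_right (abs_nonneg _)]
  refine (abs_min_sub_min_le_max _ _ _ _).trans ?_
  rw [sub_self, abs_zero, max_eq_right (abs_nonneg _)]
  simp

lemma abs_rpow_neg_sub_le {β d : ℝ} (hβ : 0 ≤ β) (hd : 0 < d) {x y : ℝ} (hx : d ≤ x) (hy : d ≤ y) :
    |x ^ (-β) - y ^ (-β)| ≤ β * d ^ (-(β + 1)) * |x - y| := by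
  refine (convex_Ici d).norm_image_sub_le_of_norm_hasDerivWithin_le
    (fun z hz => (Real.hasDerivAt_rpow_const (p := -β)
      (Or.inl (hd.trans_le (mem_Ici.1 hz)).ne')).hasDerivWithinAt)
    (fun z hz => ?_) hy hx
  have hz0 : 0 < z := hd.trans_le hz
  rw [norm_mul, norm_neg, Real.norm_of_nonneg hβ, Real.norm_of_nonneg (Real.rpow_nonneg hz0.le _),
    show -β - 1 = -(β + 1) by ring]
  exact mul_le_mul_of_nonneg_left (Real.rpow_le_rpow_of_nonpos hd hz (by linarith)) hβ

lemma isForce_cmForce {α d : ℝ} (hα : 0 < α) (hd : d ∈ Ioo (0 : ℝ) 1) :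
    IsForce (cmForce α d) (cmSlope α d) (α * (α + 1) * d ^ (α + 2)) (α * (α + 1) * d ^ (-(α + 2)))
      (α * (α + 1) * ((α + 2) * d ^ (-(α + 2 + 1)))) := by
  have hd0 := hd.1
  have hαα : 0 < α * (α + 1) := by positivity
  have hlip : ∀ x y, |cmSlope α d x - cmSlope α d y|
      ≤ α * (α + 1) * ((α + 2) * d ^ (-(α + 2 + 1))) * |x - y| := by
    intro x y
    unfold cmSlope
    rw [← mul_sub, abs_mul, abs_of_pos hαα, mul_assoc (α * (α + 1))]
    refine mul_le_mul_of_nonneg_left ?_ hαα.le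
    refine (abs_rpow_neg_sub_le (by linarith) hd0 (le_clampLen d x) (le_clampLen d y)).trans ?_
    exact mul_le_mul_of_nonneg_left (abs_clampLen_sub_le d x y) (by positivity)
  have hcont : Continuous (cmSlope α d) := by
    refine (LipschitzWith.of_dist_le_mul
      (K := ⟨α * (α + 1) * ((α + 2) * d ^ (-(α + 2 + 1))), by positivity⟩) fun x y => ?_).continuous
    exact hlip x y
  refine ⟨by simp [cmForce], fun y => ?_, by positivity, fun y => ?_, fun y => ?_, hlip⟩
  · exact intervalIntegral.integral_hasDerivAt_right (hcont.intervalIntegrable _ _)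
      (hcont.stronglyMeasurableAtFilter _ _) hcont.continuousAt
  · unfold cmSlope
    gcongr
    rw [← inv_inv d, Real.inv_rpow (by positivity), ← Real.rpow_neg (by positivity), inv_inv]
    exact Real.rpow_le_rpow_of_nonpos (hd0.trans_le (le_clampLen d y)) (clampLen_le hd y) (by linarith)
  · unfold cmSlope
    gcongr ?_ * ?_
    exact Real.rpow_le_rpow_of_nonpos hd0 (le_clampLen d y) (by linarith)

lemma cmForce_of_mem {α d : ℝ} (hα : 0 < α) (hd : d ∈ Ioo (0 : ℝ) 1) {y : ℝ} (hy : 1 + y ∈ Icc d d⁻¹) :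
    cmForce α d y = α - α * (1 + y) ^ (-(α + 1)) := by
  have hd0 := hd.1
  have hzone : ∀ x ∈ uIcc 0 y, 1 + x ∈ Icc d d⁻¹ := by
    intro x hx
    have h1 := (one_le_inv₀ hd0).2 hd.2.le
    rcases le_total 0 y with h | h
    · rw [uIcc_of_le h] at hx
      exact ⟨by linarith [hx.1, hd.2], by linarith [hx.2, hy.2]⟩
    · rw [uIcc_of_ge h] at hx
      exact ⟨by linarith [hx.1, hy.1], by linarith [hx.2]⟩
  have hint : ∀ x ∈ uIcc 0 y, HasDerivAt (fun x => -α * (1 + x) ^ (-(α + 1))) (cmSlope α d x) x := by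
    intro x hx
    have hz := hzone x hx
    have h0 : 0 < 1 + x := hd0.trans_le hz.1
    have := (((hasDerivAt_id x).const_add 1).rpow_const (p := -(α + 1)) (Or.inl h0.ne')).const_mul (-α)
    refine this.congr_deriv ?_
    simp only [id_eq]
    rw [cmSlope, clampLen_of_mem hz, show -(α + 1) - 1 = -(α + 2) by ring]
    ring
  rw [cmForce, intervalIntegral.integral_eq_sub_of_hasDerivAt hint]
  · simp only [add_zero, Real.one_rpow]
    ring
  · have hf := isForce_cmForce hα hd
    have : Continuous (cmSlope α d) := by
      refine (LipschitzWith.of_dist_le_mul (K := ⟨_, hf.L_nonneg⟩) fun x y => ?_).continuous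
      exact hf.lip x y
    exact this.intervalIntegrable _ _

/-! ### The Calogero-Moser system as an equation in `ℓ² × ℓ²` -/

lemma sub_eq_of_ellAvg {q : ℤ → ℝ} {R : EllTwo} (hR : ∀ j, R j = q (j + 1) - q j - 1) (n : ℕ) (j : ℤ) :
    q (j + (n + 1)) - q j = ((n : ℝ) + 1) * (1 + ellAvg n R j) := by
  have hn : (0 : ℝ) < (n : ℝ) + 1 := by positivity
  have hsum : ∑ i ∈ Finset.range (n + 1), R (j + i) = q (j + (n + 1)) - q j - (n + 1) := by
    have h1 : ∀ i : ℕ, R (j + i) = (q (j + (i + 1 : ℕ)) - q (j + i)) - 1 := by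
      intro i
      rw [hR]
      push_cast
      rw [add_assoc]
    simp only [h1]
    rw [Finset.sum_sub_distrib, Finset.sum_range_sub (fun i : ℕ => q (j + i))]
    simp
  rw [ellAvg_apply, mul_add, ← mul_assoc, mul_inv_cancel₀ hn.ne', hsum]
  ring

lemma ellAvg_mem_Icc {R : EllTwo} {a b : ℝ} (h : ∀ j, R j ∈ Icc a b) (n : ℕ) (j : ℤ) :
    ellAvg n R j ∈ Icc a b := by
  have hn : (0 : ℝ) < (n : ℝ) + 1 := by positivity
  rw [ellAvg_apply]
  constructor
  · rw [← div_eq_inv_mul, le_div_iff₀ hn]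
    refine le_trans (le_of_eq ?_) (Finset.sum_le_sum fun (i : ℕ) _ => (h (j + i)).1)
    simp [mul_comm]
  · rw [← div_eq_inv_mul, div_le_iff₀ hn]
    refine le_trans (Finset.sum_le_sum fun (i : ℕ) _ => (h (j + i)).2) (le_of_eq ?_)
    simp [mul_comm]

lemma hasSum_accel {f f' : ℝ → ℝ} {c C L : ℝ} (hf : IsForce f f' c C L) {α : ℝ} (hα : 1 < α)
    (R : EllTwo) (j : ℤ) :
    HasSum (fun n : ℕ => ((n : ℝ) + 1) ^ (-α) * ((n : ℝ) + 1)⁻¹ *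
      (f (ellAvg n R j) - f (ellAvg n R (j - (n + 1))))) (hf.accel α R j) := by
  have h := (hasSum_adjoint_apply hα (hf.bondForce α (bondStrain α R)) j).neg
  have e : (hf.accel α R) j
      = -(ContinuousLinearMap.adjoint (bondStrain α ∘L ellDiff) (hf.bondForce α (bondStrain α R)) : EllTwo) j :=
    rfl
  rw [e]
  convert! h using 2 with n
  have hs := (bondWeight_pos α n).ne'
  simp only [hf.bondForce_apply, bondStrain_apply hα, mul_div_cancel_left₀ _ hs, ← bondWeight_sq]
  ring

/-- In the range where the force is not truncated, the abstract acceleration is the Calogero-Moser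
force. -/
lemma hasSum_cmTerm {α d : ℝ} (hα : 1 < α) (hd : d ∈ Ioo (0 : ℝ) 1) {q : ℤ → ℝ} {R : EllTwo}
    (hR : ∀ j, R j = q (j + 1) - q j - 1) (hz : ∀ j, 1 + R j ∈ Icc d d⁻¹) (j : ℤ) :
    HasSum (fun m => -α * cmTerm α q j m)
      ((isForce_cmForce (zero_lt_one.trans hα) hd).accel α R j) := by
  have hα0 : 0 < α := zero_lt_one.trans hα
  convert! hasSum_accel (isForce_cmForce hα0 hd) hα R j using 2 with n
  have hn : (0 : ℝ) < (n : ℝ) + 1 := by positivity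
  have havg : ∀ i, 1 + ellAvg n R i ∈ Icc d d⁻¹ := by
    intro i
    have := ellAvg_mem_Icc (R := R) (a := d - 1) (b := d⁻¹ - 1)
      (fun j => ⟨by linarith [(hz j).1], by linarith [(hz j).2]⟩) n i
    exact ⟨by linarith [this.1], by linarith [this.2]⟩
  have hpos : ∀ i, 0 < 1 + ellAvg n R i := fun i => hd.1.trans_le (havg i).1
  have h1 := sub_eq_of_ellAvg hR n j
  have h2 := sub_eq_of_ellAvg hR n (j - (n + 1))
  rw [sub_add_cancel] at h2
  rw [cmTerm, h1, h2, cmForce_of_mem hα0 hd (havg j), cmForce_of_mem hα0 hd (havg _),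
    Real.mul_rpow hn.le (hpos _).le, Real.mul_rpow hn.le (hpos _).le, Real.rpow_neg (hpos _).le,
    Real.rpow_neg (hpos _).le, Real.rpow_neg hn.le, Real.rpow_add_one hn.ne']
  have := (Real.rpow_pos_of_pos hn α).ne'
  have := (Real.rpow_pos_of_pos (hpos j) (α + 1)).ne'
  have := (Real.rpow_pos_of_pos (hpos (j - (n + 1))) (α + 1)).ne'
  field_simp
  ring

/-- The lattice equations `r' = D p`, `p' = accel r` as a vector field. -/
def IsForce.field {f f' : ℝ → ℝ} {c C L : ℝ} (hf : IsForce f f' c C L) (α : ℝ)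
    (z : EllTwo × EllTwo) : EllTwo × EllTwo :=
  (ellDiff z.2, hf.accel α z.1)

lemma IsForce.exists_lipschitzWith_field {f f' : ℝ → ℝ} {c C L : ℝ} (hf : IsForce f f' c C L) (α : ℝ) :
    ∃ K, LipschitzWith K (hf.field α) := by
  set A := ContinuousLinearMap.adjoint (bondStrain α ∘L ellDiff) with hA
  have h0 : LipschitzWith C.toNNReal (hf.bondForce α) := by
    refine LipschitzWith.of_dist_le_mul fun x y => ?_
    rw [dist_eq_norm, dist_eq_norm, Real.coe_toNNReal _ hf.C_pos.le]
    exact hf.norm_bondForce_sub_le α x y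
  have h1 : LipschitzWith _ (hf.accel α) := (A.lipschitz.comp (h0.comp (bondStrain α).lipschitz)).neg
  exact ⟨_, (ellDiff.lipschitz.comp LipschitzWith.prod_snd).prodMk (h1.comp LipschitzWith.prod_fst)⟩

/-! ### Global solutions of Lipschitz differential equations -/

section Retract

variable {E : Type*} [NormedAddCommGroup E] [NormedSpace ℝ E]

/-- The radial retraction onto the ball of radius `R`. -/
def radialRetract (R : ℝ) (x : E) : E := (R / max R ‖x‖) • x

lemma radialRetract_of_le {R : ℝ} (hR : 0 < R) {x : E} (hx : ‖x‖ ≤ R) : radialRetract R x = x := by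
  rw [radialRetract, max_eq_left hx, div_self hR.ne', one_smul]

lemma norm_radialRetract {R : ℝ} (hR : 0 < R) (x : E) :
    ‖radialRetract R x‖ ≤ R ∧ ‖radialRetract R x‖ ≤ ‖x‖ := by
  have hm : 0 < max R ‖x‖ := lt_max_of_lt_left hR
  rw [radialRetract, norm_smul, Real.norm_of_nonneg (by positivity), div_mul_eq_mul_div]
  constructor
  · rw [div_le_iff₀ hm]
    exact mul_le_mul_of_nonneg_left (le_max_right _ _) hR.le
  · rw [div_le_iff₀ hm, mul_comm]
    exact mul_le_mul_of_nonneg_left (le_max_left _ _) (norm_nonneg _)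

lemma lipschitzWith_radialRetract {R : ℝ} (hR : 0 < R) :
    LipschitzWith 2 (radialRetract R : E → E) := by
  refine LipschitzWith.of_dist_le_mul fun x y => ?_
  rw [dist_eq_norm, dist_eq_norm]
  have hx : 0 < max R ‖x‖ := lt_max_of_lt_left hR
  have hy : 0 < max R ‖y‖ := lt_max_of_lt_left hR
  have e : radialRetract R x - radialRetract R y
      = (R / max R ‖x‖) • (x - y) + (R / max R ‖x‖ - R / max R ‖y‖) • y := by
    unfold radialRetract
    module
  have h1 : ‖(R / max R ‖x‖) • (x - y)‖ ≤ ‖x - y‖ := by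
    rw [norm_smul, Real.norm_of_nonneg (by positivity)]
    exact mul_le_of_le_one_left (norm_nonneg _) ((div_le_one hx).2 (le_max_left _ _))
  have h2 : ‖(R / max R ‖x‖ - R / max R ‖y‖) • y‖ ≤ ‖x - y‖ := by
    have e2 : R / max R ‖x‖ - R / max R ‖y‖
        = (R / max R ‖x‖) * ((max R ‖y‖ - max R ‖x‖) / max R ‖y‖) := by
      field_simp
    rw [norm_smul, e2, norm_mul, Real.norm_of_nonneg (by positivity : 0 ≤ R / max R ‖x‖), norm_div,
      Real.norm_of_nonneg hy.le, Real.norm_eq_abs]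
    have h3 : |max R ‖y‖ - max R ‖x‖| ≤ ‖x - y‖ := by
      refine (abs_max_sub_max_le_max _ _ _ _).trans ?_
      rw [sub_self, abs_zero, max_eq_right (abs_nonneg _), norm_sub_rev]
      exact abs_norm_sub_norm_le y x
    have h4 : R / max R ‖x‖ ≤ 1 := (div_le_one hx).2 (le_max_left _ _)
    have h5 : ‖y‖ / max R ‖y‖ ≤ 1 := (div_le_one hy).2 (le_max_right _ _)
    calc R / max R ‖x‖ * (|max R ‖y‖ - max R ‖x‖| / max R ‖y‖) * ‖y‖
        = R / max R ‖x‖ * (|max R ‖y‖ - max R ‖x‖| * (‖y‖ / max R ‖y‖)) := by ring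
      _ ≤ 1 * (‖x - y‖ * 1) := by gcongr
      _ = ‖x - y‖ := by ring
  rw [e]
  refine (norm_add_le _ _).trans ?_
  push_cast
  linarith

lemma norm_le_of_norm_deriv_le_affine {K c T : ℝ} (hK : 0 ≤ K) (hc : 0 ≤ c) {y y' : ℝ → E}
    (hy : ∀ t ∈ Icc 0 T, HasDerivWithinAt y (y' t) (Icc 0 T) t)
    (hb : ∀ t, ‖y' t‖ ≤ K * ‖y t‖ + c) {t : ℝ} (ht : t ∈ Icc 0 T) :
    ‖y t‖ ≤ gronwallBound ‖y 0‖ K c T := by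
  have h1 := norm_le_gronwallBound_of_norm_deriv_right_le (f := y) (f' := y') (δ := ‖y 0‖)
    (fun s hs => (hy s hs).continuousWithinAt)
    (fun s hs => (hy s (Ico_subset_Icc_self hs)).mono_of_mem_nhdsWithin
      (Icc_mem_nhdsGE_of_mem hs)) le_rfl (fun s _ => hb s) t ht
  rw [sub_zero] at h1
  exact h1.trans (gronwallBound_mono (norm_nonneg _) hc hK ht.2)

lemma norm_le_of_norm_deriv_le_affine_symm {K c T : ℝ} (hK : 0 ≤ K) (hc : 0 ≤ c) {y y' : ℝ → E}
    (hy : ∀ t ∈ Icc (-T) T, HasDerivWithinAt y (y' t) (Icc (-T) T) t)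
    (hb : ∀ t, ‖y' t‖ ≤ K * ‖y t‖ + c) {t : ℝ} (ht : t ∈ Icc (-T) T) :
    ‖y t‖ ≤ gronwallBound ‖y 0‖ K c T := by
  have hT : 0 ≤ T := by linarith [ht.1, ht.2]
  rcases le_total 0 t with h | h
  · exact norm_le_of_norm_deriv_le_affine hK hc
      (fun s hs => (hy s ⟨by linarith [hs.1], hs.2⟩).mono (Icc_subset_Icc_left (by linarith)))
      hb ⟨h, ht.2⟩
  · have := norm_le_of_norm_deriv_le_affine (y := fun s => y (-s)) (y' := fun s => -y' (-s)) hK hc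
      (T := T) (t := -t)
      (fun s hs => by
        have h1 := hy (-s) ⟨by linarith [hs.2], by linarith [hs.1]⟩
        have hm : MapsTo (fun s : ℝ => -s) (Icc 0 T) (Icc (-T) T) :=
          fun σ hσ => ⟨by linarith [hσ.2], by linarith [hσ.1]⟩
        have h3 : HasDerivWithinAt (y ∘ fun s => -s) ((-1 : ℝ) • y' (-s)) (Icc 0 T) s :=
          HasDerivWithinAt.scomp s h1 (hasDerivAt_neg s).hasDerivWithinAt hm
        rw [neg_one_smul] at h3
        exact h3)
      (fun s => by rw [norm_neg]; exact hb _) ⟨by linarith, by linarith [ht.1]⟩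
    simpa using this

/-- A Lipschitz vector field has solutions on every time interval: the Picard-Lindelöf theorem is
applied to the bounded field obtained with a retraction onto a ball, which by Gronwall's inequality
the solution does not leave. -/
lemma exists_solution_of_lipschitzWith [CompleteSpace E] {V : E → E} {K : NNReal}
    (hV : LipschitzWith K V) (x₀ : E) {T : ℝ} (hT : 0 ≤ T) :
    ∃ x : ℝ → E, x 0 = x₀ ∧ ∀ t ∈ Icc (-T) T, HasDerivWithinAt x (V (x t)) (Icc (-T) T) t := by
  have hgrow : ∀ z, ‖V z‖ ≤ K * ‖z‖ + ‖V 0‖ := by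
    intro z
    have h1 := hV.dist_le_mul z 0
    rw [dist_eq_norm, dist_eq_norm, sub_zero] at h1
    have h2 := norm_le_norm_add_norm_sub' (V z) (V 0)
    linarith
  obtain ⟨R, hRdef⟩ : ∃ R, R = gronwallBound ‖x₀‖ K ‖V 0‖ T + 1 := ⟨_, rfl⟩
  have hR : 0 < R := by
    have := gronwallBound_mono (norm_nonneg x₀) (norm_nonneg (V 0)) K.coe_nonneg hT
    rw [gronwallBound_x0] at this
    linarith [norm_nonneg x₀]
  have hWl : LipschitzWith (K * 2) (fun z => V (radialRetract R z)) :=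
    hV.comp (lipschitzWith_radialRetract hR)
  have hWg : ∀ z, ‖V (radialRetract R z)‖ ≤ K * ‖z‖ + ‖V 0‖ := fun z =>
    (hgrow _).trans (by gcongr; exact (norm_radialRetract hR z).2)
  obtain ⟨M, hM⟩ : ∃ M : NNReal, ∀ z, ‖V (radialRetract R z)‖ ≤ M := by
    refine ⟨K * R.toNNReal + ‖V 0‖₊, fun z => (hgrow _).trans ?_⟩
    simp only [NNReal.coe_add, NNReal.coe_mul, Real.coe_toNNReal _ hR.le, coe_nnnorm]
    gcongr
    exact (norm_radialRetract hR z).1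
  have hPL : IsPicardLindelof (fun _ z => V (radialRetract R z)) (tmin := -T) (tmax := T)
      ⟨0, by constructor <;> linarith⟩ x₀ (M * T.toNNReal) 0 M (K * 2) := by
    refine ⟨fun t _ => hWl.lipschitzOnWith, fun z _ => continuousOn_const, fun t _ z _ => hM z, ?_⟩
    simp [Real.coe_toNNReal _ hT]
  obtain ⟨x, hx0, hx⟩ := hPL.exists_eq_forall_mem_Icc_hasDerivWithinAt₀
  simp only at hx0
  refine ⟨x, hx0, fun t ht => ?_⟩
  have hb := norm_le_of_norm_deriv_le_affine_symm K.coe_nonneg (norm_nonneg (V 0)) hx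
    (fun s => hWg (x s)) ht
  rw [hx0] at hb
  have := hx t ht
  rwa [radialRetract_of_le hR (by linarith)] at this

end Retract

/-! ### Solutions of the Calogero-Moser system and of the lattice equations -/

section Correspondence

variable {α T : ℝ}

/-- A solution of the lattice equations which stays in the range where the force is not truncated is
a solution of the Calogero-Moser system. -/
lemma exists_isCMSolution {d : ℝ} (hα : 1 < α) (hd : d ∈ Ioo (0 : ℝ) 1) (hT : 0 < T)
    {r p : ℝ → EllTwo} {x₀ : ℤ → ℝ}
    (hr : ∀ t ∈ Icc (-T) T, HasDerivWithinAt r (ellDiff (p t)) (Icc (-T) T) t)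
    (hp : ∀ t ∈ Icc (-T) T, HasDerivWithinAt p
      ((isForce_cmForce (zero_lt_one.trans hα) hd).accel α (r t)) (Icc (-T) T) t)
    (hz : ∀ t ∈ Icc (-T) T, ∀ j, 1 + r t j ∈ Icc d d⁻¹)
    (h0 : ∀ j, r 0 j = x₀ (j + 1) - x₀ j - 1) :
    ∃ x : ℤ → ℝ → ℝ, IsCMSolution α T x (fun j t => p t j) ∧ (∀ j, x j 0 = x₀ j) ∧
      ∀ t ∈ Icc (-T) T, ∀ j, r t j = x (j + 1) t - x j t - 1 := by
  have hrc : ContinuousOn r (Icc (-T) T) := fun t ht => (hr t ht).continuousWithinAt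
  have hpc : ContinuousOn p (Icc (-T) T) := fun t ht => (hp t ht).continuousWithinAt
  have h0mem : (0 : ℝ) ∈ Icc (-T) T := ⟨by linarith, hT.le⟩
  have hle : -T ≤ T := by linarith
  have hpext : Continuous (IccExtend hle (domRestrict (Icc (-T) T) p)) :=
    (continuousOn_iff_continuous_domRestrict.1 hpc).Icc_extend'
  have hpext_eq : ∀ t ∈ Icc (-T) T, IccExtend hle (domRestrict (Icc (-T) T) p) t = p t := fun t ht => by
    rw [IccExtend_of_mem _ _ ht]; rfl
  have hev : ∀ (j : ℤ), Continuous fun t => IccExtend hle (domRestrict (Icc (-T) T) p) t j := fun j =>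
    (lp.evalCLM ℝ (fun _ : ℤ => ℝ) 2 j).continuous.comp hpext
  set x : ℤ → ℝ → ℝ := fun j t => x₀ j +
    ∫ s in (0 : ℝ)..t, IccExtend hle (domRestrict (Icc (-T) T) p) s j with hx
  have hxd : ∀ j, ∀ t ∈ Icc (-T) T, HasDerivWithinAt (x j) (p t j) (Icc (-T) T) t := by
    intro j t ht
    have := (intervalIntegral.integral_hasDerivAt_right ((hev j).intervalIntegrable 0 t)
      ((hev j).stronglyMeasurableAtFilter _ _) (hev j).continuousAt).const_add (x₀ j)
    rw [hpext_eq t ht] at this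
    exact this.hasDerivWithinAt
  have hx0 : ∀ j, x j 0 = x₀ j := fun j => by simp [hx]
  have heval : ∀ {z : ℝ → EllTwo} {z' : EllTwo} {t : ℝ}, HasDerivWithinAt z z' (Icc (-T) T) t → ∀ j,
      HasDerivWithinAt (fun s => z s j) (z' j) (Icc (-T) T) t := fun h j =>
    (lp.evalCLM ℝ (fun _ : ℤ => ℝ) 2 j).hasFDerivAt.comp_hasDerivWithinAt _ h
  have hrx : ∀ t ∈ Icc (-T) T, ∀ j, r t j = x (j + 1) t - x j t - 1 := by
    intro t ht j
    have key := (convex_Icc (-T) T).norm_image_sub_le_of_norm_hasDerivWithin_le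
      (f := fun t => r t j - (x (j + 1) t - x j t - 1)) (f' := fun _ => 0) (C := 0)
      (fun s hs => by
        have := (heval (hr s hs) j).sub (((hxd (j + 1) s hs).sub (hxd j s hs)).sub_const 1)
        rw [ellDiff_apply, sub_self] at this
        exact this) (fun s _ => by simp) h0mem ht
    rw [zero_mul, norm_le_zero_iff, hx0, hx0, ← h0, sub_self, sub_zero, sub_eq_zero] at key
    exact key
  have hpos : ∀ t ∈ Icc (-T) T, ∀ j, 0 < x (j + 1) t - x j t := fun t ht j => by
    have h1 := (hz t ht j).1
    have h2 := hrx t ht j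
    linarith [hd.1]
  have hforce : ∀ t ∈ Icc (-T) T, ∀ j, HasSum (fun m => -α * cmTerm α (fun i => x i t) j m)
      ((isForce_cmForce (zero_lt_one.trans hα) hd).accel α (r t) j) := fun t ht j =>
    hasSum_cmTerm hα hd (hrx t ht) (hz t ht) j
  have hα0 : -α ≠ 0 := by linarith
  obtain ⟨K, hK⟩ := (isForce_cmForce (zero_lt_one.trans hα) hd).exists_lipschitzWith_field α
  have hacc : Continuous ((isForce_cmForce (zero_lt_one.trans hα) hd).accel α) := by
    have := continuous_snd.comp (hK.continuous.comp
      (continuous_id.prodMk (continuous_const (y := (0 : EllTwo)))))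
    exact this
  have hC1 : ∀ {z z' : ℝ → EllTwo}, (∀ t ∈ Icc (-T) T, HasDerivWithinAt z (z' t) (Icc (-T) T) t) →
      ContinuousOn z' (Icc (-T) T) → ContDiffOn ℝ 1 z (Icc (-T) T) := by
    intro z z' hz hz'
    rw [contDiffOn_one_iff_derivWithin (uniqueDiffOn_Icc (by linarith))]
    refine ⟨fun t ht => (hz t ht).differentiableWithinAt, hz'.congr fun t ht => ?_⟩
    exact (hz t ht).derivWithin (uniqueDiffOn_Icc (by linarith) t ht)
  refine ⟨x, ⟨fun t ht => ?_, hxd, fun j t ht => ?_, fun j t ht => ?_, r, p, ?_, ?_, fun t ht j => ?_⟩,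
    hx0, hrx⟩
  · exact strictMono_int_of_lt_succ fun j => by linarith [hpos t ht j]
  · exact (summable_mul_left_iff hα0).1 (hforce t ht j).summable
  · rw [← tsum_mul_left, (hforce t ht j).tsum_eq]
    exact heval (hp t ht) j
  · exact hC1 hr (ellDiff.continuous.comp_continuousOn hpc)
  · exact hC1 hp (hacc.comp_continuousOn hrc)
  · exact ⟨hrx t ht j, rfl⟩

lemma exists_pos_lower_bound {R : EllTwo} (h : ∀ j, 0 < 1 + R j) : ∃ δ > 0, ∀ j, δ ≤ 1 + R j := by
  have hfin : {j | ¬ |R j| < 1 / 2}.Finite := by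
    have h1 := (lp_two_hasSum_sq R).summable.tendsto_cofinite_zero
    have h2 : ∀ᶠ j in Filter.cofinite, R j ^ 2 < 1 / 4 := h1.eventually_lt_const (by norm_num)
    have h3 : ∀ᶠ j in Filter.cofinite, |R j| < 1 / 2 := by
      filter_upwards [h2] with j hj
      refine abs_lt_of_sq_lt_sq ?_ (by norm_num)
      linarith
    exact h3
  obtain ⟨M, hM⟩ := (hfin.image fun j => (1 + R j)⁻¹).bddAbove
  refine ⟨min (1 / 2) (max M 1)⁻¹, by positivity, fun j => ?_⟩
  by_cases hj : |R j| < 1 / 2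
  · exact (min_le_left _ _).trans (by linarith [(abs_lt.1 hj).1])
  · refine (min_le_right _ _).trans ?_
    rw [inv_le_comm₀ (by positivity) (h j)]
    exact (hM (mem_image_of_mem _ hj)).trans (le_max_left _ _)

/-- Along a solution the relative bond lengths stay in a compact subset of `(0, ∞)`, and the solution
solves the lattice equations for every truncation outside of this set. -/
lemma IsCMSolution.exists_lattice (hα : 1 < α) (hT : 0 < T) {x p : ℤ → ℝ → ℝ}
    (h : IsCMSolution α T x p) :
    ∃ R P : ℝ → EllTwo, (∀ t ∈ Icc (-T) T, ∀ j, R t j = x (j + 1) t - x j t - 1 ∧ P t j = p j t) ∧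
      ∃ d₀ ∈ Ioo (0 : ℝ) 1, ∀ d, ∀ hd : d ∈ Ioo (0 : ℝ) 1, d ≤ d₀ → ∀ t ∈ Icc (-T) T,
        HasDerivWithinAt (fun t => (R t, P t))
          ((isForce_cmForce (zero_lt_one.trans hα) hd).field α (R t, P t)) (Icc (-T) T) t := by
  obtain ⟨R, P, hR, hP, hRP⟩ := h.regular
  refine ⟨R, P, hRP, ?_⟩
  have hun := uniqueDiffOn_Icc (show -T < T by linarith)
  have hpos : ∀ t ∈ Icc (-T) T, ∀ j, 0 < 1 + R t j := fun t ht j => by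
    have h1 := h.ordered t ht (show j < j + 1 by omega)
    simp only at h1
    rw [(hRP t ht j).1]
    linarith
  have hlow : ∃ δ > 0, ∀ t ∈ Icc (-T) T, ∀ j, δ ≤ 1 + R t j := by
    refine isCompact_Icc.induction_on (p := fun S => ∃ δ > 0, ∀ t ∈ S, ∀ j, δ ≤ 1 + R t j)
      ⟨1, one_pos, by simp⟩ (fun s t hst ⟨δ, hδ, h⟩ => ⟨δ, hδ, fun x hx => h x (hst hx)⟩)
      (fun s t ⟨δ, hδ, h⟩ ⟨δ', hδ', h'⟩ => ⟨min δ δ', lt_min hδ hδ', fun x hx j => ?_⟩) (fun t ht => ?_)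
    · rcases hx with hx | hx
      · exact (min_le_left _ _).trans (h x hx j)
      · exact (min_le_right _ _).trans (h' x hx j)
    · obtain ⟨δ, hδ, hb⟩ := exists_pos_lower_bound (hpos t ht)
      have hc : ContinuousWithinAt R (Icc (-T) T) t := hR.continuousOn t ht
      refine ⟨_, Metric.tendsto_nhds.1 hc (δ / 2) (by positivity), δ / 2, by positivity, fun s hs j => ?_⟩
      have hs' : ‖R s - R t‖ < δ / 2 := by simpa [dist_eq_norm] using hs
      have h1 := lp_two_abs_apply_le (R s - R t) j
      have h2 : (R s - R t) j = R s j - R t j := rfl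
      rw [h2] at h1
      have := (abs_le.1 h1).1
      linarith [hb j]
  obtain ⟨δ, hδ, hlow⟩ := hlow
  obtain ⟨M, hM⟩ := (isCompact_Icc.image_of_continuousOn hR.continuousOn.norm).bddAbove
  have hup : ∀ t ∈ Icc (-T) T, ∀ j, 1 + R t j ≤ 1 + max M 1 := fun t ht j => by
    have h1 := lp_two_abs_apply_le (R t) j
    have h2 : ‖R t‖ ≤ M := hM (mem_image_of_mem _ ht)
    have h3 := le_abs_self (R t j)
    linarith [le_max_left M 1]
  have hMpos : 0 < 1 + max M 1 := by positivity
  refine ⟨min (min δ (1 / 2)) (1 + max M 1)⁻¹, ⟨by positivity, ?_⟩, fun d hd hdle t ht => ?_⟩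
  · exact lt_of_le_of_lt ((min_le_left _ _).trans (min_le_right _ _)) (by norm_num)
  have hz : ∀ j, 1 + R t j ∈ Icc d d⁻¹ := fun j => by
    refine ⟨(hdle.trans ((min_le_left _ _).trans (min_le_left _ _))).trans (hlow t ht j), ?_⟩
    refine (hup t ht j).trans ?_
    rw [le_inv_comm₀ hMpos hd.1]
    exact hdle.trans (min_le_right _ _)
  have heval : ∀ {z : ℝ → EllTwo} {z' : EllTwo}, HasDerivWithinAt z z' (Icc (-T) T) t → ∀ j,
      HasDerivWithinAt (fun s => z s j) (z' j) (Icc (-T) T) t := fun h j =>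
    (lp.evalCLM ℝ (fun _ : ℤ => ℝ) 2 j).hasFDerivAt.comp_hasDerivWithinAt _ h
  have dR := ((hR.differentiableOn one_ne_zero) t ht).hasDerivWithinAt
  have dP := ((hP.differentiableOn one_ne_zero) t ht).hasDerivWithinAt
  have e1 : derivWithin R (Icc (-T) T) t = ellDiff (P t) := by
    ext j
    have h1 := ((h.velocity (j + 1) t ht).sub (h.velocity j t ht)).sub_const 1
    have h2 : HasDerivWithinAt (fun s => R s j) (p (j + 1) t - p j t) (Icc (-T) T) t :=
      h1.congr (fun s hs => (hRP s hs j).1) (hRP t ht j).1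
    rw [ellDiff_apply, (hRP t ht _).2, (hRP t ht _).2]
    exact (hun t ht).eq_deriv _ (heval dR j) h2
  have e2 : derivWithin P (Icc (-T) T) t
      = (isForce_cmForce (zero_lt_one.trans hα) hd).accel α (R t) := by
    ext j
    have h2 : HasDerivWithinAt (fun s => P s j) (-α * ∑' m : ℕ, cmTerm α (fun i => x i t) j m)
        (Icc (-T) T) t :=
      (h.acceleration j t ht).congr (fun s hs => (hRP s hs j).2) (hRP t ht j).2
    rw [← (hasSum_cmTerm hα hd (q := fun i => x i t) (fun j => (hRP t ht j).1) hz j).tsum_eq, tsum_mul_left]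
    exact (hun t ht).eq_deriv _ (heval dP j) h2
  rw [e1] at dR
  rw [e2] at dP
  exact dR.prodMk dP

lemma IsCMSolution.unique (hα : 1 < α) (hT : 0 < T) {x p y q : ℤ → ℝ → ℝ}
    (hx : IsCMSolution α T x p) (hy : IsCMSolution α T y q)
    (h0 : ∀ j, y j 0 = x j 0 ∧ q j 0 = p j 0) {t : ℝ} (ht : t ∈ Icc (-T) T) (j : ℤ) :
    y j t = x j t ∧ q j t = p j t := by
  obtain ⟨R, P, hRP, d₁, hd₁, hode₁⟩ := hx.exists_lattice hα hT
  obtain ⟨S, Q, hSQ, d₂, hd₂, hode₂⟩ := hy.exists_lattice hα hT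
  have hd : min d₁ d₂ ∈ Ioo (0 : ℝ) 1 := ⟨lt_min hd₁.1 hd₂.1, (min_le_left _ _).trans_lt hd₁.2⟩
  have o1 := hode₁ _ hd (min_le_left _ _)
  have o2 := hode₂ _ hd (min_le_right _ _)
  obtain ⟨K, hK⟩ := (isForce_cmForce (zero_lt_one.trans hα) hd).exists_lipschitzWith_field α
  have h0mem : (0 : ℝ) ∈ Icc (-T) T := ⟨by linarith, hT.le⟩
  have heq : (S 0, Q 0) = (R 0, P 0) := by
    refine Prod.ext ?_ ?_
    · ext j
      simp only [(hSQ 0 h0mem j).1, (hRP 0 h0mem j).1, (h0 _).1]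
    · ext j
      simp only [(hSQ 0 h0mem j).2, (hRP 0 h0mem j).2, (h0 _).2]
  have huniq := ODE_solution_unique_of_mem_Icc (v := fun _ =>
      (isForce_cmForce (zero_lt_one.trans hα) hd).field α) (s := fun _ => univ) (K := K) (t₀ := 0)
    (fun _ _ => hK.lipschitzOnWith) ⟨by linarith, hT⟩
    (fun s hs => (o2 s hs).continuousWithinAt)
    (fun s hs => (o2 s (Ioo_subset_Icc_self hs)).hasDerivAt (Icc_mem_nhds hs.1 hs.2))
    (fun _ _ => mem_univ _)
    (fun s hs => (o1 s hs).continuousWithinAt)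
    (fun s hs => (o1 s (Ioo_subset_Icc_self hs)).hasDerivAt (Icc_mem_nhds hs.1 hs.2))
    (fun _ _ => mem_univ _) heq
  have hqp : ∀ s ∈ Icc (-T) T, q j s = p j s := fun s hs => by
    have := congrArg Prod.snd (huniq hs)
    simp only at this
    rw [← (hSQ s hs j).2, ← (hRP s hs j).2, this]
  refine ⟨?_, hqp t ht⟩
  have key := (convex_Icc (-T) T).norm_image_sub_le_of_norm_hasDerivWithin_le
    (f := fun t => y j t - x j t) (f' := fun _ => 0) (C := 0)
    (fun s hs => by
      have := (hy.velocity j s hs).sub (hx.velocity j s hs)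
      rw [hqp s hs, sub_self] at this
      exact this) (fun s _ => by simp) h0mem ht
  rw [zero_mul, norm_le_zero_iff, (h0 j).1, sub_self, sub_zero, sub_eq_zero] at key
  exact key

end Correspondence

/-! ### Functions with square-summable samples -/

/-- The samples of `g` on every grid of step `ε ≤ 1` have an `ℓ²` norm of at most `K / √ε`. The norm
is expressed by duality, which makes the notion linear in `g`. -/
def SampleBound (K : ℝ) (g : ℝ → ℝ) : Prop :=
  ∀ ε ∈ Ioc (0 : ℝ) 1, ∀ (θ : ℝ) (F : Finset ℤ) (w : ℤ → ℝ), ∑ j ∈ F, w j ^ 2 ≤ 1 →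
    ∑ j ∈ F, w j * g (ε * j + θ) ≤ K / √ε

lemma SampleBound.of_sum_sq_le {K : ℝ} {g : ℝ → ℝ} (hK : 0 ≤ K)
    (h : ∀ ε ∈ Ioc (0 : ℝ) 1, ∀ (θ : ℝ) (F : Finset ℤ), ∑ j ∈ F, g (ε * j + θ) ^ 2 ≤ K ^ 2 / ε) :
    SampleBound K g := by
  intro ε hε θ F w hw
  refine (Real.sum_mul_le_sqrt_mul_sqrt F w fun j => g (ε * j + θ)).trans ?_
  have h1 : √(∑ j ∈ F, w j ^ 2) ≤ 1 := Real.sqrt_le_one.2 hw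
  have h2 : √(∑ j ∈ F, g (ε * j + θ) ^ 2) ≤ K / √ε := by
    rw [← Real.sqrt_sq hK, ← Real.sqrt_div (sq_nonneg K)]
    exact Real.sqrt_le_sqrt (h ε hε θ F)
  calc _ ≤ 1 * (K / √ε) := mul_le_mul h1 h2 (Real.sqrt_nonneg _) zero_le_one
    _ = _ := one_mul _

namespace SampleBound

variable {K L : ℝ} {g h : ℝ → ℝ}

lemma nonneg (hg : SampleBound K g) : 0 ≤ K := by
  simpa using hg 1 ⟨one_pos, le_rfl⟩ 0 ∅ 0 (by simp)

lemma sum_sq_le (hg : SampleBound K g) {ε : ℝ} (hε : ε ∈ Ioc (0 : ℝ) 1) (θ : ℝ) (F : Finset ℤ) :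
    ∑ j ∈ F, g (ε * j + θ) ^ 2 ≤ K ^ 2 / ε := by
  obtain ⟨S, hS⟩ : ∃ S, S = ∑ j ∈ F, g (ε * j + θ) ^ 2 := ⟨_, rfl⟩
  have hS0 : 0 ≤ S := hS ▸ Finset.sum_nonneg fun _ _ => sq_nonneg _
  rw [← hS]
  rcases hS0.eq_or_lt with h0 | h0
  · rw [← h0]
    exact div_nonneg (sq_nonneg K) hε.1.le
  · have hs : 0 < √S := Real.sqrt_pos.2 h0
    have key := hg ε hε θ F (fun j => g (ε * j + θ) / √S) (by
      simp only [div_pow, Real.sq_sqrt hS0]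
      rw [← Finset.sum_div, ← hS, div_self h0.ne'])
    have e : ∑ j ∈ F, g (ε * j + θ) / √S * g (ε * j + θ) = √S := by
      have : ∀ j ∈ F, g (ε * j + θ) / √S * g (ε * j + θ) = g (ε * j + θ) ^ 2 / √S :=
        fun j _ => by ring
      rw [Finset.sum_congr rfl this, ← Finset.sum_div, ← hS, Real.div_sqrt]
    rw [e] at key
    calc S = √S ^ 2 := (Real.sq_sqrt hS0).symm
      _ ≤ (K / √ε) ^ 2 := pow_le_pow_left₀ hs.le key 2
      _ = K ^ 2 / ε := by rw [div_pow, Real.sq_sqrt hε.1.le]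

lemma abs_le (hg : SampleBound K g) (X : ℝ) : |g X| ≤ K := by
  have := hg.sum_sq_le (ε := 1) ⟨one_pos, le_rfl⟩ X {0}
  simp only [Finset.sum_singleton, Int.cast_zero, mul_zero, zero_add, div_one] at this
  exact abs_le_of_sq_le_sq this hg.nonneg

lemma mono (hg : SampleBound K g) (hKL : K ≤ L) : SampleBound L g := fun ε hε θ F w hw =>
  (hg ε hε θ F w hw).trans (by gcongr)

lemma of_abs_le (hg : SampleBound K g) (hh : ∀ X, |h X| ≤ |g X|) : SampleBound K h :=
  of_sum_sq_le hg.nonneg fun _ hε θ F =>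
    (Finset.sum_le_sum fun _ _ => sq_le_sq.2 (hh _)).trans (hg.sum_sq_le hε θ F)

lemma add (hg : SampleBound K g) (hh : SampleBound L h) : SampleBound (K + L) fun X => g X + h X :=
  fun ε hε θ F w hw => by
    simp only [mul_add, Finset.sum_add_distrib, add_div]
    exact add_le_add (hg ε hε θ F w hw) (hh ε hε θ F w hw)

lemma neg (hg : SampleBound K g) : SampleBound K fun X => -g X :=
  hg.of_abs_le fun _ => (abs_neg _).le

lemma sub (hg : SampleBound K g) (hh : SampleBound L h) : SampleBound (K + L) fun X => g X - h X := by
  simpa only [sub_eq_add_neg] using hg.add hh.neg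

lemma mul_of_abs_le (hg : SampleBound K g) (hL : 0 ≤ L) (hh : ∀ X, |h X| ≤ L) :
    SampleBound (L * K) fun X => h X * g X := by
  refine of_sum_sq_le (mul_nonneg hL hg.nonneg) fun ε hε θ F => ?_
  have h1 : ∀ j ∈ F, (h (ε * j + θ) * g (ε * j + θ)) ^ 2 ≤ L ^ 2 * g (ε * j + θ) ^ 2 := fun j _ => by
    rw [mul_pow]
    refine mul_le_mul_of_nonneg_right ?_ (sq_nonneg _)
    rw [← sq_abs (h _)]
    exact pow_le_pow_left₀ (abs_nonneg _) (hh _) 2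
  refine (Finset.sum_le_sum h1).trans ?_
  rw [← Finset.mul_sum, mul_pow, mul_div_assoc]
  exact mul_le_mul_of_nonneg_left (hg.sum_sq_le hε θ F) (sq_nonneg L)

lemma mul (hh : SampleBound L h) (hg : SampleBound K g) : SampleBound (L * K) fun X => h X * g X :=
  hg.mul_of_abs_le hh.nonneg hh.abs_le

lemma const_mul (c : ℝ) (hg : SampleBound K g) : SampleBound (|c| * K) fun X => c * g X :=
  hg.mul_of_abs_le (abs_nonneg c) fun _ => le_rfl

lemma comp_add (hg : SampleBound K g) (a : ℝ) : SampleBound K fun X => g (X + a) :=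
  fun ε hε θ F w hw => by simpa only [add_assoc] using hg ε hε (θ + a) F w hw

lemma hasSum {κ : ℕ → ℝ} {G : ℕ → ℝ → ℝ} {S : ℝ} (hG : ∀ n, SampleBound (κ n) (G n))
    (hκ : HasSum κ S) (hg : ∀ X, HasSum (fun n => G n X) (g X)) : SampleBound S g :=
  fun ε hε θ F w hw => by
    have h1 : HasSum (fun n => ∑ j ∈ F, w j * G n (ε * j + θ)) (∑ j ∈ F, w j * g (ε * j + θ)) :=
      hasSum_sum fun j _ => (hg _).mul_left _
    exact hasSum_le (fun n => hG n ε hε θ F w hw) h1 (hκ.div_const _)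

lemma integral {κ : ℝ → ℝ} {G : ℝ → ℝ → ℝ} {A : Set ℝ} (hA : MeasurableSet A)
    (hG : ∀ s ∈ A, SampleBound (κ s) (G s)) (hκ : IntegrableOn κ A)
    (hg : ∀ X, IntegrableOn (fun s => G s X) A) :
    SampleBound (∫ s in A, κ s) fun X => ∫ s in A, G s X :=
  fun ε hε θ F w hw => by
    have h1 : ∑ j ∈ F, w j * ∫ s in A, G s (ε * j + θ)
        = ∫ s in A, ∑ j ∈ F, w j * G s (ε * j + θ) := by
      rw [integral_finsetSum _ fun j _ => (hg _).const_mul _]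
      exact Finset.sum_congr rfl fun j _ => (integral_const_mul _ _).symm
    rw [h1, ← integral_div]
    exact setIntegral_mono_on (integrable_finsetSum _ fun j _ => (hg _).const_mul _)
      (hκ.div_const _) hA fun s hs => hG s hs ε hε θ F w hw

/-- The symmetric second difference is small for small steps. -/
lemma second_difference {g' g'' : ℝ → ℝ} (hg : SampleBound K g) (h1 : ∀ x, HasDerivAt g (g' x) x)
    (h2 : ∀ x, HasDerivAt g' (g'' x) x) (hg'' : SampleBound K g'') {s : ℝ} (hs : 0 < s) :
    SampleBound (2 * K * min 1 (s ^ 2)) fun X => g X - (g (X + s) + g (X - s)) / 2 := by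
  have hK := hg.nonneg
  rw [mul_min_of_nonneg _ _ (by positivity : 0 ≤ 2 * K)]
  rcases min_choice (2 * K * 1) (2 * K * s ^ 2) with h | h <;> rw [h]
  · have := hg.sub (((hg.comp_add s).add (hg.comp_add (-s))).const_mul (1 / 2))
    refine (this.mono (le_of_eq ?_)).of_abs_le fun X => le_of_eq (congrArg _ ?_)
    · rw [abs_of_pos (by norm_num)]; ring
    · rw [sub_eq_add_neg X s]; ring
  · intro ε hε θ F w hw
    have key := norm_second_difference_le (f := fun y => ∑ j ∈ F, w j * g (ε * j + y))
      (f' := fun y => ∑ j ∈ F, w j * g' (ε * j + y)) (f'' := fun y => ∑ j ∈ F, w j * g'' (ε * j + y))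
      (c := θ) (s := s) (B := K / √ε) hs.le
      (fun x _ => by
        simpa [Finset.sum_fn] using!
          HasDerivAt.sum fun j (_ : j ∈ F) => ((h1 (ε * j + x)).comp_const_add _ _).const_mul (w j))
      (fun x _ => by
        simpa [Finset.sum_fn] using!
          HasDerivAt.sum fun j (_ : j ∈ F) => ((h2 (ε * j + x)).comp_const_add _ _).const_mul (w j))
      (fun x _ => by
        rw [Real.norm_eq_abs, abs_le']
        refine ⟨hg'' ε hε x F w hw, ?_⟩
        have := hg'' ε hε x F (fun j => -w j) (by simpa using hw)
        simpa using this)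
    rw [Real.norm_eq_abs, smul_eq_mul] at key
    have e : ∑ j ∈ F, w j * (g (ε * j + θ) - (g (ε * j + θ + s) + g (ε * j + θ - s)) / 2)
        = -(1 / 2) * (∑ j ∈ F, w j * g (ε * j + (θ + s)) + ∑ j ∈ F, w j * g (ε * j + (θ - s))
          - 2 * ∑ j ∈ F, w j * g (ε * j + θ)) := by
      rw [Finset.mul_sum, ← Finset.sum_add_distrib, ← Finset.sum_sub_distrib, Finset.mul_sum]
      refine Finset.sum_congr rfl fun j _ => ?_
      rw [← add_assoc, ← add_sub_assoc]
      ring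
    rw [e]
    have h3 := (_root_.abs_le.1 key).1
    have h4 : 0 ≤ K / √ε * s ^ 2 := by positivity
    have h5 : 2 * K * s ^ 2 / √ε = 2 * (K / √ε * s ^ 2) := by ring
    rw [h5]
    linarith

end SampleBound

/-! ### Fourier multipliers -/

section Multiplier

variable {K K' : ℝ} {m m' : ℝ → ℂ}

lemma one_le_jap_pow (k : ℝ) (n : ℕ) : 1 ≤ jap k ^ n := one_le_pow₀ (one_le_jap k)

lemma isMult_of_le_pow {n : ℕ} (hn : n ≤ 5) (hm : Measurable m) (hK : 0 ≤ K)
    (h : ∀ k, ‖m k‖ ≤ K * jap k ^ n) : IsMult K m :=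
  ⟨hm, hK, fun k => (h k).trans (by gcongr; exact one_le_jap k)⟩

/-- The real part of the function with spectral density `m v`. -/
def multSynth (m v : ℝ → ℂ) (X : ℝ) : ℝ := (fourierSynth (fun k => m k * v k) X).re

variable {L : ℝ} {v : ℝ → ℂ}

lemma SpectralBound.sampleBound (hv : SpectralBound L v) (hm : IsMult K m) :
    SampleBound (4 * K * L) (multSynth m v) :=
  SampleBound.of_sum_sq_le (by have := hv.nonneg; have := hm.nonneg; positivity)
    fun ε hε θ F => (Finset.sum_le_sum fun j _ => by
      rw [← sq_abs]
      exact pow_le_pow_left₀ (abs_nonneg _) (Complex.abs_re_le_norm _) 2).trans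
        (hv.sum_sample_le hm hε θ F)

lemma SpectralBound.hasDerivAt_multSynth (hv : SpectralBound L v) (hm : IsMult K m)
    (hm' : IsMult K' fun k => Complex.I * k * m k) (X : ℝ) :
    HasDerivAt (multSynth m v) (multSynth (fun k => Complex.I * k * m k) v X) X := by
  have h1 := hasDerivAt_fourierSynth (hv.integrable_mul hm)
    (by simpa only [mul_assoc] using hv.integrable_mul hm') X
  have h2 := (Complex.reCLM.hasFDerivAt.comp_hasDerivAt X h1)
  simpa only [multSynth, mul_assoc] using! h2

lemma SpectralBound.multSynth_sub (hv : SpectralBound L v) (hm : IsMult K m) (hm' : IsMult K' m')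
    (X : ℝ) : multSynth m v X - multSynth m' v X = multSynth (fun k => m k - m' k) v X := by
  unfold multSynth fourierSynth
  rw [← Complex.sub_re, ← integral_sub]
  · congr 2
    ext k
    ring
  · exact integrable_fourierSynth_integrand (hv.integrable_mul hm) X
  · exact integrable_fourierSynth_integrand (hv.integrable_mul hm') X

lemma SpectralBound.const_mul_multSynth (c : ℝ) (m v : ℝ → ℂ) (X : ℝ) :
    c * multSynth m v X = multSynth (fun k => c * m k) v X := by
  unfold multSynth fourierSynth
  rw [← Complex.re_ofReal_mul, ← integral_const_mul]
  congr 2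
  ext k
  ring

/-- Superposition of multipliers. -/
lemma SpectralBound.hasSum_multSynth (hv : SpectralBound L v) {a : ℕ → ℝ} (ha : Summable a)
    (ha0 : ∀ n, 0 ≤ a n) {M : ℕ → ℝ → ℂ} (hM : ∀ n, IsMult K (M n))
    (hm : ∀ k, HasSum (fun n => a n * M n k) (m k)) (X : ℝ) :
    HasSum (fun n => a n * multSynth (M n) v X) (multSynth m v X) := by
  have hi : ∀ n, Integrable fun k => a n * M n k * v k * Complex.exp (Complex.I * (k * X)) := by
    intro n
    simpa only [mul_assoc] using
      (integrable_fourierSynth_integrand (hv.integrable_mul (hM n)) X).const_mul (a n : ℂ)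
  have hb : ∀ n, ∫ k, ‖a n * M n k * v k * Complex.exp (Complex.I * (k * X))‖ ≤ a n * (K * (3 * L)) := by
    intro n
    have h1 : ∫ k, ‖a n * M n k * v k * Complex.exp (Complex.I * (k * X))‖
        ≤ ∫ k, a n * (K * (jap k ^ 5 * ‖v k‖)) := by
      refine integral_mono (hi n).norm ((hv.integrable_jap_five.const_mul K).const_mul _) fun k => ?_
      simp only [norm_mul, norm_exp_I_mul, mul_one, Complex.norm_real, Real.norm_of_nonneg (ha0 n),
        mul_assoc]
      rw [← mul_assoc K]
      gcongr
      · exact ha0 n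
      · exact (hM n).le k
    rw [integral_const_mul, integral_const_mul] at h1
    refine h1.trans ?_
    have := hv.integral_jap_five_le
    have := (hM n).nonneg
    have := ha0 n
    gcongr
  have hs : Summable fun n => ∫ k, ‖a n * M n k * v k * Complex.exp (Complex.I * (k * X))‖ :=
    Summable.of_nonneg_of_le (fun n => integral_nonneg fun k => norm_nonneg _) hb (ha.mul_right _)
  have key := hasSum_integral_of_summable_integral_norm hi hs
  have e : ∀ k, ∑' n, a n * M n k * v k * Complex.exp (Complex.I * (k * X))
      = m k * v k * Complex.exp (Complex.I * (k * X)) := fun k => by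
    simpa only [mul_assoc] using (((hm k).mul_right (v k)).mul_right
      (Complex.exp (Complex.I * (k * X)))).tsum_eq
  simp only [e] at key
  have h2 := Complex.reCLM.hasSum key
  refine (h2.congr_fun fun n => ?_)
  rw [SpectralBound.const_mul_multSynth]
  rfl

end Multiplier

/-- A Fourier multiplier of order `n` with constant `K`. -/
structure MultOrder (n : ℕ) (K : ℝ) (m : ℝ → ℂ) : Prop where
  measurable : Measurable m
  nonneg : 0 ≤ K
  le : ∀ k, ‖m k‖ ≤ K * jap k ^ n

namespace MultOrder

variable {n : ℕ} {K : ℝ} {m : ℝ → ℂ}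

lemma isMult (hm : MultOrder n K m) (hn : n ≤ 5) : IsMult K m :=
  isMult_of_le_pow hn hm.measurable hm.nonneg hm.le

lemma deriv (hm : MultOrder n K m) : MultOrder (n + 1) K fun k => Complex.I * k * m k where
  measurable := ((by fun_prop : Measurable fun k : ℝ => Complex.I * (k : ℂ))).mul hm.measurable
  nonneg := hm.nonneg
  le k := by
    simp only [norm_mul, Complex.norm_I, Complex.norm_real, Real.norm_eq_abs, one_mul]
    have h1 := abs_le_jap k
    have h2 := hm.le k
    have h3 := jap_pos k
    calc |k| * ‖m k‖ ≤ jap k * (K * jap k ^ n) := by gcongr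
      _ = K * jap k ^ (n + 1) := by ring

lemma one : MultOrder 0 1 fun _ => 1 where
  measurable := measurable_const
  nonneg := zero_le_one
  le k := by simp

end MultOrder

lemma abs_rpow_le_jap_pow {β : ℝ} (hβ : 0 ≤ β) {n : ℕ} (hn : β ≤ n) (k : ℝ) :
    |k| ^ β ≤ jap k ^ n := by
  rw [← Real.rpow_natCast]
  exact (Real.rpow_le_rpow (abs_nonneg k) (abs_le_jap k) hβ).trans
    (Real.rpow_le_rpow_of_exponent_le (one_le_jap k) hn)

lemma continuous_abs_rpow {β : ℝ} (hβ : 0 ≤ β) : Continuous fun k : ℝ => |k| ^ β :=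
  continuous_abs.rpow_const fun _ => Or.inr hβ

lemma multOrder_abs_rpow {β : ℝ} (hβ : 0 ≤ β) {n : ℕ} (hn : β ≤ n) :
    MultOrder n 1 fun k => ((|k| ^ β : ℝ) : ℂ) where
  measurable := Complex.measurable_ofReal.comp (continuous_abs_rpow hβ).measurable
  nonneg := zero_le_one
  le k := by
    rw [Complex.norm_real, Real.norm_of_nonneg (Real.rpow_nonneg (abs_nonneg k) β), one_mul]
    exact abs_rpow_le_jap_pow hβ hn k

/-! ### Moving averages -/

lemma abs_sinc_le_one (x : ℝ) : |Real.sinc x| ≤ 1 := by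
  rw [abs_le]
  exact ⟨Real.neg_one_le_sinc x, Real.sinc_le_one x⟩

lemma mul_sinc (x : ℝ) : x * Real.sinc x = Real.sin x := by
  rcases eq_or_ne x 0 with rfl | hx
  · simp
  · rw [Real.sinc_of_ne_zero hx, mul_div_cancel₀ _ hx]

lemma abs_one_sub_sinc_le (x : ℝ) : |1 - Real.sinc x| ≤ x ^ 2 / 2 := by
  have key : ∀ y : ℝ, 0 < y → |1 - Real.sinc y| ≤ y ^ 2 / 2 := fun y hy => by
    have h1 := abs_two_mul_sub_sin_le hy.le
    rw [← mul_sinc y, show 2 * y - 2 * (y * Real.sinc y) = 2 * y * (1 - Real.sinc y) by ring, abs_mul,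
      abs_of_pos (by positivity)] at h1
    rw [← mul_le_mul_iff_right₀ (by positivity : 0 < 2 * y)]
    calc _ ≤ y ^ 3 := h1
      _ = _ := by ring
  rcases lt_trichotomy x 0 with h | rfl | h
  · have := key (-x) (by linarith)
    rwa [Real.sinc_neg, neg_sq] at this
  · simp
  · exact key x h

lemma abs_one_sub_sinc_sq_le (x : ℝ) : |1 - Real.sinc x ^ 2| ≤ min 1 (x ^ 2) := by
  have h0 := Real.sinc_le_one x
  have h1 := Real.neg_one_le_sinc x
  refine le_min ?_ ?_
  · rw [abs_le]
    constructor <;> nlinarith [sq_nonneg (Real.sinc x)]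
  · rw [show 1 - Real.sinc x ^ 2 = (1 - Real.sinc x) * (1 + Real.sinc x) by ring, abs_mul]
    have h2 : |1 + Real.sinc x| ≤ 2 := by rw [abs_le]; constructor <;> linarith
    have h3 := abs_one_sub_sinc_le x
    calc |1 - Real.sinc x| * |1 + Real.sinc x| ≤ x ^ 2 / 2 * 2 := by gcongr
      _ = x ^ 2 := by ring

/-- The Fourier multiplier of the moving average over `[X, X + h]`. -/
def avgMult (h k : ℝ) : ℂ := Complex.exp (Complex.I * (k * h / 2)) * (Real.sinc (h * k / 2) : ℝ)

lemma integral_exp_avg (h k X : ℝ) :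
    ∫ x in X..X + h, Complex.exp (Complex.I * (k * x))
      = h * (avgMult h k * Complex.exp (Complex.I * (k * X))) := by
  rcases eq_or_ne k 0 with rfl | hk
  · simp [avgMult]
  have hk' : Complex.I * (k : ℂ) ≠ 0 := mul_ne_zero Complex.I_ne_zero (by exact_mod_cast hk)
  have h1 := integral_exp_mul_complex (a := X) (b := X + h) hk'
  simp only [mul_assoc] at h1 hk' ⊢
  rw [h1, div_eq_iff hk']
  have h2 : (h : ℂ) * ((Real.sinc (h * k / 2) : ℝ) : ℂ) * k = 2 * Complex.sin (h * k / 2) := by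
    have := mul_sinc (h * k / 2)
    have h3 : h * Real.sinc (h * k / 2) * k = 2 * Real.sin (h * k / 2) := by linear_combination 2 * this
    exact_mod_cast congrArg (fun x : ℝ => (x : ℂ)) h3
  have h4 : Complex.exp (Complex.I * (k * h / 2)) * (2 * Complex.sin (h * k / 2)) * Complex.I
      = Complex.exp (Complex.I * (k * h)) - 1 := by
    rw [Complex.two_sin]
    have e1 : -(h * k / 2 : ℂ) * Complex.I = -(Complex.I * (k * h / 2)) := by ring
    have e2 : (h * k / 2 : ℂ) * Complex.I = Complex.I * (k * h / 2) := by ring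
    have e3 : Complex.exp (Complex.I * (k * h))
        = Complex.exp (Complex.I * (k * h / 2)) * Complex.exp (Complex.I * (k * h / 2)) := by
      rw [← Complex.exp_add]; ring_nf
    rw [e1, e2, e3, Complex.exp_neg]
    have h5 := Complex.exp_ne_zero (Complex.I * (k * h / 2))
    field_simp
    rw [Complex.I_sq]
    ring
  have e4 : Complex.exp (Complex.I * (k * ((X + h : ℝ) : ℂ)))
      = Complex.exp (Complex.I * (k * X)) * Complex.exp (Complex.I * (k * h)) := by
    rw [← Complex.exp_add]; push_cast; ring_nf
  rw [e4]
  unfold avgMult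
  linear_combination -(Complex.exp (Complex.I * (k * X))) * h4
    - Complex.exp (Complex.I * (k * X)) * Complex.exp (Complex.I * (k * h / 2)) * Complex.I * h2

lemma continuous_avgMult (h : ℝ) : Continuous (avgMult h) := by
  unfold avgMult
  have : Continuous fun k => Real.sinc (h * k / 2) := Real.continuous_sinc.comp (by fun_prop)
  fun_prop

lemma norm_avgMult_le (h k : ℝ) : ‖avgMult h k‖ ≤ 1 := by
  have e : Complex.exp (Complex.I * (k * h / 2)) = Complex.exp (Complex.I * ((k : ℂ) * ((h / 2 : ℝ) : ℂ))) := by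
    push_cast; ring_nf
  rw [avgMult, norm_mul, e, norm_exp_I_mul, one_mul, Complex.norm_real]
  exact abs_sinc_le_one _

lemma multOrder_avgMult (h : ℝ) : MultOrder 0 1 (avgMult h) where
  measurable := (continuous_avgMult h).measurable
  nonneg := zero_le_one
  le k := by simpa using norm_avgMult_le h k

lemma integral_fourierSynth {w : ℝ → ℂ} (hw : Integrable w) (X h : ℝ) :
    ∫ x in X..X + h, fourierSynth w x = h * fourierSynth (fun k => avgMult h k * w k) X := by
  unfold fourierSynth
  have : IsFiniteMeasure (volume.restrict (uIoc X (X + h))) :=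
    ⟨by rw [Measure.restrict_apply_univ, uIoc]; exact measure_Ioc_lt_top⟩
  have hi : Integrable (Function.uncurry fun (x k : ℝ) => w k * Complex.exp (Complex.I * (k * x)))
      ((volume.restrict (uIoc X (X + h))).prod volume) := by
    have h1 : Integrable (fun z : ℝ × ℝ => w z.2) ((volume.restrict (uIoc X (X + h))).prod volume) := by
      have := (integrable_const (1 : ℂ) (μ := volume.restrict (uIoc X (X + h)))).mul_prod hw
      simpa using this
    refine h1.mul_bdd (c := 1) ?_ (ae_of_all _ fun z => ?_)
    · exact (by fun_prop : Continuous fun z : ℝ × ℝ =>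
        Complex.exp (Complex.I * ((z.2 : ℂ) * z.1))).aestronglyMeasurable
    · exact (norm_exp_I_mul _ _).le
  rw [intervalIntegral_integral_swap hi, ← integral_const_mul]
  congr 1
  ext k
  rw [intervalIntegral.integral_const_mul, integral_exp_avg]
  ring

section Averages

variable {L : ℝ} {v : ℝ → ℂ}

/-- The function with spectral density `v`. -/
def baseSynth (v : ℝ → ℂ) : ℝ → ℝ := multSynth (fun _ => 1) v

/-- The moving average over `[X, X + h]` of the function with spectral density `v`. -/
def avgSynth (v : ℝ → ℂ) (h : ℝ) : ℝ → ℝ := multSynth (avgMult h) v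

lemma SpectralBound.integral_baseSynth (hv : SpectralBound L v) (X h : ℝ) :
    ∫ x in X..X + h, baseSynth v x = h * avgSynth v h X := by
  have hw : Integrable fun k => 1 * v k := hv.integrable_mul (MultOrder.one.isMult (by norm_num))
  have h1 := integral_fourierSynth hw X h
  have h2 := (intervalIntegral.intervalIntegral_re (𝕜 := ℂ) (μ := volume)
    ((continuous_fourierSynth hw).intervalIntegrable X (X + h)))
  simp only [RCLike.re_eq_complex_re] at h2
  unfold baseSynth avgSynth multSynth
  rw [h2, h1, Complex.re_ofReal_mul]
  simp only [one_mul]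

lemma SpectralBound.multSynth_comp_sub (m v : ℝ → ℂ) (X h : ℝ) :
    multSynth m v (X - h) = multSynth (fun k => Complex.exp (-(Complex.I * (k * h))) * m k) v X := by
  unfold multSynth fourierSynth
  congr 2
  ext k
  have : Complex.exp (Complex.I * (k * ((X - h : ℝ) : ℂ)))
      = Complex.exp (-(Complex.I * (k * h))) * Complex.exp (Complex.I * (k * X)) := by
    rw [← Complex.exp_add]; push_cast; ring_nf
  rw [this]
  ring

lemma multOrder_exp_mul_avgMult (h : ℝ) :
    MultOrder 0 1 fun k => Complex.exp (-(Complex.I * (k * h))) * avgMult h k where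
  measurable := by
    have := continuous_avgMult h
    exact (by fun_prop : Continuous fun k : ℝ =>
      Complex.exp (-(Complex.I * (k * h))) * avgMult h k).measurable
  nonneg := zero_le_one
  le k := by
    have e : -(Complex.I * (k * h)) = Complex.I * ((k : ℂ) * ((-h : ℝ) : ℂ)) := by push_cast; ring
    rw [e, norm_mul, norm_exp_I_mul]
    simpa using norm_avgMult_le h k

lemma continuous_sinc_mul (h : ℝ) : Continuous fun k => Real.sinc (h * k) :=
  Real.continuous_sinc.comp (by fun_prop)

lemma continuous_sinc_mul_half (h : ℝ) : Continuous fun k => Real.sinc (h * k / 2) :=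
  Real.continuous_sinc.comp (by fun_prop)

/-- The multiplier of the difference quotient of the moving averages. -/
def quotMult (h k : ℝ) : ℂ := Complex.I * k * ((Real.sinc (h * k / 2) ^ 2 : ℝ) : ℂ)

/-- The multiplier of the mean of two adjacent moving averages. -/
def meanMult (h k : ℝ) : ℂ := (Real.sinc (h * k) : ℝ)

lemma multOrder_sinc_sq (h : ℝ) : MultOrder 0 1 fun k => ((Real.sinc (h * k / 2) ^ 2 : ℝ) : ℂ) where
  measurable := Complex.measurable_ofReal.comp ((continuous_sinc_mul_half h).pow 2).measurable
  nonneg := zero_le_one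
  le k := by
    rw [Complex.norm_real, norm_pow]
    simpa using abs_sinc_le_one (h * k / 2)

lemma multOrder_quotMult (h : ℝ) : MultOrder 1 1 (quotMult h) := (multOrder_sinc_sq h).deriv

lemma multOrder_meanMult (h : ℝ) : MultOrder 0 1 (meanMult h) where
  measurable := Complex.measurable_ofReal.comp (continuous_sinc_mul h).measurable
  nonneg := zero_le_one
  le k := by
    rw [meanMult, Complex.norm_real]
    simpa using abs_sinc_le_one (h * k)

lemma avgMult_eq (h k : ℝ) :
    avgMult h k - Complex.exp (-(Complex.I * (k * h))) * avgMult h k = h * quotMult h k ∧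
    avgMult h k + Complex.exp (-(Complex.I * (k * h))) * avgMult h k = 2 * meanMult h k := by
  have e1 : Complex.exp (-(Complex.I * (k * h))) * Complex.exp (Complex.I * (k * h / 2))
      = Complex.exp (-((h * k / 2 : ℝ) * Complex.I)) := by
    rw [← Complex.exp_add]; push_cast; ring_nf
  have e2 : Complex.exp (Complex.I * (k * h / 2)) = Complex.exp ((h * k / 2 : ℝ) * Complex.I) := by
    push_cast; ring_nf
  set y : ℝ := h * k / 2 with hy
  have hs := mul_sinc y
  have hs2 := mul_sinc (2 * y)
  have hc : Complex.exp (y * Complex.I) = Complex.cos y + Complex.sin y * Complex.I :=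
    Complex.exp_mul_I y
  have hc' : Complex.exp (-(y * Complex.I)) = Complex.cos y - Complex.sin y * Complex.I := by
    rw [← neg_mul, Complex.exp_mul_I, Complex.cos_neg, Complex.sin_neg]
    ring
  have hk : (h : ℂ) * k = 2 * (y : ℂ) := by rw [hy]; push_cast; ring
  have hsC : (y : ℂ) * (Real.sinc y : ℝ) = Complex.sin y := by exact_mod_cast congrArg (fun x : ℝ => (x : ℂ)) hs
  have f1 : Complex.exp (-(Complex.I * (k * h))) * avgMult h k
      = Complex.exp (-(y * Complex.I)) * (Real.sinc y : ℝ) := by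
    rw [avgMult, ← mul_assoc, e1]
  have f2 : avgMult h k = Complex.exp (y * Complex.I) * (Real.sinc y : ℝ) := by
    rw [avgMult, e2]
  rw [f1, f2, hc, hc']
  constructor
  · rw [quotMult, ← hy]
    push_cast
    linear_combination -Complex.I * (Real.sinc y : ℂ) ^ 2 * hk - 2 * Complex.I * (Real.sinc y : ℂ) * hsC
  · rw [meanMult, show h * k = 2 * y by rw [hy]; ring]
    have : Real.cos y * Real.sinc y = Real.sinc (2 * y) := by
      rcases eq_or_ne y 0 with h0 | h0
      · simp [h0]
      · rw [Real.sin_two_mul, ← hs] at hs2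
        have : 2 * y ≠ 0 := by simpa using h0
        apply mul_left_cancel₀ this
        rw [hs2]; ring
    rw [← this]
    push_cast
    ring

lemma SpectralBound.avgSynth_sub (hv : SpectralBound L v) (h X : ℝ) :
    avgSynth v h X - avgSynth v h (X - h) = h * multSynth (quotMult h) v X := by
  unfold avgSynth
  rw [SpectralBound.multSynth_comp_sub, hv.multSynth_sub ((multOrder_avgMult h).isMult (by norm_num))
    ((multOrder_exp_mul_avgMult h).isMult (by norm_num)), SpectralBound.const_mul_multSynth]
  simp only [(avgMult_eq h _).1]

lemma SpectralBound.avgSynth_add (hv : SpectralBound L v) (h X : ℝ) :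
    avgSynth v h X + avgSynth v h (X - h) = 2 * multSynth (meanMult h) v X := by
  have h1 : avgSynth v h X + avgSynth v h (X - h) = 2 * avgSynth v h X
      - h * multSynth (quotMult h) v X := by rw [← hv.avgSynth_sub]; ring
  rw [h1, show (2 : ℝ) * avgSynth v h X = ((2 : ℝ)) * multSynth (avgMult h) v X from rfl,
    SpectralBound.const_mul_multSynth, SpectralBound.const_mul_multSynth, hv.multSynth_sub
    (K := 2) (K' := |h|) ?_ ?_, SpectralBound.const_mul_multSynth]
  · congr 1
    ext k
    have := avgMult_eq h k
    push_cast
    linear_combination this.2 + this.1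
  · refine isMult_of_le_pow (n := 0) (by norm_num) ((continuous_avgMult h).measurable.const_mul _)
      zero_le_two fun k => ?_
    rw [norm_mul]
    simpa using norm_avgMult_le h k
  · refine isMult_of_le_pow (n := 1) (by norm_num) ((multOrder_quotMult h).measurable.const_mul _)
      (abs_nonneg h) fun k => ?_
    rw [norm_mul, Complex.norm_real, Real.norm_eq_abs]
    have := (multOrder_quotMult h).le k
    gcongr
    simpa using this

end Averages

/-! ### Dispersion of the linearized lattice, and the quadratic interaction -/

section Dispersion

variable {α : ℝ} {L : ℝ} {v : ℝ → ℂ}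

/-- The derivative of the function with spectral density `v`. -/
def derivSynth (v : ℝ → ℂ) : ℝ → ℝ := multSynth (fun k => Complex.I * k * 1) v

/-- The multiplier `-i k |k|^(α-1) = -i sgn(k) |k|^α`. -/
def dispMult (α k : ℝ) : ℂ := -(Complex.I * k * ((|k| ^ (α - 1) : ℝ) : ℂ))

lemma multOrder_dispMult (hα : α ∈ Ioo (1 : ℝ) 3) : MultOrder 3 1 (dispMult α) := by
  have h := (multOrder_abs_rpow (β := α - 1) (by linarith [hα.1]) (n := 2)
    (by push_cast; linarith [hα.2])).deriv
  refine ⟨h.measurable.neg, h.nonneg, fun k => ?_⟩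
  rw [dispMult, norm_neg]
  exact h.le k

lemma multOrder_one_sub_quot (h : ℝ) :
    MultOrder 1 1 fun k => Complex.I * k * 1 - quotMult h k := by
  have hm : MultOrder 0 1 fun k => ((1 - Real.sinc (h * k / 2) ^ 2 : ℝ) : ℂ) := by
    refine ⟨Complex.measurable_ofReal.comp
      (continuous_const.sub ((continuous_sinc_mul_half h).pow 2)).measurable, zero_le_one, fun k => ?_⟩
    rw [Complex.norm_real]
    simpa using (abs_one_sub_sinc_sq_le (h * k / 2)).trans (min_le_left _ _)
  have e : (fun k : ℝ => Complex.I * k * 1 - quotMult h k)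
      = fun k : ℝ => Complex.I * k * ((1 - Real.sinc (h * k / 2) ^ 2 : ℝ) : ℂ) := by
    ext k
    rw [quotMult]
    push_cast
    ring
  rw [e]
  exact hm.deriv

/-- The symbol of the difference between the linearized lattice and its limit. -/
def dispersionError (α ε k : ℝ) : ℝ :=
  ∑' n : ℕ, ((n : ℝ) + 1) ^ (-α) * (1 - Real.sinc (((n : ℝ) + 1) * ε * k / 2) ^ 2)
    - dispersionConst α * ε ^ (α - 1) * |k| ^ (α - 1)

lemma summable_dispersion_terms (hα : 1 < α) (ε k : ℝ) :
    Summable fun n : ℕ => ((n : ℝ) + 1) ^ (-α) * (1 - Real.sinc (((n : ℝ) + 1) * ε * k / 2) ^ 2) := by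
  refine (summable_rpow_neg hα).of_norm_bounded fun n => ?_
  rw [norm_mul, Real.norm_of_nonneg (by positivity), Real.norm_eq_abs]
  exact mul_le_of_le_one_right (by positivity)
    ((abs_one_sub_sinc_sq_le _).trans (min_le_left _ _))

lemma continuous_dispersionError (hα : 1 < α) (ε : ℝ) : Continuous (dispersionError α ε) := by
  refine (continuous_tsum (fun n => ?_) (summable_rpow_neg hα) fun n k => ?_).sub
    (continuous_const.mul (continuous_abs_rpow (by linarith)))
  · exact continuous_const.mul (continuous_const.sub ((continuous_sinc_mul_half _).pow 2))
  · rw [norm_mul, Real.norm_of_nonneg (by positivity), Real.norm_eq_abs]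
    exact mul_le_of_le_one_right (by positivity)
      ((abs_one_sub_sinc_sq_le _).trans (min_le_left _ _))

lemma exists_multOrder_dispersionError (hα : α ∈ Ioo (1 : ℝ) 3) :
    ∃ C, 0 ≤ C ∧ ∀ ε, 0 < ε →
      MultOrder 3 (C * ε ^ 2) fun k => Complex.I * k * ((dispersionError α ε k : ℝ) : ℂ) := by
  obtain ⟨C, hC, h⟩ := exists_dispersion_sum_error hα
  refine ⟨C, hC, fun ε hε => ?_⟩
  suffices hm : MultOrder 2 (C * ε ^ 2) fun k => ((dispersionError α ε k : ℝ) : ℂ) from hm.deriv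
  refine ⟨Complex.measurable_ofReal.comp (continuous_dispersionError hα.1 ε).measurable,
    by positivity, fun k => ?_⟩
  rw [Complex.norm_real, Real.norm_eq_abs]
  have h0 : dispersionError α ε 0 = 0 := by
    have : α - 1 ≠ 0 := by linarith [hα.1]
    simp [dispersionError, Real.zero_rpow this]
  rcases eq_or_ne k 0 with rfl | hk
  · rw [h0, abs_zero]
    have := jap_pos 0
    positivity
  · have hk' : 0 < |k| := abs_pos.2 hk
    have h1 := h (ε * |k|) (by positivity)
    rw [Real.mul_rpow hε.le hk'.le, ← mul_assoc] at h1
    have e : ∀ n : ℕ, Real.sinc (((n : ℝ) + 1) * (ε * |k|) / 2) ^ 2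
        = Real.sinc (((n : ℝ) + 1) * ε * k / 2) ^ 2 := fun n => by
      rcases abs_choice k with h2 | h2 <;> rw [h2]
      · rw [mul_assoc]
      · rw [← Real.sinc_neg]
        congr 2
        ring
    simp only [e] at h1
    refine h1.trans ?_
    rw [mul_pow, ← mul_assoc]
    have := abs_le_jap k
    gcongr

/-- The dispersion produced by the linear part of the lattice force. -/
lemma exists_linear_dispersion (hα : α ∈ Ioo (1 : ℝ) 3) :
    ∃ C, 0 ≤ C ∧ ∀ {L : ℝ} {v : ℝ → ℂ}, SpectralBound L v → ∀ ε, 0 < ε →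
      ∃ g : ℝ → ℝ, SampleBound (C * L * ε ^ 2) g ∧ ∀ X,
        HasSum (fun n : ℕ => ((n : ℝ) + 1) ^ (-α) *
          (derivSynth v X - multSynth (quotMult (((n : ℝ) + 1) * ε)) v X))
          (g X - dispersionConst α * ε ^ (α - 1) * multSynth (dispMult α) v X) := by
  obtain ⟨C, hC, h⟩ := exists_multOrder_dispersionError hα
  refine ⟨4 * C, by positivity, fun {L v} hv ε hε => ⟨multSynth _ v,
    (hv.sampleBound ((h ε hε).isMult (by norm_num))).mono (le_of_eq (by ring)), fun X => ?_⟩⟩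
  have hD : IsMult |dispersionConst α * ε ^ (α - 1)|
      fun k => ((dispersionConst α * ε ^ (α - 1) : ℝ) : ℂ) * dispMult α k := by
    refine isMult_of_le_pow (n := 3) (by norm_num) ((multOrder_dispMult hα).measurable.const_mul _)
      (abs_nonneg _) fun k => ?_
    rw [norm_mul, Complex.norm_real, Real.norm_eq_abs]
    have := (multOrder_dispMult hα).le k
    gcongr
    simpa using this
  rw [SpectralBound.const_mul_multSynth, hv.multSynth_sub ((h ε hε).isMult (by norm_num)) hD]
  unfold derivSynth
  simp only [hv.multSynth_sub (MultOrder.one.deriv.isMult (by norm_num))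
    ((multOrder_quotMult _).isMult (by norm_num))]
  refine hv.hasSum_multSynth (summable_rpow_neg hα.1) (fun n => by positivity)
    (fun n => (multOrder_one_sub_quot _).isMult (by norm_num)) (fun k => ?_) X
  have h1 := (summable_dispersion_terms hα.1 ε k).hasSum
  have h2 := (Complex.ofRealCLM.hasSum h1).mul_left (Complex.I * k)
  convert! h2 using 1
  · ext n
    simp only [quotMult, Complex.ofRealCLM_apply]
    push_cast
    ring
  · simp only [dispersionError, dispMult, Complex.ofRealCLM_apply]
    push_cast
    ring

lemma multOrder_one_sub_mean (h : ℝ) :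
    MultOrder 2 (2 * min 1 (h ^ 2)) fun k => meanMult h k - 1 where
  measurable := (multOrder_meanMult h).measurable.sub measurable_const
  nonneg := by positivity
  le k := by
    have e : meanMult h k - 1 = ((Real.sinc (h * k) - 1 : ℝ) : ℂ) := by
      rw [meanMult]; push_cast; ring
    rw [e, Complex.norm_real, Real.norm_eq_abs, abs_sub_comm]
    have h1 := abs_one_sub_sinc_le (h * k)
    have h2 : |1 - Real.sinc (h * k)| ≤ 2 := by
      have := abs_sinc_le_one (h * k)
      rw [abs_le] at this ⊢
      constructor <;> linarith
    have h3 := one_le_jap_pow k 2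
    have h4 : k ^ 2 ≤ jap k ^ 2 := by rw [jap_sq]; linarith
    rw [mul_assoc, min_mul_of_nonneg _ _ (by positivity), mul_min_of_nonneg _ _ zero_le_two]
    refine le_min (by linarith) (h1.trans ?_)
    rw [mul_pow]
    have : h ^ 2 * k ^ 2 ≤ h ^ 2 * jap k ^ 2 := by gcongr
    nlinarith [mul_nonneg (sq_nonneg h) (sq_nonneg k)]

lemma multOrder_one_sub_quot' (h : ℝ) :
    MultOrder 3 (min 1 (h ^ 2)) fun k => quotMult h k - Complex.I * k * 1 := by
  have hm : MultOrder 2 (min 1 (h ^ 2)) fun k => ((Real.sinc (h * k / 2) ^ 2 - 1 : ℝ) : ℂ) := by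
    refine ⟨Complex.measurable_ofReal.comp
      (((continuous_sinc_mul_half h).pow 2).sub continuous_const).measurable, by positivity,
      fun k => ?_⟩
    rw [Complex.norm_real, Real.norm_eq_abs, abs_sub_comm]
    have h1 := abs_one_sub_sinc_sq_le (h * k / 2)
    have h3 := one_le_jap_pow k 2
    have h4 : k ^ 2 ≤ jap k ^ 2 := by rw [jap_sq]; linarith
    rw [min_mul_of_nonneg _ _ (by positivity)]
    refine le_min ((h1.trans (min_le_left _ _)).trans (by linarith))
      ((h1.trans (min_le_right _ _)).trans ?_)
    have : h ^ 2 * k ^ 2 ≤ h ^ 2 * jap k ^ 2 := by gcongr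
    nlinarith [mul_nonneg (sq_nonneg h) (sq_nonneg k)]
  have e : (fun k : ℝ => quotMult h k - Complex.I * k * 1)
      = fun k : ℝ => Complex.I * k * ((Real.sinc (h * k / 2) ^ 2 - 1 : ℝ) : ℂ) := by
    ext k
    rw [quotMult]
    push_cast
    ring
  rw [e]
  exact hm.deriv

lemma SpectralBound.sampleBound_quadratic (hv : SpectralBound L v) (h : ℝ) :
    SampleBound (48 * L ^ 2 * min 1 (h ^ 2)) fun X =>
      baseSynth v X * derivSynth v X - multSynth (quotMult h) v X * multSynth (meanMult h) v X := by
  have b1 := hv.sampleBound ((multOrder_one_sub_quot' h).isMult (by norm_num))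
  have b2 := hv.sampleBound ((multOrder_one_sub_mean h).isMult (by norm_num))
  have b3 := hv.sampleBound ((multOrder_meanMult h).isMult (by norm_num))
  have b4 := hv.sampleBound (MultOrder.one.deriv.isMult (by norm_num))
  refine (((b1.mul b3).add (b4.mul b2)).mono (le_of_eq (by ring))).of_abs_le fun X => ?_
  rw [← hv.multSynth_sub ((multOrder_quotMult h).isMult (by norm_num))
    (MultOrder.one.deriv.isMult (by norm_num)), ← hv.multSynth_sub
    ((multOrder_meanMult h).isMult (by norm_num)) (MultOrder.one.isMult (by norm_num)), abs_sub_comm]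
  refine le_of_eq (congrArg _ ?_)
  unfold baseSynth derivSynth
  ring

/-- The quadratic interaction produced by the lattice force. -/
lemma exists_quadratic_interaction (hα : α ∈ Ioo (1 : ℝ) 3) :
    ∃ C, 0 ≤ C ∧ ∀ {L : ℝ} {v : ℝ → ℂ}, SpectralBound L v → ∀ ε, 0 < ε →
      ∃ g : ℝ → ℝ, SampleBound (C * L ^ 2 * ε ^ (α - 1)) g ∧ ∀ X,
        HasSum (fun n : ℕ => ((n : ℝ) + 1) ^ (-α) *
          (baseSynth v X * derivSynth v X - multSynth (quotMult (((n : ℝ) + 1) * ε)) v X *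
            multSynth (meanMult (((n : ℝ) + 1) * ε)) v X)) (g X) := by
  have hI : 0 ≤ ∫ s in Ioi 0, tailWeight α s :=
    setIntegral_nonneg measurableSet_Ioi fun s hs => tailWeight_nonneg (mem_Ioi.1 hs).le
  refine ⟨48 * (4 * 2 ^ α * ∫ s in Ioi 0, tailWeight α s), by positivity,
    fun {L v} hv ε hε => ?_⟩
  obtain ⟨hs, hle⟩ := summable_tsum_tailWeight_le hα hε
  have hb : ∀ n : ℕ, SampleBound (48 * L ^ 2 * (((n : ℝ) + 1) ^ (-α) * min 1 ((((n : ℝ) + 1) * ε) ^ 2)))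
      fun X => ((n : ℝ) + 1) ^ (-α) * (baseSynth v X * derivSynth v X -
        multSynth (quotMult (((n : ℝ) + 1) * ε)) v X * multSynth (meanMult (((n : ℝ) + 1) * ε)) v X) :=
    fun n => ((hv.sampleBound_quadratic _).const_mul _).mono (le_of_eq (by
      rw [abs_of_nonneg (by positivity)]; ring))
  have hsum : ∀ X, Summable fun n : ℕ => ((n : ℝ) + 1) ^ (-α) * (baseSynth v X * derivSynth v X -
      multSynth (quotMult (((n : ℝ) + 1) * ε)) v X * multSynth (meanMult (((n : ℝ) + 1) * ε)) v X) :=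
    fun X => (hs.mul_left (48 * L ^ 2)).of_norm_bounded fun n => (hb n).abs_le X
  refine ⟨_, (SampleBound.hasSum hb (hs.hasSum.mul_left _) fun X => (hsum X).hasSum).mono ?_,
    fun X => (hsum X).hasSum⟩
  calc _ ≤ 48 * L ^ 2 * ((4 * 2 ^ α * ∫ s in Ioi 0, tailWeight α s) * ε ^ (α - 1)) := by gcongr
    _ = _ := by ring

end Dispersion

/-! ### The fractional derivative as a singular integral -/

section Fractional

variable {α : ℝ} {L : ℝ} {v : ℝ → ℂ}

lemma fourierSynth_second_difference {w : ℝ → ℂ} (hw : Integrable w) (X s : ℝ) :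
    fourierSynth w X - (fourierSynth w (X + s) + fourierSynth w (X - s)) / 2
      = ∫ k, ((1 - Real.cos (k * s) : ℝ) : ℂ) * (w k * Complex.exp (Complex.I * (k * X))) := by
  have hi := integrable_fourierSynth_integrand hw
  have hi2 : Integrable fun k : ℝ => (w k * Complex.exp (Complex.I * (k * ((X + s : ℝ) : ℂ))) +
      w k * Complex.exp (Complex.I * (k * ((X - s : ℝ) : ℂ)))) / 2 :=
    ((hi (X + s)).add (hi (X - s))).div_const 2
  unfold fourierSynth
  rw [← integral_add (hi _) (hi _), ← integral_div, ← integral_sub (hi _) hi2]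
  congr 1
  ext k
  have e1 : Complex.exp (Complex.I * (k * ((X + s : ℝ) : ℂ)))
      = Complex.exp (Complex.I * (k * X)) * Complex.exp ((k * s : ℝ) * Complex.I) := by
    rw [← Complex.exp_add]; push_cast; ring_nf
  have e2 : Complex.exp (Complex.I * (k * ((X - s : ℝ) : ℂ)))
      = Complex.exp (Complex.I * (k * X)) * Complex.exp (-(k * s : ℝ) * Complex.I) := by
    rw [← Complex.exp_add]; push_cast; ring_nf
  rw [e1, e2, Complex.exp_mul_I, Complex.exp_mul_I, Complex.cos_neg, Complex.sin_neg,
    Complex.ofReal_sub, Complex.ofReal_cos]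
  push_cast
  ring

lemma integral_rpow_mul_second_difference (hα : α ∈ Ioo (1 : ℝ) 3) (hv : SpectralBound L v) (X : ℝ) :
    ∫ s in Ioi 0, s ^ (-α) * (baseSynth v X - (baseSynth v (X + s) + baseSynth v (X - s)) / 2)
      = fracConst α * multSynth (fun k => ((|k| ^ (α - 1) : ℝ) : ℂ)) v X := by
  have hw : Integrable fun k => 1 * v k := hv.integrable_mul (MultOrder.one.isMult (by norm_num))
  have hw' : Integrable fun k => ((|k| ^ (α - 1) : ℝ) : ℂ) * v k :=
    hv.integrable_mul ((multOrder_abs_rpow (n := 2) (by linarith [hα.1])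
      (by push_cast; linarith [hα.2])).isMult (by norm_num))
  have e1 : ∀ s, baseSynth v X - (baseSynth v (X + s) + baseSynth v (X - s)) / 2
      = (∫ k, ((1 - Real.cos (k * s) : ℝ) : ℂ) *
        (1 * v k * Complex.exp (Complex.I * (k * X)))).re := fun s => by
    rw [← fourierSynth_second_difference hw]
    simp [baseSynth, multSynth]
  set G : ℝ → ℝ → ℂ := fun s k => ((s ^ (-α) * (1 - Real.cos (k * s)) : ℝ) : ℂ) *
    (1 * v k * Complex.exp (Complex.I * (k * X))) with hG
  have e2 : ∀ s, s ^ (-α) * (baseSynth v X - (baseSynth v (X + s) + baseSynth v (X - s)) / 2)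
      = (∫ k, G s k).re := fun s => by
    rw [e1, ← Complex.re_ofReal_mul, ← integral_const_mul]
    congr 2
    ext k
    simp only [hG]
    push_cast
    ring
  have hnn : ∀ s ∈ Ioi (0 : ℝ), ∀ k : ℝ, 0 ≤ s ^ (-α) * (1 - Real.cos (k * s)) := fun s hs k =>
    mul_nonneg (Real.rpow_nonneg (mem_Ioi.1 hs).le _) (by linarith [Real.cos_le_one (k * s)])
  have hcos : ∀ k : ℝ, IntegrableOn (fun s => s ^ (-α) * (1 - Real.cos (k * s))) (Ioi 0) := fun k =>
    integrableOn_rpow_mul_of_abs_le hα (by fun_prop) (B := 2 * max 1 (k ^ 2)) fun s _ => by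
      rw [abs_of_nonneg (by linarith [Real.cos_le_one (k * s)])]
      refine (one_sub_cos_le (k * s)).trans ?_
      rw [mul_assoc]
      refine mul_le_mul_of_nonneg_left ?_ zero_le_two
      rw [mul_pow, mul_min_of_nonneg _ _ (by positivity)]
      refine min_le_min (by simp) ?_
      gcongr
      exact le_max_right _ _
  have hGi : Integrable (Function.uncurry G) ((volume.restrict (Ioi 0)).prod volume) := by
    have hmeas : AEStronglyMeasurable (Function.uncurry G) ((volume.restrict (Ioi 0)).prod volume) := by
      refine AEStronglyMeasurable.mul ?_ (hw.1.comp_snd.mul ?_)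
      · refine (Complex.measurable_ofReal.comp ?_).aestronglyMeasurable
        exact (measurable_fst.pow_const _).mul (measurable_const.sub
          (Real.measurable_cos.comp (measurable_snd.mul measurable_fst)))
      · exact (by fun_prop : Continuous fun z : ℝ × ℝ =>
          Complex.exp (Complex.I * ((z.2 : ℂ) * X))).aestronglyMeasurable
    rw [integrable_prod_iff' hmeas]
    refine ⟨ae_of_all _ fun k => ?_, ?_⟩
    · have h1 : IntegrableOn (fun s => ((s ^ (-α) * (1 - Real.cos (k * s)) : ℝ) : ℂ)) (Ioi 0) :=
        Integrable.ofReal (𝕜 := ℂ) (hcos k)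
      exact Integrable.mul_const h1 (1 * v k * Complex.exp (Complex.I * (k * X)))
    · have e3 : ∀ k, ∫ s in Ioi 0, ‖Function.uncurry G (s, k)‖
          = fracConst α * ‖((|k| ^ (α - 1) : ℝ) : ℂ) * v k‖ := fun k => by
        rw [norm_mul, Complex.norm_real, Real.norm_of_nonneg (Real.rpow_nonneg (abs_nonneg k) _),
          ← mul_assoc, ← integral_rpow_mul_one_sub_cos hα, ← integral_mul_const]
        refine setIntegral_congr_fun measurableSet_Ioi fun s hs => ?_
        simp only [Function.uncurry, hG, norm_mul, Complex.norm_real, norm_exp_I_mul, mul_one,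
          one_mul]
        rw [← norm_mul, Real.norm_of_nonneg (hnn s hs k)]
      simp only [e3]
      exact hw'.norm.const_mul _
  simp only [e2]
  have hre := integral_re (𝕜 := ℂ) hGi.integral_prod_left
  simp only [RCLike.re_eq_complex_re, Function.uncurry] at hre
  rw [hre, integral_integral_swap hGi, multSynth, fourierSynth, ← Complex.re_ofReal_mul,
    ← integral_const_mul]
  congr 2
  ext k
  rw [integral_mul_const, integral_complex_ofReal, integral_rpow_mul_one_sub_cos hα]
  push_cast
  ring

/-- The singular integral of second differences preserves sample bounds. -/
lemma SampleBound.fractional (hα : α ∈ Ioo (1 : ℝ) 3) {K : ℝ} {g g' g'' : ℝ → ℝ}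
    (hg : SampleBound K g) (h1 : ∀ x, HasDerivAt g (g' x) x) (h2 : ∀ x, HasDerivAt g' (g'' x) x)
    (hg'' : SampleBound K g'') :
    (∀ X, IntegrableOn (fun s => s ^ (-α) * (g X - (g (X + s) + g (X - s)) / 2)) (Ioi 0)) ∧
    SampleBound (2 * K * ∫ s in Ioi 0, tailWeight α s) fun X =>
      ∫ s in Ioi 0, s ^ (-α) * (g X - (g (X + s) + g (X - s)) / 2) := by
  have hc : Continuous g := continuous_iff_continuousAt.2 fun x => (h1 x).continuousAt
  have hi : ∀ X, IntegrableOn (fun s => s ^ (-α) * (g X - (g (X + s) + g (X - s)) / 2)) (Ioi 0) :=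
    fun X => integrableOn_rpow_mul_of_abs_le hα (by fun_prop) (B := 2 * K)
      fun s hs => (hg.second_difference h1 h2 hg'' hs).abs_le X
  refine ⟨hi, ?_⟩
  rw [← integral_const_mul]
  refine SampleBound.integral measurableSet_Ioi (fun s hs => ?_)
    ((integrableOn_tailWeight hα).const_mul (2 * K)) hi
  have hs' := mem_Ioi.1 hs
  refine ((hg.second_difference h1 h2 hg'' hs').const_mul (s ^ (-α))).mono (le_of_eq ?_)
  rw [abs_of_nonneg (by positivity), tailWeight]
  ring

end Fractional

/-! ### Differentiation along lines and under the integral sign -/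

/-- A function with a first partial derivative which is Lipschitz in the first variable is
differentiable if it is Lipschitz and differentiable in the second variable: interpolation makes the
first partial derivative continuous. -/
lemma hasFDerivAt_of_lipschitz_partial {g gX : ℝ → ℝ → ℝ} {A : Set ℝ} {L L' X₀ τ₀ gτ : ℝ}
    (hA : A ∈ nhds τ₀) (h1 : ∀ τ ∈ A, ∀ X, HasDerivAt (fun Y => g Y τ) (gX X τ) X)
    (h2 : ∀ τ ∈ A, ∀ X Y, |gX X τ - gX Y τ| ≤ L * |X - Y|)
    (h3 : ∀ X, ∀ σ ∈ A, ∀ τ ∈ A, |g X σ - g X τ| ≤ L' * |σ - τ|)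
    (h4 : HasDerivAt (fun σ => g X₀ σ) gτ τ₀) :
    HasFDerivAt (fun z : ℝ × ℝ => g z.1 z.2)
      (gX X₀ τ₀ • ContinuousLinearMap.fst ℝ ℝ ℝ + gτ • ContinuousLinearMap.snd ℝ ℝ ℝ) (X₀, τ₀) := by
  have hτ₀ : τ₀ ∈ A := mem_of_mem_nhds hA
  have hL : 0 ≤ L := by
    have := (abs_nonneg _).trans (h2 τ₀ hτ₀ 1 0)
    simpa using this
  -- the increment in the first variable
  have hmv : ∀ τ ∈ A, ∀ X a B : ℝ, (∀ Y ∈ uIcc X₀ X, |gX Y τ - a| ≤ B) →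
      |g X τ - g X₀ τ - a * (X - X₀)| ≤ B * |X - X₀| := by
    intro τ hτ X a B hB
    have := (convex_uIcc X₀ X).norm_image_sub_le_of_norm_hasDerivWithin_le
      (f := fun Y => g Y τ - a * Y) (f' := fun Y => gX Y τ - a)
      (fun Y _ => by
        simpa using! ((h1 τ hτ Y).sub ((hasDerivAt_id Y).const_mul a)).hasDerivWithinAt)
      hB left_mem_uIcc right_mem_uIcc
    rw [Real.norm_eq_abs, Real.norm_eq_abs] at this
    convert! this using 2
    ring
  have hseg : ∀ X Y : ℝ, Y ∈ uIcc X₀ X → |Y - X₀| ≤ |X - X₀| := fun X Y hY =>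
    abs_sub_left_of_mem_uIcc hY
  -- continuity of the first partial derivative in the second variable
  have hcont : Filter.Tendsto (fun τ => gX X₀ τ) (nhds τ₀) (nhds (gX X₀ τ₀)) := by
    rw [Metric.tendsto_nhds]
    intro η hη
    set δ : ℝ := η / (4 * (L + 1)) with hδ
    have hδ0 : 0 < δ := by positivity
    have hLδ : L * δ ≤ η / 4 := by
      rw [hδ, mul_div_assoc', div_le_iff₀ (by positivity)]
      nlinarith
    have hdiff : ∀ τ ∈ A, |g (X₀ + δ) τ - g X₀ τ - gX X₀ τ * δ| ≤ η / 4 * δ := by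
      intro τ hτ
      have := hmv τ hτ (X₀ + δ) (gX X₀ τ) (η / 4) fun Y hY => by
        have h5 := hseg _ _ hY
        rw [add_sub_cancel_left, abs_of_pos hδ0] at h5
        exact (h2 τ hτ Y X₀).trans ((mul_le_mul_of_nonneg_left h5 hL).trans hLδ)
      rwa [add_sub_cancel_left, abs_of_pos hδ0] at this
    have hball : ∀ᶠ τ in nhds τ₀, 2 * (L' * |τ - τ₀|) < η / 4 * δ := by
      have : Filter.Tendsto (fun τ => 2 * (L' * |τ - τ₀|)) (nhds τ₀) (nhds (2 * (L' * |τ₀ - τ₀|))) :=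
        (by fun_prop : Continuous fun τ => 2 * (L' * |τ - τ₀|)).continuousAt
      rw [sub_self, abs_zero, mul_zero, mul_zero] at this
      exact this.eventually_lt_const (by positivity)
    filter_upwards [hball, hA] with τ hb hτ
    rw [Real.dist_eq]
    have a1 := hdiff τ hτ
    have a2 := hdiff τ₀ hτ₀
    have a3 := h3 (X₀ + δ) τ hτ τ₀ hτ₀
    have a4 := h3 X₀ τ hτ τ₀ hτ₀
    have : |gX X₀ τ - gX X₀ τ₀| * δ < η * δ := by
      rw [← abs_of_pos hδ0, ← abs_mul, abs_of_pos hδ0]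
      rw [abs_le] at a1 a2 a3 a4
      rw [abs_lt]
      constructor <;> nlinarith
    exact lt_of_mul_lt_mul_right this hδ0.le
  rw [hasFDerivAt_iff_isLittleO]
  have e : (fun z : ℝ × ℝ => g z.1 z.2 - g (X₀, τ₀).1 (X₀, τ₀).2 -
      (gX X₀ τ₀ • ContinuousLinearMap.fst ℝ ℝ ℝ + gτ • ContinuousLinearMap.snd ℝ ℝ ℝ) (z - (X₀, τ₀)))
      = fun z : ℝ × ℝ => (g z.1 z.2 - g X₀ z.2 - gX X₀ τ₀ * (z.1 - X₀))
        + (g X₀ z.2 - g X₀ τ₀ - (z.2 - τ₀) • gτ) := by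
    ext z
    simp
    ring
  rw [e]
  refine Asymptotics.IsLittleO.add ?_ ?_
  · rw [Asymptotics.isLittleO_iff]
    intro c hc
    have q1 : ∀ᶠ τ in nhds τ₀, |gX X₀ τ - gX X₀ τ₀| < c / 2 := by
      simpa [Real.dist_eq] using Metric.tendsto_nhds.1 hcont (c / 2) (by positivity)
    have q2 : ∀ᶠ X in nhds X₀, L * |X - X₀| < c / 2 := by
      have : Filter.Tendsto (fun X => L * |X - X₀|) (nhds X₀) (nhds (L * |X₀ - X₀|)) :=
        (by fun_prop : Continuous fun X => L * |X - X₀|).continuousAt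
      rw [sub_self, abs_zero, mul_zero] at this
      exact this.eventually_lt_const (by positivity)
    rw [nhds_prod_eq]
    filter_upwards [q2.prod_mk (q1.and hA)] with z hz
    obtain ⟨hz1, hz2, hz3⟩ := hz
    have := hmv z.2 hz3 z.1 (gX X₀ τ₀) c fun Y hY => by
      have b1 := h2 z.2 hz3 Y X₀
      have b2 := mul_le_mul_of_nonneg_left (hseg _ _ hY) hL
      have b3 := abs_sub_le (gX Y z.2) (gX X₀ z.2) (gX X₀ τ₀)
      linarith
    refine this.trans (mul_le_mul_of_nonneg_left ?_ hc.le)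
    exact norm_fst_le (z - (X₀, τ₀))
  · have := (hasDerivAt_iff_isLittleO.1 h4).comp_tendsto
      (continuous_snd.tendsto (X₀, τ₀) : Filter.Tendsto Prod.snd (nhds (X₀, τ₀)) (nhds τ₀))
    refine this.trans_isBigO (Asymptotics.IsBigO.of_bound 1 (Filter.Eventually.of_forall fun z => ?_))
    rw [one_mul]
    exact norm_snd_le (z - (X₀, τ₀))

lemma abs_sub_le_of_hasDerivWithinAt {g g' : ℝ → ℝ} {A : Set ℝ} (hA : Convex ℝ A) {B : ℝ}
    (hd : ∀ τ ∈ A, HasDerivWithinAt g (g' τ) A τ) (hB : ∀ τ ∈ A, |g' τ| ≤ B) {σ τ : ℝ}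
    (hσ : σ ∈ A) (hτ : τ ∈ A) : |g σ - g τ| ≤ B * |σ - τ| := by
  simpa using! hA.norm_image_sub_le_of_norm_hasDerivWithin_le hd hB hτ hσ

/-- Differentiation under the integral sign, for a family differentiable on a convex set, with an
integrable bound for the derivatives. -/
lemma integral_lipschitz_and_hasDerivAt {A S : Set ℝ} (hA : Convex ℝ A) (hS : MeasurableSet S)
    {φ ψ : ℝ → ℝ → ℝ} {b : ℝ → ℝ} (hb : IntegrableOn b S)
    (hφ : ∀ τ ∈ A, IntegrableOn (fun s => φ s τ) S) (hψ : ∀ τ ∈ A, IntegrableOn (fun s => ψ s τ) S)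
    (hd : ∀ s ∈ S, ∀ τ ∈ A, HasDerivWithinAt (fun σ => φ s σ) (ψ s τ) A τ)
    (hle : ∀ s ∈ S, ∀ τ ∈ A, |ψ s τ| ≤ b s) :
    (∀ σ ∈ A, ∀ τ ∈ A, |(∫ s in S, φ s σ) - ∫ s in S, φ s τ| ≤ (∫ s in S, b s) * |σ - τ|) ∧
    ∀ τ₀, A ∈ nhds τ₀ →
      HasDerivAt (fun τ => ∫ s in S, φ s τ) (∫ s in S, ψ s τ₀) τ₀ := by
  have hlip : ∀ s ∈ S, ∀ σ ∈ A, ∀ τ ∈ A, |φ s σ - φ s τ| ≤ b s * |σ - τ| := fun s hs σ hσ τ hτ =>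
    abs_sub_le_of_hasDerivWithinAt hA (hd s hs) (hle s hs) hσ hτ
  refine ⟨fun σ hσ τ hτ => ?_, fun τ₀ hτ₀ => ?_⟩
  · rw [← integral_sub (hφ σ hσ) (hφ τ hτ), ← integral_mul_const, ← Real.norm_eq_abs]
    exact norm_integral_le_of_norm_le (hb.mul_const _)
      ((ae_restrict_iff' hS).2 (ae_of_all _ fun s hs => hlip s hs σ hσ τ hτ))
  · refine (hasDerivAt_integral_of_dominated_loc_of_lip (F := fun τ s => φ s τ) (bound := b) hτ₀
      ?_ (hφ τ₀ (mem_of_mem_nhds hτ₀)) (hψ τ₀ (mem_of_mem_nhds hτ₀)).1 ?_ hb ?_).2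
    · filter_upwards [hτ₀] with τ hτ
      exact (hφ τ hτ).1
    · refine (ae_restrict_iff' hS).2 (ae_of_all _ fun s hs => ?_)
      refine LipschitzOnWith.of_dist_le_mul fun σ hσ τ hτ => ?_
      rw [Real.dist_eq, Real.dist_eq, Real.coe_nnabs]
      exact (hlip s hs σ hσ τ hτ).trans (mul_le_mul_of_nonneg_right (le_abs_self _) (abs_nonneg _))
    · refine (ae_restrict_iff' hS).2 (ae_of_all _ fun s hs => ?_)
      exact (hd s hs τ₀ (mem_of_mem_nhds hτ₀)).hasDerivAt hτ₀

/-! ### Solutions of the generalized Benjamin-Ono equation -/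

section Constants

variable {α : ℝ}

lemma cSpeed_sq (hα : 1 < α) : cSpeed α ^ 2 = α * (α + 1) * zetaSum α := by
  have := one_le_zetaSum hα
  exact Real.sq_sqrt (by positivity)

lemma cSpeed_pos (hα : 1 < α) : 0 < cSpeed α := by
  have := one_le_zetaSum hα
  exact Real.sqrt_pos.2 (by positivity)

lemma kappa₁_pos (hα : 1 < α) : 0 < kappa₁ α := mul_pos two_pos (cSpeed_pos hα)

end Constants

/-- The time derivative of a solution of the generalized Benjamin-Ono equation with spectral density
`v`, as prescribed by the equation. -/
def boRate (α : ℝ) (v : ℝ → ℂ) (X : ℝ) : ℝ :=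
  (kappa₁ α)⁻¹ * (-kappa₂ α * (baseSynth v X * derivSynth v X) - kappa₃ α * multSynth (dispMult α) v X)

/-- The flux of the generalized Benjamin-Ono equation, whose derivative is the rate. -/
def boFlux (α : ℝ) (v : ℝ → ℂ) (X : ℝ) : ℝ :=
  (kappa₁ α)⁻¹ * (-(kappa₂ α / 2) * (baseSynth v X * baseSynth v X)
    + kappa₃ α * multSynth (fun k => ((|k| ^ (α - 1) : ℝ) : ℂ)) v X)

/-- The time derivative of the flux along a solution. -/
def boFluxRate (α : ℝ) (v : ℝ → ℂ) (X : ℝ) : ℝ :=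
  (kappa₁ α)⁻¹ * (-kappa₂ α * (baseSynth v X * boRate α v X) + kappa₃ α * (fracConst α)⁻¹ *
    ∫ s in Ioi 0, s ^ (-α) * (boRate α v X - (boRate α v (X + s) + boRate α v (X - s)) / 2))

/-- A bound for the time derivative of the flux. -/
def fluxBound (α C : ℝ) : ℝ :=
  |(kappa₁ α)⁻¹| * (|kappa₂ α| * (C * C) + |kappa₃ α * (fracConst α)⁻¹| *
    (2 * C * ∫ s in Ioi 0, tailWeight α s))

/-- The bounds, uniform in time, which hold along a solution of the Benjamin-Ono equation. -/
structure BOProfile (α C : ℝ) (v : ℝ → ℂ) : Prop where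
  base : SampleBound C (baseSynth v)
  deriv : SampleBound C (derivSynth v)
  flux : SampleBound C (boFlux α v)
  rate : SampleBound C (boRate α v)
  hasDerivAt_base : ∀ X, HasDerivAt (baseSynth v) (derivSynth v X) X
  lipschitz_deriv : ∀ X Y, |derivSynth v X - derivSynth v Y| ≤ C * |X - Y|
  hasDerivAt_flux : ∀ X, HasDerivAt (boFlux α v) (boRate α v X) X
  lipschitz_rate : ∀ X Y, |boRate α v X - boRate α v Y| ≤ C * |X - Y|
  frac_base : ∀ s, 0 < s → ∀ X,
    |baseSynth v X - (baseSynth v (X + s) + baseSynth v (X - s)) / 2| ≤ 2 * C * min 1 (s ^ 2)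
  frac_rate : ∀ s, 0 < s → ∀ X,
    |boRate α v X - (boRate α v (X + s) + boRate α v (X - s)) / 2| ≤ 2 * C * min 1 (s ^ 2)
  fluxRate : SampleBound (fluxBound α C) (boFluxRate α v)

namespace BOProfile

variable {α C : ℝ} {v : ℝ → ℂ} (h : BOProfile α C v)
include h

lemma continuous_base : Continuous (baseSynth v) :=
  continuous_iff_continuousAt.2 fun X => (h.hasDerivAt_base X).continuousAt

lemma continuous_rate : Continuous (boRate α v) :=
  (LipschitzWith.of_dist_le_mul (K := C.toNNReal) fun X Y => by
    rw [Real.coe_toNNReal _ h.base.nonneg]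
    exact h.lipschitz_rate X Y).continuous

lemma abs_base_sub_le (X Y : ℝ) : |baseSynth v X - baseSynth v Y| ≤ C * |X - Y| :=
  abs_sub_le_of_hasDerivWithinAt convex_univ (fun x _ => (h.hasDerivAt_base x).hasDerivWithinAt)
    (fun x _ => h.deriv.abs_le x) (mem_univ X) (mem_univ Y)

lemma abs_flux_sub_le (X Y : ℝ) : |boFlux α v X - boFlux α v Y| ≤ C * |X - Y| :=
  abs_sub_le_of_hasDerivWithinAt convex_univ (fun x _ => (h.hasDerivAt_flux x).hasDerivWithinAt)
    (fun x _ => h.rate.abs_le x) (mem_univ X) (mem_univ Y)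

end BOProfile

lemma exists_boProfile {α : ℝ} (hα : α ∈ Ioo (1 : ℝ) 3) (L : ℝ) :
    ∃ C, ∀ v, SpectralBound L v → BOProfile α C v := by
  obtain ⟨P, hP⟩ : ∃ P, P = 4 * 1 * L := ⟨_, rfl⟩
  refine ⟨P + |(kappa₁ α)⁻¹| * (|kappa₂ α| * (4 * (P * P)) + |kappa₃ α| * P), fun v hv => ?_⟩
  obtain ⟨C, hC⟩ : ∃ C, C = P + |(kappa₁ α)⁻¹| * (|kappa₂ α| * (4 * (P * P)) + |kappa₃ α| * P) :=
    ⟨_, rfl⟩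
  rw [← hC]
  have hP0 : 0 ≤ P := by have := hv.nonneg; rw [hP]; positivity
  have hPC : P ≤ C := by
    rw [hC]
    have : 0 ≤ |(kappa₁ α)⁻¹| * (|kappa₂ α| * (4 * (P * P)) + |kappa₃ α| * P) := by positivity
    linarith
  have hrest : ∀ y, y ≤ 4 * (P * P) → |(kappa₁ α)⁻¹| * (|kappa₂ α| * y + |kappa₃ α| * P) ≤ C := by
    intro y hy
    have : |(kappa₁ α)⁻¹| * (|kappa₂ α| * y + |kappa₃ α| * P)
        ≤ |(kappa₁ α)⁻¹| * (|kappa₂ α| * (4 * (P * P)) + |kappa₃ α| * P) := by gcongr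
    rw [hC]
    linarith
  have sb : ∀ {n : ℕ} {m : ℝ → ℂ}, MultOrder n 1 m → n ≤ 5 → SampleBound P (multSynth m v) :=
    fun hm hn => hP ▸ hv.sampleBound (hm.isMult hn)
  have hd : ∀ {n : ℕ} {m : ℝ → ℂ}, MultOrder n 1 m → n + 1 ≤ 5 → ∀ X, HasDerivAt (multSynth m v)
      (multSynth (fun k => Complex.I * k * m k) v X) X :=
    fun hm hn => hv.hasDerivAt_multSynth (hm.isMult (by omega)) (hm.deriv.isMult hn)
  have o0 := MultOrder.one
  have o1 := o0.deriv
  have o2 := o1.deriv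
  have o3 := o2.deriv
  have q0 := multOrder_dispMult hα
  have q1 := q0.deriv
  have q2 := q1.deriv
  have a0 := multOrder_abs_rpow (β := α - 1) (by linarith [hα.1]) (n := 2)
    (by push_cast; linarith [hα.2])
  have u0 : SampleBound P (baseSynth v) := sb o0 (by norm_num)
  have u1 : SampleBound P (derivSynth v) := sb o1 (by norm_num)
  have u2 := sb o2 (by norm_num)
  have u3 := sb o3 (by norm_num)
  have h0 := sb q0 (by norm_num)
  have h1 := sb q1 (by norm_num)
  have h2 := sb q2 (by norm_num)
  have f0 := sb a0 (by norm_num)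
  have du0 : ∀ X, HasDerivAt (baseSynth v) (derivSynth v X) X := hd o0 (by norm_num)
  have du1 : ∀ X, HasDerivAt (derivSynth v) _ X := hd o1 (by norm_num)
  have du2 := hd o2 (by norm_num)
  have dh0 := hd q0 (by norm_num)
  have dh1 := hd q1 (by norm_num)
  have df0 := hd a0 (by norm_num)
  set U2 := multSynth (fun k => Complex.I * k * (Complex.I * k * 1)) v with hU2
  set U3 := multSynth (fun k => Complex.I * k * (Complex.I * k * (Complex.I * k * 1))) v with hU3
  set H0 := multSynth (dispMult α) v with hH0
  set H1 := multSynth (fun k => Complex.I * k * dispMult α k) v with hH1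
  set H2 := multSynth (fun k => Complex.I * k * (Complex.I * k * dispMult α k)) v with hH2
  set W0 := multSynth (fun k => ((|k| ^ (α - 1) : ℝ) : ℂ)) v with hW0
  have hW1 : ∀ X, multSynth (fun k => Complex.I * k * ((|k| ^ (α - 1) : ℝ) : ℂ)) v X = -H0 X := by
    intro X
    have := SpectralBound.const_mul_multSynth (-1) (dispMult α) v X
    rw [neg_one_mul] at this
    rw [hH0, this]
    congr 1
    ext k
    rw [dispMult]
    push_cast
    ring
  have rate : SampleBound C (boRate α v) := by
    refine ((((u0.mul u1).const_mul (-kappa₂ α)).sub (h0.const_mul (kappa₃ α))).const_mul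
      (kappa₁ α)⁻¹).mono ?_
    rw [abs_neg]
    exact hrest _ (by nlinarith)
  have drate : ∀ X, HasDerivAt (boRate α v) ((kappa₁ α)⁻¹ *
      (-kappa₂ α * (derivSynth v X * derivSynth v X + baseSynth v X * U2 X) - kappa₃ α * H1 X)) X :=
    fun X => ((((du0 X).mul (du1 X)).const_mul _).sub ((dh0 X).const_mul _)).const_mul _
  have ddrate : ∀ X, HasDerivAt (fun X => (kappa₁ α)⁻¹ *
      (-kappa₂ α * (derivSynth v X * derivSynth v X + baseSynth v X * U2 X) - kappa₃ α * H1 X))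
      ((kappa₁ α)⁻¹ * (-kappa₂ α * ((U2 X * derivSynth v X + derivSynth v X * U2 X) +
        (derivSynth v X * U2 X + baseSynth v X * U3 X)) - kappa₃ α * H2 X)) X :=
    fun X => (((((du1 X).mul (du1 X)).add ((du0 X).mul (du2 X))).const_mul _).sub
      ((dh1 X).const_mul _)).const_mul _
  have rate1 : SampleBound C (fun X => (kappa₁ α)⁻¹ *
      (-kappa₂ α * (derivSynth v X * derivSynth v X + baseSynth v X * U2 X) - kappa₃ α * H1 X)) := by
    refine (((((u1.mul u1).add (u0.mul u2)).const_mul (-kappa₂ α)).sub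
      (h1.const_mul (kappa₃ α))).const_mul (kappa₁ α)⁻¹).mono ?_
    rw [abs_neg]
    exact hrest _ (by nlinarith)
  have rate2 : SampleBound C (fun X => (kappa₁ α)⁻¹ * (-kappa₂ α *
      ((U2 X * derivSynth v X + derivSynth v X * U2 X) +
        (derivSynth v X * U2 X + baseSynth v X * U3 X)) - kappa₃ α * H2 X)) := by
    refine ((((((u2.mul u1).add (u1.mul u2)).add ((u1.mul u2).add (u0.mul u3))).const_mul
      (-kappa₂ α)).sub (h2.const_mul (kappa₃ α))).const_mul (kappa₁ α)⁻¹).mono ?_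
    rw [abs_neg]
    exact hrest _ (by nlinarith)
  have lip : ∀ {g g' : ℝ → ℝ}, (∀ X, HasDerivAt g (g' X) X) → SampleBound C g' → ∀ X Y,
      |g X - g Y| ≤ C * |X - Y| := fun hg hg' X Y =>
    abs_sub_le_of_hasDerivWithinAt convex_univ (fun x _ => (hg x).hasDerivWithinAt)
      (fun x _ => hg'.abs_le x) (mem_univ X) (mem_univ Y)
  refine ⟨u0.mono hPC, u1.mono hPC, ?_, rate, du0, lip du1 (u2.mono hPC), fun X => ?_, lip drate rate1,
    fun s hs => ((u0.mono hPC).second_difference du0 du1 (u2.mono hPC) hs).abs_le,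
    fun s hs => (rate.second_difference drate ddrate rate2 hs).abs_le, ?_⟩
  · refine ((((u0.mul u0).const_mul (-(kappa₂ α / 2))).add (f0.const_mul (kappa₃ α))).const_mul
      (kappa₁ α)⁻¹).mono ?_
    rw [abs_neg, abs_div, abs_two, div_mul_eq_mul_div, mul_div_assoc]
    exact hrest _ (by nlinarith)
  · have := ((((du0 X).mul (du0 X)).const_mul (-(kappa₂ α / 2))).add
      ((df0 X).const_mul (kappa₃ α))).const_mul (kappa₁ α)⁻¹
    refine this.congr_deriv ?_
    rw [hW1, boRate]
    ring
  · rw [fluxBound, ← abs_neg (kappa₂ α)]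
    exact ((((u0.mono hPC).mul rate).const_mul (-kappa₂ α)).add
      ((rate.fractional hα drate ddrate rate2).2.const_mul (kappa₃ α * (fracConst α)⁻¹))).const_mul _

/-- The curve `v` of spectral densities belongs to a solution of the generalized Benjamin-Ono equation
for `|τ| ≤ τ₀` which is bounded by `L` in `H^6`. -/
structure BOCurve (α τ₀ L : ℝ) (v : ℝ → ℝ → ℂ) : Prop where
  spectral : ∀ τ ∈ Icc (-τ₀) τ₀, SpectralBound L (v τ)
  hasDeriv : ∀ τ ∈ Icc (-τ₀) τ₀, ∀ X,
    HasDerivWithinAt (fun σ => baseSynth (v σ) X) (boRate α (v τ) X) (Icc (-τ₀) τ₀) τ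

lemma hilbertDHat_eq (α : ℝ) (f : ℝ → ℝ) :
    hilbertDHat α f = fun k => dispMult α k * fourierHat f k := by
  ext k
  have h : (SignType.sign k : ℝ) * |k| ^ α = k * |k| ^ (α - 1) := by
    rcases eq_or_ne k 0 with rfl | hk
    · simp
    · rw [Real.rpow_sub_one (abs_pos.2 hk).ne', ← sign_mul_abs k, abs_mul]
      have h1 : |((SignType.sign k : ℝ))| = 1 := by
        rcases lt_or_gt_of_ne hk with h | h <;> simp [h]
      have h2 := (abs_pos.2 hk).ne'
      rw [h1, one_mul, abs_abs]
      have h3 : SignType.sign ((SignType.sign k : ℝ) * |k|) = SignType.sign k := by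
        rw [sign_mul_abs]
      rw [h3]
      field_simp
  rw [hilbertDHat, dispMult]
  have h' : ((SignType.sign k : ℝ) : ℂ) * ((|k| ^ α : ℝ) : ℂ) = k * ((|k| ^ (α - 1) : ℝ) : ℂ) := by
    rw [← Complex.ofReal_mul, h, Complex.ofReal_mul]
  linear_combination -Complex.I * fourierHat f k * h'

lemma IsBOSolution.exists_boCurve {α τ₀ M : ℝ} (hα : α ∈ Ioo (1 : ℝ) 3) {u : ℝ → ℝ → ℝ}
    (hu : IsBOSolution α τ₀ u) (hM : ∀ τ ∈ Icc (-τ₀) τ₀,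
      MemHs 6 (fun X => u X τ) ∧ hsNorm 6 (fun X => u X τ) ≤ M) :
    ∃ v, BOCurve α τ₀ M v ∧ ∀ τ ∈ Icc (-τ₀) τ₀, ∀ X, u X τ = baseSynth (v τ) X := by
  have hs : ∀ τ ∈ Icc (-τ₀) τ₀, SpectralBound M (fourierHat fun X => u X τ) := fun τ hτ =>
    memHs_spectralBound (hM τ hτ).1 (hM τ hτ).2
  have heq : ∀ τ ∈ Icc (-τ₀) τ₀, ∀ X, u X τ = baseSynth (fourierHat fun X => u X τ) X := by
    intro τ hτ X
    have hc : Continuous fun X => u X τ := continuous_iff_continuousAt.2 fun X => by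
      obtain ⟨uX, _, h, _⟩ := (hu τ hτ).2 X
      exact h.continuousAt
    have hi : Integrable (fourierHat fun X => u X τ) := by
      simpa using (hs τ hτ).integrable_mul (MultOrder.one.isMult (by norm_num))
    have := eq_fourierSynth_fourierHat hc (hM τ hτ).1.1 hi X
    simp only [baseSynth, multSynth, one_mul, ← this, Complex.ofReal_re]
  refine ⟨fun τ => fourierHat fun X => u X τ, ⟨hs, fun τ hτ X => ?_⟩, heq⟩
  obtain ⟨uX, uτ, h1, h2, h3⟩ := (hu τ hτ).2 X
  have hX : uX = derivSynth (fourierHat fun X => u X τ) X := by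
    have h4 := (hs τ hτ).hasDerivAt_multSynth (MultOrder.one.isMult (by norm_num))
      (MultOrder.one.deriv.isMult (by norm_num)) X
    have h5 : (fun Y => u Y τ) = baseSynth (fourierHat fun X => u X τ) := funext (heq τ hτ)
    rw [h5] at h1
    exact h1.unique h4
  have hH : (hilbertD α (fun Y => u Y τ) X).re = multSynth (dispMult α) (fourierHat fun X => u X τ) X := by
    rw [hilbertD, hilbertDHat_eq]
    rfl
  have h4 := congrArg Complex.re h3
  simp only [Complex.add_re, Complex.ofReal_re, Complex.re_ofReal_mul, Complex.zero_re, hH] at h4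
  have hκ := (kappa₁_pos hα.1).ne'
  have hrate : uτ = boRate α (fourierHat fun X => u X τ) X := by
    rw [boRate, eq_inv_mul_iff_mul_eq₀ hκ, ← hX, ← heq τ hτ]
    linarith
  rw [← hrate]
  exact h2.congr (fun σ hσ => (heq σ hσ X).symm) (heq τ hτ X).symm

namespace BOCurve

variable {α τ₀ L C : ℝ} {v : ℝ → ℝ → ℂ} (h : BOCurve α τ₀ L v)
  (hC : ∀ v, SpectralBound L v → BOProfile α C v)
include h hC

lemma profile {τ : ℝ} (hτ : τ ∈ Icc (-τ₀) τ₀) : BOProfile α C (v τ) := hC _ (h.spectral τ hτ)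

lemma lipschitz_base {σ τ : ℝ} (hσ : σ ∈ Icc (-τ₀) τ₀) (hτ : τ ∈ Icc (-τ₀) τ₀) (X : ℝ) :
    |baseSynth (v σ) X - baseSynth (v τ) X| ≤ C * |σ - τ| :=
  abs_sub_le_of_hasDerivWithinAt (convex_Icc _ _) (fun τ hτ => h.hasDeriv τ hτ X)
    (fun _ hτ => (h.profile hC hτ).rate.abs_le X) hσ hτ

lemma hasFDerivAt_base {τ : ℝ} (hτ : τ ∈ Ioo (-τ₀) τ₀) (X : ℝ) :
    HasFDerivAt (fun z : ℝ × ℝ => baseSynth (v z.2) z.1)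
      (derivSynth (v τ) X • ContinuousLinearMap.fst ℝ ℝ ℝ +
        boRate α (v τ) X • ContinuousLinearMap.snd ℝ ℝ ℝ) (X, τ) := by
  have hI := Icc_mem_nhds hτ.1 hτ.2
  exact hasFDerivAt_of_lipschitz_partial (g := fun X τ => baseSynth (v τ) X)
    (gX := fun X τ => derivSynth (v τ) X) hI
    (fun τ hτ => (h.profile hC hτ).hasDerivAt_base) (fun τ hτ => (h.profile hC hτ).lipschitz_deriv)
    (fun X σ hσ τ hτ => h.lipschitz_base hC hσ hτ X)
    ((h.hasDeriv τ (Ioo_subset_Icc_self hτ) X).hasDerivAt hI)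

lemma hasDerivAt_avg (s : ℝ) {τ : ℝ} (hτ : τ ∈ Icc (-τ₀) τ₀) (X : ℝ) :
    HasDerivAt (fun X => s * avgSynth (v τ) s X) (baseSynth (v τ) (X + s) - baseSynth (v τ) X) X := by
  have hc := (h.profile hC hτ).continuous_base
  have e : ∀ Y, s * avgSynth (v τ) s Y = (∫ x in (0 : ℝ)..Y + s, baseSynth (v τ) x)
      - ∫ x in (0 : ℝ)..Y, baseSynth (v τ) x := fun Y => by
    rw [← (h.spectral τ hτ).integral_baseSynth, intervalIntegral.integral_interval_sub_left
      (hc.intervalIntegrable _ _) (hc.intervalIntegrable _ _)]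
  simp only [e]
  have d : ∀ Y, HasDerivAt (fun Y => ∫ x in (0 : ℝ)..Y, baseSynth (v τ) x) (baseSynth (v τ) Y) Y :=
    fun Y => intervalIntegral.integral_hasDerivAt_right (hc.intervalIntegrable _ _)
      (hc.stronglyMeasurableAtFilter _ _) hc.continuousAt
  exact ((d (X + s)).comp_add_const X s).sub (d X)

lemma abs_avg_sub_le (s : ℝ) {τ : ℝ} (hτ : τ ∈ Icc (-τ₀) τ₀) (X Y : ℝ) :
    |s * avgSynth (v τ) s X - s * avgSynth (v τ) s Y| ≤ (C + C) * |X - Y| :=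
  abs_sub_le_of_hasDerivWithinAt convex_univ
    (fun x _ => (h.hasDerivAt_avg hC s hτ x).hasDerivWithinAt)
    (fun _ _ => (abs_sub _ _).trans (add_le_add ((h.profile hC hτ).base.abs_le _)
      ((h.profile hC hτ).base.abs_le _))) (mem_univ X) (mem_univ Y)

lemma avg_lipschitz_and_hasDerivAt {s : ℝ} (hs : 0 ≤ s) (X : ℝ) :
    (∀ σ ∈ Icc (-τ₀) τ₀, ∀ τ ∈ Icc (-τ₀) τ₀,
      |s * avgSynth (v σ) s X - s * avgSynth (v τ) s X| ≤ C * s * |σ - τ|) ∧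
    ∀ τ ∈ Ioo (-τ₀) τ₀, HasDerivAt (fun σ => s * avgSynth (v σ) s X)
      (boFlux α (v τ) (X + s) - boFlux α (v τ) X) τ := by
  have hint : ∀ τ ∈ Icc (-τ₀) τ₀, s * avgSynth (v τ) s X = ∫ x in Ioc X (X + s), baseSynth (v τ) x :=
    fun τ hτ => by
      rw [← (h.spectral τ hτ).integral_baseSynth, intervalIntegral.integral_of_le (by linarith)]
  have hrint : ∀ τ ∈ Icc (-τ₀) τ₀, ∫ x in Ioc X (X + s), boRate α (v τ) x
      = boFlux α (v τ) (X + s) - boFlux α (v τ) X := fun τ hτ => by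
    rw [← intervalIntegral.integral_of_le (by linarith)]
    exact intervalIntegral.integral_eq_sub_of_hasDerivAt
      (fun _ _ => (h.profile hC hτ).hasDerivAt_flux _)
      ((h.profile hC hτ).continuous_rate.intervalIntegrable _ _)
  have key := integral_lipschitz_and_hasDerivAt (convex_Icc (-τ₀) τ₀)
    (measurableSet_Ioc (a := X) (b := X + s))
    (φ := fun x τ => baseSynth (v τ) x) (ψ := fun x τ => boRate α (v τ) x) (b := fun _ => C)
    (integrableOn_const (by simp)) (fun τ hτ => (h.profile hC hτ).continuous_base.integrableOn_Ioc)
    (fun τ hτ => (h.profile hC hτ).continuous_rate.integrableOn_Ioc)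
    (fun x _ τ hτ => h.hasDeriv τ hτ x) (fun x _ τ hτ => (h.profile hC hτ).rate.abs_le x)
  refine ⟨fun σ hσ τ hτ => ?_, fun τ hτ => ?_⟩
  · rw [hint σ hσ, hint τ hτ]
    refine (key.1 σ hσ τ hτ).trans (le_of_eq ?_)
    rw [setIntegral_const, measureReal_def, Real.volume_Ioc, add_sub_cancel_left,
      ENNReal.toReal_ofReal hs, smul_eq_mul, mul_comm s C]
  · have hI := Icc_mem_nhds hτ.1 hτ.2
    rw [← hrint τ (Ioo_subset_Icc_self hτ)]
    refine (key.2 τ hI).congr_of_eventuallyEq ?_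
    filter_upwards [hI] with σ hσ using hint σ hσ

/-- The primitive of the solution over an interval. -/
lemma hasFDerivAt_avg {s τ : ℝ} (hs : 0 ≤ s) (hτ : τ ∈ Ioo (-τ₀) τ₀) (X : ℝ) :
    HasFDerivAt (fun z : ℝ × ℝ => s * avgSynth (v z.2) s z.1)
      ((baseSynth (v τ) (X + s) - baseSynth (v τ) X) • ContinuousLinearMap.fst ℝ ℝ ℝ +
        (boFlux α (v τ) (X + s) - boFlux α (v τ) X) • ContinuousLinearMap.snd ℝ ℝ ℝ) (X, τ) := by
  refine hasFDerivAt_of_lipschitz_partial (g := fun X τ => s * avgSynth (v τ) s X)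
    (gX := fun X τ => baseSynth (v τ) (X + s) - baseSynth (v τ) X) (L := C + C) (L' := C * s)
    (Icc_mem_nhds hτ.1 hτ.2) (fun τ hτ X => h.hasDerivAt_avg hC s hτ X) (fun τ hτ X Y => ?_)
    (fun X => (h.avg_lipschitz_and_hasDerivAt hC hs X).1)
    ((h.avg_lipschitz_and_hasDerivAt hC hs X).2 τ hτ)
  have e1 := (h.profile hC hτ).abs_base_sub_le (X + s) (Y + s)
  have e2 := (h.profile hC hτ).abs_base_sub_le X Y
  rw [add_sub_add_right_eq_sub] at e1
  rw [sub_sub_sub_comm]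
  refine (abs_sub _ _).trans ?_
  linarith

lemma flux_lipschitz_and_hasDerivAt (hα : α ∈ Ioo (1 : ℝ) 3) (X : ℝ) :
    (∀ σ ∈ Icc (-τ₀) τ₀, ∀ τ ∈ Icc (-τ₀) τ₀,
      |boFlux α (v σ) X - boFlux α (v τ) X| ≤ fluxBound α C * |σ - τ|) ∧
    ∀ τ ∈ Ioo (-τ₀) τ₀, HasDerivAt (fun σ => boFlux α (v σ) X) (boFluxRate α (v τ) X) τ := by
  have hfc := (fracConst_pos hα).ne'
  obtain ⟨hlip, hder⟩ := integral_lipschitz_and_hasDerivAt (convex_Icc (-τ₀) τ₀)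
    (measurableSet_Ioi (a := (0 : ℝ)))
    (φ := fun s τ => s ^ (-α) * (baseSynth (v τ) X -
      (baseSynth (v τ) (X + s) + baseSynth (v τ) (X - s)) / 2))
    (ψ := fun s τ => s ^ (-α) * (boRate α (v τ) X -
      (boRate α (v τ) (X + s) + boRate α (v τ) (X - s)) / 2))
    (b := fun s => 2 * C * tailWeight α s) ((integrableOn_tailWeight hα).const_mul _)
    (fun τ hτ => by
      have := (h.profile hC hτ).continuous_base
      exact integrableOn_rpow_mul_of_abs_le hα (by fun_prop) fun s hs =>
        (h.profile hC hτ).frac_base s hs X)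
    (fun τ hτ => by
      have := (h.profile hC hτ).continuous_rate
      exact integrableOn_rpow_mul_of_abs_le hα (by fun_prop) fun s hs =>
        (h.profile hC hτ).frac_rate s hs X)
    (fun s _ τ hτ => (((h.hasDeriv τ hτ X).sub
      (((h.hasDeriv τ hτ (X + s)).add (h.hasDeriv τ hτ (X - s))).div_const 2)).const_mul _))
    (fun s hs τ hτ => by
      have hs' := mem_Ioi.1 hs
      have h1 := (h.profile hC hτ).frac_rate s hs' X
      have h2 : 0 ≤ s ^ (-α) := Real.rpow_nonneg hs'.le _
      rw [abs_mul, abs_of_nonneg h2, tailWeight]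
      calc _ ≤ s ^ (-α) * (2 * C * min 1 (s ^ 2)) := by gcongr
        _ = _ := by ring)
  have e : ∀ τ ∈ Icc (-τ₀) τ₀, boFlux α (v τ) X = (kappa₁ α)⁻¹ *
      (-(kappa₂ α / 2) * (baseSynth (v τ) X * baseSynth (v τ) X) + kappa₃ α * (fracConst α)⁻¹ *
        ∫ s in Ioi 0, s ^ (-α) * (baseSynth (v τ) X -
          (baseSynth (v τ) (X + s) + baseSynth (v τ) (X - s)) / 2)) := fun τ hτ => by
    rw [integral_rpow_mul_second_difference hα (h.spectral τ hτ), boFlux]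
    field_simp
  refine ⟨fun σ hσ τ hτ => ?_, fun τ hτ => ?_⟩
  · rw [e σ hσ, e τ hτ]
    set I1 := ∫ s in Ioi 0, s ^ (-α) * (baseSynth (v σ) X -
          (baseSynth (v σ) (X + s) + baseSynth (v σ) (X - s)) / 2)
    set I2 := ∫ s in Ioi 0, s ^ (-α) * (baseSynth (v τ) X -
          (baseSynth (v τ) (X + s) + baseSynth (v τ) (X - s)) / 2)
    have hI : |I1 - I2| ≤ (2 * C * ∫ s in Ioi 0, tailWeight α s) * |σ - τ| := by
      rw [← integral_const_mul]
      exact hlip σ hσ τ hτ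
    have b1 := h.lipschitz_base hC hσ hτ X
    have b2 := (h.profile hC hσ).base.abs_le X
    have b3 := (h.profile hC hτ).base.abs_le X
    have hC0 := (h.profile hC hτ).base.nonneg
    have b4 : |(baseSynth (v σ) X + baseSynth (v τ) X) / 2| ≤ C := by
      rw [abs_le] at b2 b3 ⊢
      constructor <;> linarith
    have e1 : fluxBound α C * |σ - τ| = |(kappa₁ α)⁻¹| * ((|kappa₂ α| * (C * C) +
        |kappa₃ α * (fracConst α)⁻¹| * (2 * C * ∫ s in Ioi 0, tailWeight α s)) * |σ - τ|) := by
      rw [fluxBound, mul_assoc]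
    rw [← mul_sub, abs_mul, e1]
    refine mul_le_mul_of_nonneg_left ?_ (abs_nonneg _)
    have e2 : -(kappa₂ α / 2) * (baseSynth (v σ) X * baseSynth (v σ) X)
        + kappa₃ α * (fracConst α)⁻¹ * I1 - (-(kappa₂ α / 2) * (baseSynth (v τ) X * baseSynth (v τ) X)
        + kappa₃ α * (fracConst α)⁻¹ * I2)
        = -kappa₂ α * ((baseSynth (v σ) X + baseSynth (v τ) X) / 2 *
          (baseSynth (v σ) X - baseSynth (v τ) X)) + kappa₃ α * (fracConst α)⁻¹ * (I1 - I2) := by ring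
    rw [e2]
    refine (abs_add_le _ _).trans ?_
    rw [abs_mul (-kappa₂ α), abs_neg, abs_mul (kappa₃ α * (fracConst α)⁻¹) (I1 - I2),
      abs_mul ((baseSynth (v σ) X + baseSynth (v τ) X) / 2)]
    calc _ ≤ |kappa₂ α| * (C * (C * |σ - τ|)) + |kappa₃ α * (fracConst α)⁻¹| *
          ((2 * C * ∫ s in Ioi 0, tailWeight α s) * |σ - τ|) := by gcongr
      _ = _ := by ring
  · have hI := Icc_mem_nhds hτ.1 hτ.2
    have d0 := (h.hasDeriv τ (Ioo_subset_Icc_self hτ) X).hasDerivAt hI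
    have d1 := (((d0.mul d0).const_mul (-(kappa₂ α / 2))).add
      ((hder τ hI).const_mul (kappa₃ α * (fracConst α)⁻¹))).const_mul (kappa₁ α)⁻¹
    refine (d1.congr_of_eventuallyEq ?_).congr_deriv ?_
    · filter_upwards [hI] with σ hσ using e σ hσ
    · rw [boFluxRate]
      ring

lemma hasFDerivAt_flux (hα : α ∈ Ioo (1 : ℝ) 3) {τ : ℝ} (hτ : τ ∈ Ioo (-τ₀) τ₀) (X : ℝ) :
    HasFDerivAt (fun z : ℝ × ℝ => boFlux α (v z.2) z.1)
      (boRate α (v τ) X • ContinuousLinearMap.fst ℝ ℝ ℝ +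
        boFluxRate α (v τ) X • ContinuousLinearMap.snd ℝ ℝ ℝ) (X, τ) := by
  exact hasFDerivAt_of_lipschitz_partial (g := fun X τ => boFlux α (v τ) X)
    (gX := fun X τ => boRate α (v τ) X) (Icc_mem_nhds hτ.1 hτ.2)
    (fun τ hτ => (h.profile hC hτ).hasDerivAt_flux) (fun τ hτ => (h.profile hC hτ).lipschitz_rate)
    (fun X => (h.flux_lipschitz_and_hasDerivAt hC hα X).1)
    ((h.flux_lipschitz_and_hasDerivAt hC hα X).2 τ hτ)

end BOCurve

/-! ### Sampled functions as square-summable sequences -/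

open Classical in
/-- The sequence of the samples `g (ε j + θ)` (and `0` if it is not square-summable). -/
def sampleTwo (ε θ : ℝ) (g : ℝ → ℝ) : EllTwo :=
  if h : Memℓp (fun j : ℤ => g (ε * j + θ)) 2 then ⟨fun j => g (ε * j + θ), h⟩ else 0

namespace SampleBound

variable {K ε : ℝ} {g : ℝ → ℝ}

lemma sampleTwo_apply (hg : SampleBound K g) (hε : ε ∈ Ioc (0 : ℝ) 1) (θ : ℝ) (j : ℤ) :
    sampleTwo ε θ g j = g (ε * j + θ) := by
  have h : Memℓp (fun j : ℤ => g (ε * j + θ)) 2 := memℓp_two_of_summable_sq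
    (summable_of_sum_le (fun j => sq_nonneg _) fun F => hg.sum_sq_le hε θ F)
  rw [sampleTwo, dif_pos h]

lemma norm_le_of_apply (hg : SampleBound K g) (hε : ε ∈ Ioc (0 : ℝ) 1) {θ : ℝ} {x : EllTwo}
    (hx : ∀ j, x j = g (ε * j + θ)) : ‖x‖ ≤ K / √ε := by
  have hK := hg.nonneg
  refine lp_two_norm_le_of_hasSum (by positivity) fun F => ?_
  simp only [hx, div_pow, Real.sq_sqrt hε.1.le]
  exact hg.sum_sq_le hε θ F

end SampleBound

/-! ### The approximate solution and its residual -/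

section Taylor

variable {α : ℝ}

/-- The remainder of the expansion of the force to second order. -/
def cmRemainder (α y : ℝ) : ℝ :=
  cmForce α (1 / 2) y - (α * (α + 1) * y - α * (α + 1) * (α + 2) / 2 * y ^ 2)

/-- A constant for the remainder of the expansion of the force. -/
def remainderConst (α : ℝ) : ℝ :=
  α * (α + 1) * ((α + 2) * ((α + 3) * (1 / 2) ^ (-(α + 3 + 1))))

lemma remainderConst_nonneg (hα : 0 < α) : 0 ≤ remainderConst α := by
  unfold remainderConst
  positivity

lemma abs_rpow_neg_taylor_le {β : ℝ} (hβ : 0 ≤ β) {y : ℝ} (hy : |y| ≤ 1 / 2) :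
    |(1 + y) ^ (-β) - 1 + β * y| ≤ β * ((β + 1) * (1 / 2) ^ (-(β + 1 + 1))) * y ^ 2 := by
  have hmem : ∀ x ∈ uIcc 0 y, 1 / 2 ≤ 1 + x ∧ |x| ≤ |y| := fun x hx => by
    have h1 : |x| ≤ |y| := by simpa using abs_sub_left_of_mem_uIcc hx
    exact ⟨by linarith [(abs_le.1 (h1.trans hy)).1], h1⟩
  have key := (convex_uIcc 0 y).norm_image_sub_le_of_norm_hasDerivWithin_le
    (f := fun x => (1 + x) ^ (-β) + β * x) (f' := fun x => β * (1 - (1 + x) ^ (-(β + 1))))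
    (C := β * ((β + 1) * (1 / 2) ^ (-(β + 1 + 1)) * |y|))
    (fun x hx => by
      have h1 := (hmem x hx).1
      have h2 : HasDerivAt (fun x : ℝ => 1 + x) 1 x := (hasDerivAt_id x).const_add 1
      have h3 := (h2.rpow_const (p := -β) (Or.inl (by linarith))).add
        ((hasDerivAt_id x).const_mul β)
      refine HasDerivAt.hasDerivWithinAt (h3.congr_deriv ?_)
      rw [show -β - 1 = -(β + 1) by ring]
      ring)
    (fun x hx => by
      obtain ⟨h1, h2⟩ := hmem x hx
      have h3 := abs_rpow_neg_sub_le (β := β + 1) (d := 1 / 2) (by linarith) (by norm_num)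
        (x := 1) (y := 1 + x) (by norm_num) h1
      rw [Real.one_rpow, sub_add_cancel_left, abs_neg] at h3
      rw [norm_mul, Real.norm_of_nonneg hβ, Real.norm_eq_abs]
      gcongr
      refine h3.trans ?_
      gcongr)
    left_mem_uIcc right_mem_uIcc
  simp only [add_zero, Real.one_rpow, mul_zero, sub_zero, Real.norm_eq_abs] at key
  rw [show (1 + y) ^ (-β) - 1 + β * y = (1 + y) ^ (-β) + β * y - 1 by ring]
  refine key.trans (le_of_eq ?_)
  rw [← sq_abs y]
  ring

lemma half_mem : (1 / 2 : ℝ) ∈ Ioo (0 : ℝ) 1 := by constructor <;> norm_num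

lemma one_add_mem_Icc {y : ℝ} (hy : |y| ≤ 1 / 2) : 1 + y ∈ Icc (1 / 2 : ℝ) (1 / 2)⁻¹ := by
  rw [abs_le] at hy
  constructor
  · linarith [hy.1]
  · norm_num
    linarith [hy.2]

lemma abs_cmRemainder_sub_le (hα : 0 < α) {ρ x y : ℝ} (hρ : ρ ≤ 1 / 2) (hx : |x| ≤ ρ) (hy : |y| ≤ ρ) :
    |cmRemainder α x - cmRemainder α y| ≤ remainderConst α * ρ ^ 2 * |x - y| := by
  refine (convex_Icc (-ρ) ρ).norm_image_sub_le_of_norm_hasDerivWithin_le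
    (f' := fun z => cmSlope α (1 / 2) z - α * (α + 1) * (1 - (α + 2) * z)) (fun z _ => ?_)
    (fun z hz => ?_) (abs_le.1 hy) (abs_le.1 hx)
  · have h1 := (isForce_cmForce hα half_mem).deriv z
    have h2 := h1.sub (((hasDerivAt_id z).const_mul (α * (α + 1))).sub
      (((hasDerivAt_id z).pow 2).const_mul (α * (α + 1) * (α + 2) / 2)))
    refine HasDerivAt.hasDerivWithinAt (h2.congr_deriv ?_)
    simp
    ring
  · have hz' : |z| ≤ ρ := abs_le.2 hz
    have h1 := abs_rpow_neg_taylor_le (β := α + 2) (by linarith) (hz'.trans hρ)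
    rw [cmSlope, clampLen_of_mem (one_add_mem_Icc (hz'.trans hρ)), Real.norm_eq_abs, ← mul_sub, abs_mul,
      abs_of_pos (by positivity), remainderConst, mul_assoc (α * (α + 1))]
    refine mul_le_mul_of_nonneg_left ?_ (by positivity)
    rw [show (1 + z) ^ (-(α + 2)) - (1 - (α + 2) * z) = (1 + z) ^ (-(α + 2)) - 1 + (α + 2) * z by ring]
    refine h1.trans ?_
    rw [← sq_abs z, show α + 2 + 1 = α + 3 by ring]
    gcongr

end Taylor

section Residual

variable {α L : ℝ} {v : ℝ → ℂ}

lemma SpectralBound.sum_avgSynth (hv : SpectralBound L v) {ε : ℝ} (hε : ε ≠ 0) (X : ℝ) (n : ℕ) :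
    ((n : ℝ) + 1)⁻¹ * ∑ i ∈ Finset.range (n + 1), avgSynth v ε (X + ε * i)
      = avgSynth v (((n : ℝ) + 1) * ε) X := by
  have hn : (n : ℝ) + 1 ≠ 0 := by positivity
  have hw : Integrable fun k => 1 * v k := hv.integrable_mul (MultOrder.one.isMult (by norm_num))
  have hc : Continuous (baseSynth v) := Complex.continuous_re.comp (continuous_fourierSynth hw)
  have h1 := intervalIntegral.sum_integral_adjacent_intervals (f := baseSynth v) (μ := volume)
    (a := fun i : ℕ => X + ε * i) (n := n + 1) fun i _ => hc.intervalIntegrable _ _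
  have h2 : ∀ i : ℕ, ∫ x in (X + ε * i)..(X + ε * (i + 1 : ℕ)), baseSynth v x
      = ε * avgSynth v ε (X + ε * i) := fun i => by
    rw [← hv.integral_baseSynth]
    push_cast
    congr 1
    ring
  simp only [h2] at h1
  rw [← Finset.mul_sum, Nat.cast_zero, mul_zero, add_zero,
    show X + ε * ((n + 1 : ℕ) : ℝ) = X + ((n : ℝ) + 1) * ε by push_cast; ring,
    hv.integral_baseSynth] at h1
  rw [inv_mul_eq_iff_eq_mul₀ hn]
  apply mul_left_cancel₀ hε
  rw [h1]
  ring

/-- The relative displacements of the approximate solution. In this and the following definitions,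
`a` stands for `ε ^ (α - 1)`. -/
def strainProfile (a ε : ℝ) (v : ℝ → ℂ) (X : ℝ) : ℝ := -a * avgSynth v ε X

/-- The velocities of the approximate solution. -/
def velocityProfile (α a : ℝ) (v : ℝ → ℂ) (X : ℝ) : ℝ :=
  cSpeed α * a * baseSynth v X - a ^ 2 * boFlux α v X

/-- The accelerations of the approximate solution. -/
def accelProfile (α a ε : ℝ) (v : ℝ → ℂ) (X : ℝ) : ℝ :=
  -cSpeed α ^ 2 * a * ε * derivSynth v X + kappa₁ α * a ^ 2 * ε * boRate α v X
    - a ^ 3 * ε * boFluxRate α v X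

lemma SpectralBound.sampleBound_avg (hv : SpectralBound L v) (h : ℝ) :
    SampleBound (4 * L) (avgSynth v h) := by
  unfold avgSynth
  simpa using hv.sampleBound ((multOrder_avgMult h).isMult (by norm_num))

lemma SpectralBound.sampleBound_strain (hv : SpectralBound L v) (a ε : ℝ) :
    SampleBound (|a| * (4 * L)) (strainProfile a ε v) := by
  rw [← abs_neg a]
  exact (hv.sampleBound_avg ε).const_mul (-a)

/-- The contribution of the remainder of the force. -/
lemma SpectralBound.sampleBound_remainder (hα : 1 < α) (hv : SpectralBound L v) {a ε : ℝ} (ha : 0 < a)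
    (hε : 0 < ε) (haL : a * (4 * L) ≤ 1 / 2) (n : ℕ) :
    SampleBound (((n : ℝ) + 1) ^ (-α) * (remainderConst α * (4 * L) ^ 3 * (a ^ 3 * ε))) fun X =>
      ((n : ℝ) + 1) ^ (-α) * ((n : ℝ) + 1)⁻¹ *
        (cmRemainder α (-a * avgSynth v (((n : ℝ) + 1) * ε) X)
          - cmRemainder α (-a * avgSynth v (((n : ℝ) + 1) * ε) (X - ((n : ℝ) + 1) * ε))) := by
  have hR := remainderConst_nonneg (zero_lt_one.trans hα)
  have hn : (0 : ℝ) < (n : ℝ) + 1 := by positivity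
  have hL := hv.nonneg
  set h := ((n : ℝ) + 1) * ε with hh
  have hQ := (hv.sampleBound ((multOrder_quotMult h).isMult (by norm_num))).const_mul
    (((n : ℝ) + 1) ^ (-α) * (remainderConst α * (a * (4 * L)) ^ 2 * (a * ε)))
  refine (hQ.mono (le_of_eq ?_)).of_abs_le fun X => ?_
  · rw [abs_of_nonneg (by positivity)]
    ring
  · have hb : ∀ Y, |-a * avgSynth v h Y| ≤ a * (4 * L) := fun Y => by
      rw [abs_mul, abs_neg, abs_of_pos ha]
      exact mul_le_mul_of_nonneg_left ((hv.sampleBound_avg h).abs_le Y) ha.le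
    have h1 := abs_cmRemainder_sub_le (zero_lt_one.trans hα) haL (hb X) (hb (X - h))
    rw [← mul_sub, hv.avgSynth_sub, abs_mul (-a), abs_neg, abs_of_pos ha, abs_mul h,
      abs_of_pos (by positivity : 0 < h)] at h1
    rw [abs_mul, abs_of_nonneg (by positivity : 0 ≤ ((n : ℝ) + 1) ^ (-α) * ((n : ℝ) + 1)⁻¹), abs_mul,
      abs_of_nonneg (by positivity : 0 ≤ ((n : ℝ) + 1) ^ (-α) *
        (remainderConst α * (a * (4 * L)) ^ 2 * (a * ε)))]
    calc _ ≤ ((n : ℝ) + 1) ^ (-α) * ((n : ℝ) + 1)⁻¹ * (remainderConst α * (a * (4 * L)) ^ 2 *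
          (a * (h * |multSynth (quotMult h) v X|))) := by gcongr
      _ = ((n : ℝ) + 1)⁻¹ * ((n : ℝ) + 1) * (((n : ℝ) + 1) ^ (-α) *
          (remainderConst α * (a * (4 * L)) ^ 2 * (a * ε)) * |multSynth (quotMult h) v X|) := by
          rw [hh]; ring
      _ = _ := by rw [inv_mul_cancel₀ hn.ne', one_mul]

/-- The approximate solution satisfies the lattice equations up to a small residual: the terms of
lower order cancel by the choice of the wave speed and by the Benjamin-Ono equation. -/
lemma exists_residual_bound (hα : α ∈ Ioo (1 : ℝ) 3) {C : ℝ}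
    (hC : ∀ v, SpectralBound L v → BOProfile α C v) :
    ∃ K, 0 ≤ K ∧ ∀ {v : ℝ → ℂ}, SpectralBound L v → ∀ {ε a : ℝ}, ε ∈ Ioc (0 : ℝ) 1 → a = ε ^ (α - 1) →
      a * (4 * L) ≤ 1 / 2 → ∀ θ, ∀ R G : EllTwo,
      (∀ j, R j = strainProfile a ε v (ε * j + θ)) → (∀ j, G j = accelProfile α a ε v (ε * j + θ)) →
      ‖G - (isForce_cmForce (zero_lt_one.trans hα.1) half_mem).accel α R‖
        ≤ K * (a * ε ^ 3 + a ^ 3 * ε) / √ε := by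
  have hα0 : 0 < α := zero_lt_one.trans hα.1
  obtain ⟨C₁, hC₁, hlin⟩ := exists_linear_dispersion hα
  obtain ⟨C₂, hC₂, hquad⟩ := exists_quadratic_interaction hα
  set b := α * (α + 1) * (α + 2) / 2 with hb
  have hz := (summable_rpow_neg hα.1).hasSum
  rw [← zetaSum_eq] at hz
  have hζ := one_le_zetaSum hα.1
  have hR := remainderConst_nonneg hα0
  refine ⟨α * (α + 1) * (C₁ * |L|) + (|fluxBound α C| + 2 * b * (C₂ * L ^ 2)
    + zetaSum α * (remainderConst α * (4 * |L|) ^ 3)), by positivity,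
    fun {v} hv {ε a} hε ha haL θ R G hRj hGj => ?_⟩
  have hL := hv.nonneg
  have hε0 := hε.1
  have ha0 : 0 < a := ha ▸ Real.rpow_pos_of_pos hε.1 _
  obtain ⟨g₁, hg₁, hs₁⟩ := hlin hv ε hε.1
  obtain ⟨g₂, hg₂, hs₂⟩ := hquad hv ε hε.1
  have hrem := hv.sampleBound_remainder hα.1 ha0 hε.1 haL
  set U := baseSynth v with hU
  set D := derivSynth v with hD
  set H := multSynth (dispMult α) v with hH
  set Q : ℕ → ℝ → ℝ := fun n => multSynth (quotMult (((n : ℝ) + 1) * ε)) v with hQ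
  set P : ℕ → ℝ → ℝ := fun n => multSynth (meanMult (((n : ℝ) + 1) * ε)) v with hP
  set B : ℕ → ℝ → ℝ := fun n => avgSynth v (((n : ℝ) + 1) * ε) with hB
  set ρ : ℕ → ℝ → ℝ := fun n X => ((n : ℝ) + 1) ^ (-α) * ((n : ℝ) + 1)⁻¹ *
    (cmRemainder α (-a * B n X) - cmRemainder α (-a * B n (X - ((n : ℝ) + 1) * ε))) with hρ
  have hρs : ∀ X, Summable fun n => ρ n X := fun X =>
    (hz.summable.mul_right _).of_norm_bounded fun n => (hrem n).abs_le X
  have hg₃ : SampleBound (zetaSum α * (remainderConst α * (4 * L) ^ 3 * (a ^ 3 * ε)))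
      fun X => ∑' n, ρ n X := SampleBound.hasSum hrem (hz.mul_right _) fun X => (hρs X).hasSum
  have havg : ∀ (n : ℕ) (j : ℤ), ellAvg n R j = -a * B n (ε * j + θ) := fun n j => by
    rw [ellAvg_apply]
    simp only [hRj, strainProfile]
    have hBj : B n (ε * j + θ) = _ := (hv.sum_avgSynth hε.1.ne' (ε * j + θ) n).symm
    rw [← Finset.mul_sum, hBj]
    have : ∀ i : ℕ, avgSynth v ε (ε * ((j + (i : ℤ) : ℤ) : ℝ) + θ)
        = avgSynth v ε (ε * j + θ + ε * i) := fun i => by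
      congr 1
      push_cast
      ring
    simp only [this]
    ring
  -- the expansion of the acceleration
  have hacc : ∀ j : ℤ, (isForce_cmForce hα0 half_mem).accel α R j
      = -(α * (α + 1) * a * ε) * (zetaSum α * D (ε * j + θ)
          - (g₁ (ε * j + θ) - dispersionConst α * a * H (ε * j + θ)))
        - 2 * b * a ^ 2 * ε * (zetaSum α * (U (ε * j + θ) * D (ε * j + θ)) - g₂ (ε * j + θ))
        + ∑' n, ρ n (ε * j + θ) := fun j => by
    set X := ε * j + θ with hX
    have e1 := (hz.mul_right (D X)).sub (hs₁ X)
    have e2 := (hz.mul_right (U X * D X)).sub (hs₂ X)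
    have e3 := ((e1.mul_left (-(α * (α + 1) * a * ε))).sub (e2.mul_left (2 * b * a ^ 2 * ε))).add
      (hρs X).hasSum
    rw [← ha] at e3
    refine (hasSum_accel (isForce_cmForce hα0 half_mem) hα.1 R j).unique ?_
    convert! e3 using 2 with n
    have hn : (0 : ℝ) < (n : ℝ) + 1 := by positivity
    have hX' : ε * ((j - ((n : ℤ) + 1) : ℤ) : ℝ) + θ = X - ((n : ℝ) + 1) * ε := by
      rw [hX]; push_cast; ring
    rw [havg, havg, hX', ← hX]
    have s1 : B n X - B n (X - ((n : ℝ) + 1) * ε) = ((n : ℝ) + 1) * ε * Q n X :=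
      hv.avgSynth_sub (((n : ℝ) + 1) * ε) X
    have s2 : B n X + B n (X - ((n : ℝ) + 1) * ε) = 2 * P n X :=
      hv.avgSynth_add (((n : ℝ) + 1) * ε) X
    have s3 : ((n : ℝ) + 1)⁻¹ * ((n : ℝ) + 1) = 1 := inv_mul_cancel₀ hn.ne'
    have hf : ∀ y, cmForce α (1 / 2) y = α * (α + 1) * y - b * y ^ 2 + cmRemainder α y := fun y => by
      rw [cmRemainder]; ring
    rw [hf, hf]
    simp only [hρ]
    set B1 := B n X
    set B2 := B n (X - ((n : ℝ) + 1) * ε)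
    set z := ((n : ℝ) + 1) ^ (-α)
    set w := ((n : ℝ) + 1)⁻¹
    set R1 := cmRemainder α (-a * B1)
    set R2 := cmRemainder α (-a * B2)
    have t1 : w * (B1 - B2) = ε * Q n X := by
      rw [s1]; linear_combination ε * Q n X * s3
    have t2 : w * (B1 ^ 2 - B2 ^ 2) = 2 * ε * Q n X * P n X := by
      have : B1 ^ 2 - B2 ^ 2 = (B1 - B2) * (B1 + B2) := by ring
      rw [this, ← mul_assoc, t1, s2]; ring
    change z * w * _ = -(α * (α + 1) * a * ε) * (z * D X - z * (D X - Q n X))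
      - 2 * b * a ^ 2 * ε * (z * (U X * D X) - z * (U X * D X - Q n X * P n X)) + _
    linear_combination -(α * (α + 1) * a * z) * t1 - b * a ^ 2 * z * t2
  -- the residual
  have hres : ∀ j, (G - (isForce_cmForce hα0 half_mem).accel α R) j
      = (fun X => (-(a ^ 3 * ε)) * boFluxRate α v X - (α * (α + 1) * a * ε) * g₁ X
        - (2 * b * a ^ 2 * ε) * g₂ X - ∑' n, ρ n X) (ε * j + θ) := fun j => by
    have e : (G - (isForce_cmForce hα0 half_mem).accel α R) j
        = G j - (isForce_cmForce hα0 half_mem).accel α R j := rfl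
    rw [e, hacc, hGj, accelProfile, cSpeed_sq hα.1, boRate]
    have h1 : kappa₁ α * (kappa₁ α)⁻¹ = 1 := mul_inv_cancel₀ (kappa₁_pos hα.1).ne'
    have h2 : kappa₂ α = 2 * b * zetaSum α := by rw [kappa₂, hb]; ring
    have h3 := kappa₃_eq α
    simp only [← hU, ← hD, ← hH]
    rw [h2, h3]
    linear_combination (a ^ 2 * ε * (-(2 * b * zetaSum α) * (U (ε * j + θ) * D (ε * j + θ))
      - α * (α + 1) * dispersionConst α * H (ε * j + θ))) * h1
  have hsb := ((((hC v hv).fluxRate.const_mul (-(a ^ 3 * ε))).sub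
    (hg₁.const_mul (α * (α + 1) * a * ε))).sub (hg₂.const_mul (2 * b * a ^ 2 * ε))).sub hg₃
  refine (hsb.norm_le_of_apply hε hres).trans ?_
  have hb0 : 0 < b := by positivity
  rw [abs_neg, abs_of_nonneg (by positivity : 0 ≤ a ^ 3 * ε),
    abs_of_nonneg (by positivity : 0 ≤ α * (α + 1) * a * ε),
    abs_of_nonneg (by positivity : 0 ≤ 2 * b * a ^ 2 * ε), ← ha, abs_of_nonneg hL]
  gcongr
  have h1 : a ^ 3 * ε * fluxBound α C ≤ a ^ 3 * ε * |fluxBound α C| := by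
    gcongr
    exact le_abs_self _
  have h2 : 0 ≤ a ^ 3 * ε * (α * (α + 1) * (C₁ * L)) := by positivity
  have h3 : 0 ≤ a * ε ^ 3 * (|fluxBound α C| + 2 * b * (C₂ * L ^ 2)
    + zetaSum α * (remainderConst α * (4 * L) ^ 3)) := by positivity
  linarith

end Residual

/-! ### The approximate solution as a curve -/

lemma lp_two_norm_sub_le_Icc {ι : Type*} {z : ℝ → lp (fun _ : ι => ℝ) 2} {a b B : ℝ} (hab : a < b)
    (hB : 0 ≤ B) (hc : ∀ i, ContinuousOn (fun s => z s i) (Icc a b))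
    (h : ∀ s ∈ Ioo a b, ∀ t ∈ Ioo a b, ‖z s - z t‖ ≤ B * |s - t|) {s t : ℝ} (hs : s ∈ Icc a b)
    (ht : t ∈ Icc a b) : ‖z s - z t‖ ≤ B * |s - t| := by
  refine lp_two_norm_le_of_hasSum (by positivity) fun F => ?_
  have hcl : closure (Ioo a b ×ˢ Ioo a b) = Icc a b ×ˢ Icc a b := by
    rw [closure_prod_eq, closure_Ioo hab.ne]
  have hle : ∀ q ∈ Ioo a b ×ˢ Ioo a b, ∑ i ∈ F, (z q.1 i - z q.2 i) ^ 2 ≤ (B * |q.1 - q.2|) ^ 2 := by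
    intro q hq
    refine (sum_le_hasSum F (fun i _ => sq_nonneg _) (lp_two_hasSum_sq (z q.1 - z q.2))).trans ?_
    exact pow_le_pow_left₀ (norm_nonneg _) (h _ hq.1 _ hq.2) 2
  have hmem : (s, t) ∈ closure (Ioo a b ×ˢ Ioo a b) := hcl ▸ ⟨hs, ht⟩
  refine le_on_closure hle ?_ ?_ hmem
  · rw [hcl]
    refine continuousOn_finsetSum F fun i _ => ContinuousOn.pow (ContinuousOn.sub ?_ ?_) 2
    · exact (hc i).comp continuousOn_fst fun q hq => hq.1
    · exact (hc i).comp continuousOn_snd fun q hq => hq.2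
  · exact (by fun_prop : Continuous fun q : ℝ × ℝ => (B * |q.1 - q.2|) ^ 2).continuousOn

lemma HasFDerivAt.hasDerivAt_line {g : ℝ → ℝ → ℝ} {A B x₀ c e t : ℝ}
    (h : HasFDerivAt (fun z : ℝ × ℝ => g z.1 z.2)
      (A • ContinuousLinearMap.fst ℝ ℝ ℝ + B • ContinuousLinearMap.snd ℝ ℝ ℝ) (x₀ - c * t, e * t)) :
    HasDerivAt (fun s => g (x₀ - c * s) (e * s)) (-c * A + e * B) t := by
  have h1 : HasDerivAt (fun s : ℝ => (x₀ - c * s, e * s)) (-c, e) t := by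
    refine HasDerivAt.prodMk ?_ ?_
    · simpa using! ((hasDerivAt_id t).const_mul c).const_sub x₀
    · simpa using! (hasDerivAt_id t).const_mul e
  have h2 := h.comp_hasDerivAt t h1
  refine h2.congr_deriv ?_
  simp
  ring

lemma continuousOn_line {g : ℝ → ℝ → ℝ} {A : Set ℝ} {L L' : ℝ}
    (h1 : ∀ τ ∈ A, ∀ X Y, |g X τ - g Y τ| ≤ L * |X - Y|)
    (h2 : ∀ X, ∀ σ ∈ A, ∀ τ ∈ A, |g X σ - g X τ| ≤ L' * |σ - τ|) {S : Set ℝ} {x₀ c e : ℝ}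
    (hS : ∀ s ∈ S, e * s ∈ A) : ContinuousOn (fun s => g (x₀ - c * s) (e * s)) S := by
  intro t ht
  rw [ContinuousWithinAt, tendsto_iff_dist_tendsto_zero]
  have hlim : Filter.Tendsto (fun s => L * |(x₀ - c * s) - (x₀ - c * t)| + L' * |e * s - e * t|)
      (nhdsWithin t S) (nhds 0) := by
    have : Filter.Tendsto (fun s => L * |(x₀ - c * s) - (x₀ - c * t)| + L' * |e * s - e * t|)
        (nhds t) (nhds (L * |(x₀ - c * t) - (x₀ - c * t)| + L' * |e * t - e * t|)) :=
      (by fun_prop : Continuous fun s =>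
        L * |(x₀ - c * s) - (x₀ - c * t)| + L' * |e * s - e * t|).continuousAt
    simp only [sub_self, abs_zero, mul_zero, add_zero] at this
    exact this.mono_left nhdsWithin_le_nhds
  refine squeeze_zero' (Filter.Eventually.of_forall fun _ => dist_nonneg) ?_ hlim
  filter_upwards [self_mem_nhdsWithin] with s hs
  rw [Real.dist_eq]
  refine (abs_sub_le _ (g (x₀ - c * t) (e * s)) _).trans ?_
  exact add_le_add (h1 _ (hS s hs) _ _) (h2 _ _ (hS s hs) _ (hS t ht))

/-- An approximate solution of the lattice equations, with relative displacements `rt`, velocities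
`pt` and accelerations `g`, in the form needed for the stability estimate. -/
structure IsApproximation (α a ε L C K T : ℝ) (hα : α ∈ Ioo (1 : ℝ) 3) (v : ℝ → ℝ → ℂ)
    (rt pt g : ℝ → EllTwo) (B : ℝ) : Prop where
  strain_apply : ∀ t ∈ Icc (-T) T, ∀ j : ℤ,
    rt t j = strainProfile a ε (v (a * ε * t)) (ε * j - ε * cSpeed α * t)
  velocity_apply : ∀ t ∈ Icc (-T) T, ∀ j : ℤ,
    pt t j = velocityProfile α a (v (a * ε * t)) (ε * j - ε * cSpeed α * t)
  continuousOn : ContinuousOn rt (Icc (-T) T)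
  hasDerivAt_strain : ∀ t ∈ Ioo (-T) T, ∀ j, HasDerivAt (fun s => rt s j) (ellDiff (pt t) j) t
  nonneg : 0 ≤ B
  lipschitz : ∀ s ∈ Icc (-T) T, ∀ t ∈ Icc (-T) T, ‖pt s - pt t‖ ≤ B * |s - t|
  hasDerivAt_velocity : ∀ t ∈ Ioo (-T) T, ∀ j, HasDerivAt (fun s => pt s j) (g t j) t
  residual : ∀ t ∈ Ioo (-T) T,
    ‖g t - (isForce_cmForce (zero_lt_one.trans hα.1) half_mem).accel α (rt t)‖
      ≤ K * (a * ε ^ 3 + a ^ 3 * ε) / √ε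
  rate_le : ∀ t ∈ Ioo (-T) T, ∀ j, |ellDiff (pt t) j| ≤ (cSpeed α + 1) * C * (a * ε)

lemma BOProfile.sampleBound_velocity {α C : ℝ} {v : ℝ → ℂ} (h : BOProfile α C v) (a : ℝ) :
    SampleBound (|cSpeed α * a| * C + |a ^ 2| * C) (velocityProfile α a v) :=
  (h.base.const_mul _).sub (h.flux.const_mul _)

lemma BOProfile.sampleBound_accel {α C : ℝ} {v : ℝ → ℂ} (h : BOProfile α C v) (a ε : ℝ) :
    SampleBound (|-cSpeed α ^ 2 * a * ε| * C + |kappa₁ α * a ^ 2 * ε| * C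
      + |a ^ 3 * ε| * fluxBound α C) (accelProfile α a ε v) :=
  ((h.deriv.const_mul _).add (h.rate.const_mul _)).sub (h.fluxRate.const_mul _)

lemma BOCurve.exists_approximation {α τ₀ L C K : ℝ} (hα : α ∈ Ioo (1 : ℝ) 3) {v : ℝ → ℝ → ℂ}
    (h : BOCurve α τ₀ L v) (hτ₀ : 0 < τ₀) (hC : ∀ v, SpectralBound L v → BOProfile α C v)
    (hK : ∀ {v : ℝ → ℂ}, SpectralBound L v → ∀ {ε a : ℝ}, ε ∈ Ioc (0 : ℝ) 1 → a = ε ^ (α - 1) →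
      a * (4 * L) ≤ 1 / 2 → ∀ θ, ∀ R G : EllTwo,
      (∀ j, R j = strainProfile a ε v (ε * j + θ)) → (∀ j, G j = accelProfile α a ε v (ε * j + θ)) →
      ‖G - (isForce_cmForce (zero_lt_one.trans hα.1) half_mem).accel α R‖
        ≤ K * (a * ε ^ 3 + a ^ 3 * ε) / √ε)
    {ε a : ℝ} (hε : ε ∈ Ioc (0 : ℝ) 1) (ha : a = ε ^ (α - 1)) (haL : a * (4 * L) ≤ 1 / 2) :
    ∃ rt pt g B, IsApproximation α a ε L C K (τ₀ / (a * ε)) hα v rt pt g B := by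
  obtain ⟨hε0, hε1⟩ := hε
  have ha0 : 0 < a := ha ▸ Real.rpow_pos_of_pos hε0 _
  have ha1 : a ≤ 1 := ha ▸ Real.rpow_le_one hε0.le hε1 (by linarith [hα.1])
  have haε : 0 < a * ε := by positivity
  have hc := cSpeed_pos hα.1
  obtain ⟨T, hT⟩ : ∃ T, T = τ₀ / (a * ε) := ⟨_, rfl⟩
  rw [← hT]
  have hT0 : 0 < T := by rw [hT]; positivity
  have hTτ : a * ε * T = τ₀ := by rw [hT]; field_simp
  have hIcc : ∀ t ∈ Icc (-T) T, a * ε * t ∈ Icc (-τ₀) τ₀ := fun t ht => by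
    constructor <;> nlinarith [ht.1, ht.2]
  have hIoo : ∀ t ∈ Ioo (-T) T, a * ε * t ∈ Ioo (-τ₀) τ₀ := fun t ht => by
    constructor <;> nlinarith [ht.1, ht.2]
  have hP : ∀ t ∈ Icc (-T) T, BOProfile α C (v (a * ε * t)) := fun t ht => h.profile hC (hIcc t ht)
  have h0T : (0 : ℝ) ∈ Icc (-T) T := ⟨by linarith, hT0.le⟩
  have hC0 : 0 ≤ C := (hP 0 h0T).base.nonneg
  set θ : ℝ → ℝ := fun t => -(ε * cSpeed α * t) with hθ
  set rt : ℝ → EllTwo := fun t => sampleTwo ε (θ t) (strainProfile a ε (v (a * ε * t))) with hrt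
  set pt : ℝ → EllTwo := fun t => sampleTwo ε (θ t) (velocityProfile α a (v (a * ε * t))) with hpt
  set g : ℝ → EllTwo := fun t => sampleTwo ε (θ t) (accelProfile α a ε (v (a * ε * t))) with hg
  have art : ∀ t ∈ Icc (-T) T, ∀ j : ℤ, rt t j
      = strainProfile a ε (v (a * ε * t)) (ε * j + θ t) := fun t ht j =>
    ((h.spectral _ (hIcc t ht)).sampleBound_strain a ε).sampleTwo_apply ⟨hε0, hε1⟩ _ j
  have apt : ∀ t ∈ Icc (-T) T, ∀ j : ℤ, pt t j
      = velocityProfile α a (v (a * ε * t)) (ε * j + θ t) := fun t ht j =>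
    ((hP t ht).sampleBound_velocity a).sampleTwo_apply ⟨hε0, hε1⟩ _ j
  have ag : ∀ t ∈ Icc (-T) T, ∀ j : ℤ, g t j
      = accelProfile α a ε (v (a * ε * t)) (ε * j + θ t) := fun t ht j =>
    ((hP t ht).sampleBound_accel a ε).sampleTwo_apply ⟨hε0, hε1⟩ _ j
  have eθ : ∀ (j : ℤ) (t : ℝ), ε * j + θ t = ε * j - ε * cSpeed α * t := fun j t => by
    rw [hθ]; ring
  have art' : ∀ t ∈ Icc (-T) T, ∀ j : ℤ, rt t j
      = strainProfile a ε (v (a * ε * t)) (ε * j - ε * cSpeed α * t) := fun t ht j => by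
    rw [art t ht, eθ]
  have apt' : ∀ t ∈ Icc (-T) T, ∀ j : ℤ, pt t j
      = velocityProfile α a (v (a * ε * t)) (ε * j - ε * cSpeed α * t) := fun t ht j => by
    rw [apt t ht, eθ]
  have hdiff : ∀ t ∈ Icc (-T) T, ∀ j : ℤ, ellDiff (pt t) j
      = cSpeed α * a * (baseSynth (v (a * ε * t)) (ε * j - ε * cSpeed α * t + ε)
          - baseSynth (v (a * ε * t)) (ε * j - ε * cSpeed α * t))
        - a ^ 2 * (boFlux α (v (a * ε * t)) (ε * j - ε * cSpeed α * t + ε)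
          - boFlux α (v (a * ε * t)) (ε * j - ε * cSpeed α * t)) := fun t ht j => by
    rw [ellDiff_apply, apt' t ht, apt' t ht, velocityProfile, velocityProfile,
      show ε * ((j + 1 : ℤ) : ℝ) - ε * cSpeed α * t = ε * j - ε * cSpeed α * t + ε by push_cast; ring]
    ring
  have hevT : ∀ t ∈ Ioo (-T) T, ∀ᶠ s in nhds t, s ∈ Icc (-T) T := fun t ht =>
    Icc_mem_nhds ht.1 ht.2
  have dbase : ∀ t ∈ Ioo (-T) T, ∀ x₀, HasDerivAt
      (fun s => baseSynth (v (a * ε * s)) (x₀ - ε * cSpeed α * s))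
      (-(ε * cSpeed α) * derivSynth (v (a * ε * t)) (x₀ - ε * cSpeed α * t)
        + a * ε * boRate α (v (a * ε * t)) (x₀ - ε * cSpeed α * t)) t := fun t ht x₀ =>
    HasFDerivAt.hasDerivAt_line (g := fun X τ => baseSynth (v τ) X)
      (h.hasFDerivAt_base hC (hIoo t ht) (x₀ - ε * cSpeed α * t))
  have dflux : ∀ t ∈ Ioo (-T) T, ∀ x₀, HasDerivAt
      (fun s => boFlux α (v (a * ε * s)) (x₀ - ε * cSpeed α * s))
      (-(ε * cSpeed α) * boRate α (v (a * ε * t)) (x₀ - ε * cSpeed α * t)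
        + a * ε * boFluxRate α (v (a * ε * t)) (x₀ - ε * cSpeed α * t)) t := fun t ht x₀ =>
    HasFDerivAt.hasDerivAt_line (g := fun X τ => boFlux α (v τ) X)
      (h.hasFDerivAt_flux hC hα (hIoo t ht) (x₀ - ε * cSpeed α * t))
  have davg : ∀ t ∈ Ioo (-T) T, ∀ x₀, HasDerivAt
      (fun s => ε * avgSynth (v (a * ε * s)) ε (x₀ - ε * cSpeed α * s))
      (-(ε * cSpeed α) * (baseSynth (v (a * ε * t)) (x₀ - ε * cSpeed α * t + ε)
          - baseSynth (v (a * ε * t)) (x₀ - ε * cSpeed α * t))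
        + a * ε * (boFlux α (v (a * ε * t)) (x₀ - ε * cSpeed α * t + ε)
          - boFlux α (v (a * ε * t)) (x₀ - ε * cSpeed α * t))) t := fun t ht x₀ =>
    HasFDerivAt.hasDerivAt_line (g := fun X τ => ε * avgSynth (v τ) ε X)
      (h.hasFDerivAt_avg hC hε0.le (hIoo t ht) (x₀ - ε * cSpeed α * t))
  have drt : ∀ t ∈ Ioo (-T) T, ∀ j, HasDerivAt (fun s => rt s j) (ellDiff (pt t) j) t := by
    intro t ht j
    rw [hdiff t (Ioo_subset_Icc_self ht)]
    refine (((davg t ht (ε * j)).const_mul (-(a / ε))).congr_of_eventuallyEq ?_).congr_deriv ?_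
    · filter_upwards [hevT t ht] with s hs
      rw [art' s hs, strainProfile]
      field_simp
    · field_simp
      ring
  have dpt : ∀ t ∈ Ioo (-T) T, ∀ j, HasDerivAt (fun s => pt s j) (g t j) t := by
    intro t ht j
    rw [ag t (Ioo_subset_Icc_self ht), eθ]
    refine ((((dbase t ht (ε * j)).const_mul (cSpeed α * a)).sub
      ((dflux t ht (ε * j)).const_mul (a ^ 2))).congr_of_eventuallyEq ?_).congr_deriv ?_
    · filter_upwards [hevT t ht] with s hs
      rw [apt' s hs, velocityProfile]
      rfl
    · rw [accelProfile, kappa₁]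
      ring
  have cpt : ∀ j, ContinuousOn (fun s => pt s j) (Icc (-T) T) := by
    intro j
    have c1 : ContinuousOn (fun s => baseSynth (v (a * ε * s)) (ε * j - ε * cSpeed α * s)) (Icc (-T) T) :=
      continuousOn_line (g := fun X τ => baseSynth (v τ) X)
        (fun τ hτ => (h.profile hC hτ).abs_base_sub_le)
        (fun X σ hσ τ hτ => h.lipschitz_base hC hσ hτ X) hIcc
    have c2 : ContinuousOn (fun s => boFlux α (v (a * ε * s)) (ε * j - ε * cSpeed α * s)) (Icc (-T) T) :=
      continuousOn_line (g := fun X τ => boFlux α (v τ) X)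
        (fun τ hτ => (h.profile hC hτ).abs_flux_sub_le)
        (fun X => (h.flux_lipschitz_and_hasDerivAt hC hα X).1) hIcc
    exact ((c1.const_mul (cSpeed α * a)).sub (c2.const_mul (a ^ 2))).congr fun s hs => apt' s hs j
  have crt : ∀ j, ContinuousOn (fun s => rt s j) (Icc (-T) T) := by
    intro j
    have c1 : ContinuousOn (fun s => ε * avgSynth (v (a * ε * s)) ε (ε * j - ε * cSpeed α * s))
        (Icc (-T) T) :=
      continuousOn_line (g := fun X τ => ε * avgSynth (v τ) ε X)
        (fun τ hτ => h.abs_avg_sub_le hC ε hτ)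
        (fun X => (h.avg_lipschitz_and_hasDerivAt hC hε0.le X).1) hIcc
    refine (c1.const_mul (-(a / ε))).congr fun s hs => ?_
    rw [art' s hs, strainProfile]
    field_simp
  obtain ⟨Bp, hBp⟩ : ∃ Bp, ∀ t ∈ Icc (-T) T, ‖pt t‖ ≤ Bp :=
    ⟨_, fun t ht => ((hP t ht).sampleBound_velocity a).norm_le_of_apply ⟨hε0, hε1⟩ (apt t ht)⟩
  obtain ⟨Bg, hBg⟩ : ∃ Bg, ∀ t ∈ Icc (-T) T, ‖g t‖ ≤ Bg :=
    ⟨_, fun t ht => ((hP t ht).sampleBound_accel a ε).norm_le_of_apply ⟨hε0, hε1⟩ (ag t ht)⟩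
  have hBg0 : 0 ≤ Bg := (norm_nonneg _).trans (hBg 0 h0T)
  have hBd0 : 0 ≤ ‖ellDiff‖ * Bp :=
    mul_nonneg (norm_nonneg _) ((norm_nonneg _).trans (hBp 0 h0T))
  have hsq : ∀ (x : EllTwo) {b : ℝ}, ‖x‖ ≤ b → ∀ F : Finset ℤ, ∑ i ∈ F, x i ^ 2 ≤ b ^ 2 :=
    fun x b hx F => (sum_le_hasSum F (fun i _ => sq_nonneg _) (lp_two_hasSum_sq x)).trans
      (pow_le_pow_left₀ (norm_nonneg _) hx 2)
  have hlip : ∀ s ∈ Icc (-T) T, ∀ t ∈ Icc (-T) T, ‖pt s - pt t‖ ≤ Bg * |s - t| := fun s hs t ht =>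
    lp_two_norm_sub_le_Icc (by linarith) hBg0 cpt
      (fun s hs t ht => lp_two_norm_sub_le_of_hasDerivWithinAt (convex_Ioo (-T) T) hBg0
        (g := fun t j => g t j) (fun s hs i => (dpt s hs i).hasDerivWithinAt)
        (fun s hs F => hsq _ (hBg s (Ioo_subset_Icc_self hs)) F) hs ht) hs ht
  have hlipr : ∀ s ∈ Icc (-T) T, ∀ t ∈ Icc (-T) T, ‖rt s - rt t‖ ≤ ‖ellDiff‖ * Bp * |s - t| :=
    fun s hs t ht => lp_two_norm_sub_le_Icc (by linarith) hBd0 crt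
      (fun s hs t ht => lp_two_norm_sub_le_of_hasDerivWithinAt (convex_Ioo (-T) T) hBd0
        (g := fun t j => ellDiff (pt t) j) (fun s hs i => (drt s hs i).hasDerivWithinAt)
        (fun s hs F => hsq _ ((ellDiff.le_opNorm _).trans (mul_le_mul_of_nonneg_left
          (hBp s (Ioo_subset_Icc_self hs)) (norm_nonneg _))) F) hs ht) hs ht
  refine ⟨rt, pt, g, Bg, art', apt', ?_, drt, hBg0, hlip, dpt, fun t ht => ?_, fun t ht j => ?_⟩
  · refine (LipschitzOnWith.of_dist_le_mul (K := (‖ellDiff‖ * Bp).toNNReal)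
      fun s hs t ht => ?_).continuousOn
    rw [dist_eq_norm, Real.dist_eq, Real.coe_toNNReal _ hBd0]
    exact hlipr s hs t ht
  · have ht' := Ioo_subset_Icc_self ht
    exact hK (h.spectral _ (hIcc t ht')) ⟨hε0, hε1⟩ ha haL (θ t) _ _ (art t ht') (ag t ht')
  · have ht' := Ioo_subset_Icc_self ht
    rw [hdiff t ht']
    set X := ε * (j : ℝ) - ε * cSpeed α * t
    have e1 := (hP t ht').abs_base_sub_le (X + ε) X
    have e2 := (hP t ht').abs_flux_sub_le (X + ε) X
    rw [add_sub_cancel_left, abs_of_pos hε0] at e1 e2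
    refine (abs_sub _ _).trans ?_
    rw [abs_mul (cSpeed α * a), abs_mul (a ^ 2), abs_of_pos (by positivity : 0 < cSpeed α * a),
      abs_of_pos (by positivity : 0 < a ^ 2)]
    calc _ ≤ cSpeed α * a * (C * ε) + a * 1 * (C * ε) := by
          rw [pow_two]
          gcongr
      _ = _ := by ring

/-! ### Powers of the small parameter -/

section Powers

variable {α : ℝ}

lemma gammaExp_pos (hα : 5 / 4 < α) : 0 < gammaExp α := by
  unfold gammaExp
  split_ifs <;> linarith

lemma gammaExp_le (α : ℝ) : gammaExp α ≤ 2 * α - 5 / 2 ∧ gammaExp α ≤ 3 / 2 ∧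
    gammaExp α ≤ α - 1 / 2 := by
  unfold gammaExp
  split_ifs <;> refine ⟨?_, ?_, ?_⟩ <;> linarith

variable {ε : ℝ} (hε : ε ∈ Ioc (0 : ℝ) 1)
include hε

lemma rpow_sub_one_mul_self (α : ℝ) : ε ^ (α - 1) * ε = ε ^ α := by
  rw [Real.rpow_sub_one hε.1.ne', div_mul_cancel₀ _ hε.1.ne']

lemma amplitude_mul_div_sqrt_le (α : ℝ) : ε ^ (α - 1) * ε / √ε ≤ ε ^ gammaExp α := by
  rw [rpow_sub_one_mul_self hε, Real.sqrt_eq_rpow, ← Real.rpow_sub hε.1]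
  exact Real.rpow_le_rpow_of_exponent_ge hε.1 hε.2 (gammaExp_le α).2.2

lemma amplitude_sq_div_sqrt_le (α : ℝ) : (ε ^ (α - 1)) ^ 2 / √ε ≤ ε ^ gammaExp α := by
  rw [← Real.rpow_natCast, ← Real.rpow_mul hε.1.le, Real.sqrt_eq_rpow, ← Real.rpow_sub hε.1]
  refine Real.rpow_le_rpow_of_exponent_ge hε.1 hε.2 ?_
  have := (gammaExp_le α).1
  push_cast
  linarith

lemma residual_le (α : ℝ) : (ε ^ (α - 1) * ε ^ 3 + (ε ^ (α - 1)) ^ 3 * ε) / √ε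
    ≤ 2 * (ε ^ α * ε ^ gammaExp α) := by
  have h1 : ε ^ (α - 1) * ε ^ 3 / √ε ≤ ε ^ α * ε ^ gammaExp α := by
    have e : ε ^ (α - 1) * ε ^ 3 / √ε = ε ^ α * (ε ^ (2 : ℝ) / ε ^ (1 / 2 : ℝ)) := by
      rw [← rpow_sub_one_mul_self hε α, ← Real.sqrt_eq_rpow]
      norm_cast
      ring
    rw [e, ← Real.rpow_sub hε.1]
    refine mul_le_mul_of_nonneg_left ?_ (Real.rpow_nonneg hε.1.le _)
    refine Real.rpow_le_rpow_of_exponent_ge hε.1 hε.2 ?_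
    linarith [(gammaExp_le α).2.1]
  have h2 : (ε ^ (α - 1)) ^ 3 * ε / √ε ≤ ε ^ α * ε ^ gammaExp α := by
    have e : (ε ^ (α - 1)) ^ 3 * ε / √ε = ε ^ α * ((ε ^ (α - 1)) ^ 2 / √ε) := by
      rw [← rpow_sub_one_mul_self hε α]
      ring
    rw [e]
    exact mul_le_mul_of_nonneg_left (amplitude_sq_div_sqrt_le hε α) (Real.rpow_nonneg hε.1.le _)
  rw [add_div]
  linarith

end Powers

lemma exists_rpow_mul_le {γ : ℝ} (hγ : 0 < γ) (A : ℝ) :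
    ∃ δ ∈ Ioc (0 : ℝ) 1, ∀ ε ∈ Ioc 0 δ, A * ε ^ γ ≤ 1 / 4 := by
  have h1 : Filter.Tendsto (fun ε : ℝ => A * ε ^ γ) (nhds 0) (nhds (A * 0 ^ γ)) :=
    ((Real.continuousAt_rpow_const 0 γ (Or.inr hγ.le)).const_mul A)
  rw [Real.zero_rpow hγ.ne', mul_zero] at h1
  obtain ⟨δ, hδ, h⟩ := Metric.eventually_nhds_iff.1
    (h1.eventually_le_const (by norm_num : (0 : ℝ) < 1 / 4))
  refine ⟨min 1 (δ / 2), ⟨by positivity, min_le_left _ _⟩, fun ε hε => h ?_⟩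
  rw [Real.dist_eq, sub_zero, abs_of_pos hε.1]
  have := hε.2.trans (min_le_right _ _)
  linarith

lemma multOrder_avgMult_sub_one {h : ℝ} (hh : 0 ≤ h) : MultOrder 1 h fun k => avgMult h k - 1 where
  measurable := (continuous_avgMult h).measurable.sub measurable_const
  nonneg := hh
  le k := by
    have e : avgMult h k - 1 = (Complex.exp (Complex.I * ((h * k / 2 : ℝ) : ℂ)) - 1)
        * (Real.sinc (h * k / 2) : ℝ) + ((Real.sinc (h * k / 2) - 1 : ℝ) : ℂ) := by
      have : Complex.I * (k * h / 2) = Complex.I * ((h * k / 2 : ℝ) : ℂ) := by push_cast; ring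
      rw [avgMult, this]
      push_cast
      ring
    obtain ⟨y, hy⟩ : ∃ y, y = h * k / 2 := ⟨_, rfl⟩
    have h1 : ‖Complex.exp (Complex.I * (y : ℂ)) - 1‖ ≤ |y| :=
      Real.norm_exp_I_mul_ofReal_sub_one_le
    have h2 : |Real.sinc y - 1| ≤ |y| := by
      rw [abs_sub_comm]
      have h3 := abs_one_sub_sinc_le y
      have h4 : |1 - Real.sinc y| ≤ 2 := by
        have := abs_sinc_le_one y
        rw [abs_le] at this ⊢
        constructor <;> linarith
      rcases le_total |y| 2 with h5 | h5
      · refine h3.trans ?_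
        rw [← sq_abs]
        nlinarith [abs_nonneg y]
      · linarith
    have h6 : |y| = h * |k| / 2 := by
      rw [hy, abs_div, abs_mul, abs_of_nonneg hh, abs_two]
    rw [e, ← hy]
    refine (norm_add_le _ _).trans ?_
    rw [norm_mul, Complex.norm_real, Complex.norm_real, Real.norm_eq_abs, Real.norm_eq_abs, pow_one]
    have h7 := mul_le_mul h1 (abs_sinc_le_one y) (abs_nonneg _) (abs_nonneg y)
    have h8 := mul_le_mul_of_nonneg_left (abs_le_jap k) hh
    linarith

lemma SpectralBound.sampleBound_avg_sub {L : ℝ} {v : ℝ → ℂ} (hv : SpectralBound L v) {ε : ℝ}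
    (hε : 0 ≤ ε) (a : ℝ) :
    SampleBound (|a| * (4 * ε * L)) fun X => strainProfile a ε v X + a * baseSynth v X := by
  have h1 := (hv.sampleBound ((multOrder_avgMult_sub_one hε).isMult (by norm_num))).const_mul (-a)
  rw [abs_neg] at h1
  refine h1.of_abs_le fun X => le_of_eq (congrArg _ ?_)
  rw [← hv.multSynth_sub ((multOrder_avgMult ε).isMult (by norm_num)) (MultOrder.one.isMult (by norm_num)),
    strainProfile, avgSynth, baseSynth]
  ring

lemma norm_le_of_half_sq_add_le {c x y Z b : ℝ} (hc : 0 < c) (hb : 0 ≤ b)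
    (hZ : 0 ≤ Z) (h : 1 / 2 * x ^ 2 + c / 2 * y ^ 2 ≤ Z * b ^ 2) :
    x ≤ √(2 * Z) * b ∧ y ≤ √(2 * Z / c) * b := by
  constructor
  · refine abs_le_of_sq_le_sq' ?_ (by positivity) |>.2
    rw [mul_pow, Real.sq_sqrt (by positivity)]
    nlinarith [mul_nonneg hc.le (sq_nonneg y)]
  · refine abs_le_of_sq_le_sq' ?_ (by positivity) |>.2
    rw [mul_pow, Real.sq_sqrt (by positivity), div_mul_eq_mul_div, le_div_iff₀ hc]
    nlinarith [sq_nonneg x]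

/-! ### The approximation theorem -/

/-- A bound for the error of the approximation, depending only on the bounds for the solution of the
Benjamin-Ono equation. -/
def errorBound (α τ₀ L C K c C' L' : ℝ) : ℝ :=
  (1 / 2 * (1 + C) ^ 2 + C' / 2 * zetaSum α * (1 + 4 * L) ^ 2 + 2 * K ^ 2 * τ₀)
    * Real.exp ((2 * L' * ((cSpeed α + 1) * C) / c + 1) * τ₀)

/-- Solutions of the equations with truncated force that start within `O(b)` of an approximate
solution whose residual is `O(a ε b)` stay within `O(b)` of it up to the time `τ₀ / (a ε)`. -/
lemma IsApproximation.dist_le {α a ε L C K T τ₀ b c C' L' Z B : ℝ} {hα : α ∈ Ioo (1 : ℝ) 3}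
    {v : ℝ → ℝ → ℂ} {rt pt g : ℝ → EllTwo} (hA : IsApproximation α a ε L C K T hα v rt pt g B)
    (hc : c = α * (α + 1) * (1 / 2 : ℝ) ^ (α + 2))
    (hC' : C' = α * (α + 1) * (1 / 2 : ℝ) ^ (-(α + 2)))
    (hL' : L' = α * (α + 1) * ((α + 2) * (1 / 2 : ℝ) ^ (-(α + 2 + 1))))
    (hZ : Z = errorBound α τ₀ L C K c C' L') (hε0 : 0 < ε) (ha0 : 0 < a) (hb0 : 0 < b)
    (hL0 : 0 ≤ L) (hC0 : 0 ≤ C) (hK0 : 0 ≤ K) (hT0 : 0 < T) (hTτ : a * ε * T = τ₀)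
    (hres : (a * ε ^ 3 + a ^ 3 * ε) / √ε ≤ 2 * (a * ε * b)) {r p : ℝ → EllTwo}
    (hr : ∀ t ∈ Icc (-T) T, HasDerivWithinAt r (ellDiff (p t)) (Icc (-T) T) t)
    (hp : ∀ t ∈ Icc (-T) T, HasDerivWithinAt p
      ((isForce_cmForce (zero_lt_one.trans hα.1) half_mem).accel α (r t)) (Icc (-T) T) t)
    (i1 : ‖p 0 - pt 0‖ ≤ (1 + C) * b) (i2 : ‖r 0 - rt 0‖ ≤ (1 + 4 * L) * b) {t : ℝ}
    (ht : t ∈ Icc (-T) T) :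
    ‖p t - pt t‖ ≤ √(2 * Z) * b ∧ ‖r t - rt t‖ ≤ √(2 * Z / c) * b := by
  have hf := isForce_cmForce (zero_lt_one.trans hα.1) half_mem
  have hc0 : 0 < c := by rw [hc]; exact hf.pos
  have hC'0 : 0 < C' := by rw [hC']; exact hf.C_pos
  have hL'0 : 0 ≤ L' := by rw [hL']; exact hf.L_nonneg
  have hζ := one_le_zetaSum hα.1
  have hcs := cSpeed_pos hα.1
  have haε0 : 0 < a * ε := by positivity
  have hτ₀ : 0 < τ₀ := by rw [← hTτ]; positivity
  have hZ0 : 0 ≤ Z := by rw [hZ, errorBound]; positivity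
  have hst := hf.stability hα.1 hr hp hA.continuousOn hA.hasDerivAt_strain hA.nonneg hA.lipschitz
    hA.hasDerivAt_velocity hA.residual (by positivity) hA.rate_le haε0 ht
  rw [← hc, ← hC', ← hL'] at hst
  have i3 : (K * (a * ε ^ 3 + a ^ 3 * ε) / √ε) ^ 2 / (2 * (a * ε)) * T ≤ 2 * K ^ 2 * τ₀ * b ^ 2 := by
    have h1 : K * (a * ε ^ 3 + a ^ 3 * ε) / √ε ≤ K * (2 * (a * ε * b)) := by
      rw [mul_div_assoc]
      gcongr
    have h2 : 0 ≤ K * (a * ε ^ 3 + a ^ 3 * ε) / √ε := by positivity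
    calc _ ≤ (K * (2 * (a * ε * b))) ^ 2 / (2 * (a * ε)) * T := by gcongr
      _ = 2 * K ^ 2 * (a * ε * T) * b ^ 2 := by field_simp
      _ = _ := by rw [hTτ]
  have i4 : (2 * L' * ((cSpeed α + 1) * C * (a * ε)) / c + a * ε) * T
      = (2 * L' * ((cSpeed α + 1) * C) / c + 1) * τ₀ := by
    rw [← hTτ]; ring
  refine norm_le_of_half_sq_add_le hc0 hb0.le hZ0 (hst.trans ?_)
  have e : Z * b ^ 2 = (1 / 2 * (1 + C) ^ 2 + C' / 2 * zetaSum α * (1 + 4 * L) ^ 2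
      + 2 * K ^ 2 * τ₀) * b ^ 2 * Real.exp ((2 * L' * ((cSpeed α + 1) * C) / c + 1) * τ₀) := by
    rw [hZ, errorBound]
    ring
  rw [i4, e]
  refine mul_le_mul_of_nonneg_right ?_ (Real.exp_pos _).le
  have j1 := pow_le_pow_left₀ (norm_nonneg _) i1 2
  have j2 := pow_le_pow_left₀ (norm_nonneg _) i2 2
  have j3 := mul_le_mul_of_nonneg_left j2 (by positivity : 0 ≤ C' / 2 * zetaSum α)
  rw [mul_pow] at j1 j3
  linarith

/-- The approximate solution differs by `O(b)` from the samples of the solution of the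
Benjamin-Ono equation, to leading order in the amplitude. -/
lemma BOCurve.exists_samples {α τ₀ L C K T a b ε B : ℝ} {hα : α ∈ Ioo (1 : ℝ) 3} {v : ℝ → ℝ → ℂ}
    {u : ℝ → ℝ → ℝ} (hv : BOCurve α τ₀ L v)
    (huv : ∀ τ ∈ Icc (-τ₀) τ₀, ∀ X, u X τ = baseSynth (v τ) X)
    (hC : ∀ v, SpectralBound L v → BOProfile α C v)
    {rt pt g : ℝ → EllTwo} (hA : IsApproximation α a ε L C K T hα v rt pt g B)
    (hε : ε ∈ Ioc (0 : ℝ) 1) (ha0 : 0 < a) (hT0 : 0 < T) (hTτ : a * ε * T = τ₀)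
    (e1 : a * ε / √ε ≤ b) (e2 : a ^ 2 / √ε ≤ b) :
    ∃ w : ℝ → EllTwo, ∀ t ∈ Icc (-T) T,
      (∀ j : ℤ, w t j = u (ε * (j - cSpeed α * t)) (a * ε * t)) ∧
      ‖rt t + a • w t‖ ≤ 4 * L * b ∧ ‖pt t - (cSpeed α * a) • w t‖ ≤ C * b ∧
      ∀ j, |rt t j| ≤ a * (4 * L) := by
  have hε0 := hε.1
  have haε0 : 0 < a * ε := by positivity
  have hIcc : ∀ t ∈ Icc (-T) T, a * ε * t ∈ Icc (-τ₀) τ₀ := fun t ht => by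
    constructor <;> nlinarith [ht.1, ht.2]
  have h0T : (0 : ℝ) ∈ Icc (-T) T := ⟨by linarith, hT0.le⟩
  have hL0 : 0 ≤ L := (hv.spectral _ (hIcc 0 h0T)).nonneg
  have hC0 : 0 ≤ C := (hv.profile hC (hIcc 0 h0T)).base.nonneg
  have hw : ∀ t ∈ Icc (-T) T, ∀ j : ℤ,
      sampleTwo ε (-(ε * cSpeed α * t)) (baseSynth (v (a * ε * t))) j
        = u (ε * (j - cSpeed α * t)) (a * ε * t) := fun t ht j => by
    rw [(hv.profile hC (hIcc t ht)).base.sampleTwo_apply hε]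
    refine Eq.trans ?_ (huv _ (hIcc t ht) _).symm
    congr 1
    ring
  refine ⟨fun t => sampleTwo ε (-(ε * cSpeed α * t)) (baseSynth (v (a * ε * t))),
    fun t ht => ⟨hw t ht, ?_, ?_, fun j => ?_⟩⟩
  · set w := sampleTwo ε (-(ε * cSpeed α * t)) (baseSynth (v (a * ε * t)))
    have h1 := ((hv.spectral _ (hIcc t ht)).sampleBound_avg_sub hε.1.le a).norm_le_of_apply hε
      (θ := -(ε * cSpeed α * t)) (x := rt t + a • w) (fun j => by
        have : (rt t + a • w) j = rt t j + a * w j := rfl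
        rw [this, hA.strain_apply t ht,
          (hv.profile hC (hIcc t ht)).base.sampleTwo_apply hε]
        ring_nf)
    refine h1.trans ?_
    rw [abs_of_pos ha0]
    calc _ = 4 * L * (a * ε / √ε) := by ring
      _ ≤ _ := by gcongr
  · set w := sampleTwo ε (-(ε * cSpeed α * t)) (baseSynth (v (a * ε * t)))
    have h1 := ((hv.profile hC (hIcc t ht)).flux.const_mul (-a ^ 2)).norm_le_of_apply hε
      (θ := -(ε * cSpeed α * t)) (x := pt t - (cSpeed α * a) • w) (fun j => by
        have : (pt t - (cSpeed α * a) • w) j = pt t j - cSpeed α * a * w j := rfl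
        rw [this, hA.velocity_apply t ht,
          (hv.profile hC (hIcc t ht)).base.sampleTwo_apply hε, velocityProfile]
        ring_nf)
    refine h1.trans ?_
    rw [abs_neg, abs_of_pos (by positivity : 0 < a ^ 2)]
    calc _ = C * (a ^ 2 / √ε) := by ring
      _ ≤ _ := by gcongr
  · rw [hA.strain_apply t ht]
    refine (((hv.spectral _ (hIcc t ht)).sampleBound_strain a ε).abs_le _).trans ?_
    rw [abs_of_pos ha0]

end

theorem theorem1p1 :
    ∃ αstar ∈ Ioo (1.45 : ℝ) 1.5, ∀ α ∈ Ioo αstar 3,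
      ∀ (τ₀ : ℝ) (u : ℝ → ℝ → ℝ), 0 < τ₀ → IsBOSolution α τ₀ u →
        (∃ M : ℝ, ∀ τ ∈ Icc (-τ₀) τ₀,
          MemHs 6 (fun X => u X τ) ∧ hsNorm 6 (fun X => u X τ) ≤ M) →
        ∃ C₁ C₂ εstar : ℝ, 0 < C₁ ∧ 0 < C₂ ∧ 0 < εstar ∧ ∀ ε ∈ Ioc 0 εstar,
          ∀ x₀ p₀ : ℤ → ℝ,
            (∃ μ₀ ν₀ : EllTwo,
              (∀ j : ℤ,
                x₀ (j + 1) - x₀ j - 1 = -ε ^ (α - 1) * u (ε * j) 0 + μ₀ j ∧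
                p₀ j = cSpeed α * ε ^ (α - 1) * u (ε * j) 0 + ν₀ j) ∧
              ‖μ₀‖ ≤ C₁ * ε ^ gammaExp α ∧ ‖ν₀‖ ≤ C₁ * ε ^ gammaExp α) →
            ∃ x p : ℤ → ℝ → ℝ,
              -- existence and uniqueness of the solution on the time interval
              (IsCMSolution α (τ₀ / ε ^ α) x p ∧ ∀ j, x j 0 = x₀ j ∧ p j 0 = p₀ j) ∧
              (∀ y q : ℤ → ℝ → ℝ, IsCMSolution α (τ₀ / ε ^ α) y q →
                (∀ j, y j 0 = x₀ j ∧ q j 0 = p₀ j) →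
                ∀ t ∈ Icc (-(τ₀ / ε ^ α)) (τ₀ / ε ^ α), ∀ j,
                  y j t = x j t ∧ q j t = p j t) ∧
              -- the approximation and its error
              ∃ μ ν : ℝ → EllTwo, ∀ t ∈ Icc (-(τ₀ / ε ^ α)) (τ₀ / ε ^ α),
                (∀ j : ℤ,
                  x (j + 1) t - x j t - 1
                    = -ε ^ (α - 1) * u (ε * (j - cSpeed α * t)) (ε ^ α * t) + μ t j ∧
                  p j t
                    = cSpeed α * ε ^ (α - 1) * u (ε * (j - cSpeed α * t)) (ε ^ α * t) + ν t j) ∧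
                ‖μ t‖ ≤ C₂ * ε ^ gammaExp α ∧ ‖ν t‖ ≤ C₂ * ε ^ gammaExp α := by
  -- the argument needs only `γ_α > 0`, that is `α > 5 / 4`, so any threshold in the interval will do
  refine ⟨1.49, by norm_num, fun α hα' τ₀ u hτ₀ hu hM => ?_⟩
  have hα : α ∈ Ioo (1 : ℝ) 3 := ⟨by linarith [hα'.1], hα'.2⟩
  have hγ : 0 < gammaExp α := gammaExp_pos (by linarith [hα'.1])
  obtain ⟨L, hL⟩ := hM
  obtain ⟨v, hv, huv⟩ := hu.exists_boCurve hα hL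
  obtain ⟨C, hC⟩ := exists_boProfile hα L
  obtain ⟨K, hK0, hK⟩ := exists_residual_bound hα hC
  have h0τ : (0 : ℝ) ∈ Icc (-τ₀) τ₀ := ⟨by linarith, hτ₀.le⟩
  have hL0 : 0 ≤ L := (hv.spectral 0 h0τ).nonneg
  have hC0 : 0 ≤ C := (hv.profile hC h0τ).base.nonneg
  have hf := isForce_cmForce (zero_lt_one.trans hα.1) half_mem
  obtain ⟨c, hc⟩ : ∃ c, c = α * (α + 1) * (1 / 2 : ℝ) ^ (α + 2) := ⟨_, rfl⟩
  obtain ⟨C', hC'⟩ : ∃ C', C' = α * (α + 1) * (1 / 2 : ℝ) ^ (-(α + 2)) := ⟨_, rfl⟩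
  obtain ⟨L', hL'⟩ : ∃ L', L' = α * (α + 1) * ((α + 2) * (1 / 2 : ℝ) ^ (-(α + 2 + 1))) := ⟨_, rfl⟩
  have hc0 : 0 < c := by rw [hc]; exact hf.pos
  have hC'0 : 0 < C' := by rw [hC']; exact hf.C_pos
  have hL'0 : 0 ≤ L' := by rw [hL']; exact hf.L_nonneg
  have hζ := one_le_zetaSum hα.1
  have hcs := cSpeed_pos hα.1
  obtain ⟨Z, hZ⟩ : ∃ Z, Z = errorBound α τ₀ L C K c C' L' := ⟨_, rfl⟩
  have hZ0 : 0 ≤ Z := by rw [hZ, errorBound]; positivity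
  obtain ⟨Y, hY⟩ : ∃ Y, Y = √(2 * Z) + √(2 * Z / c) := ⟨_, rfl⟩
  have hY0 : 0 ≤ Y := by rw [hY]; positivity
  obtain ⟨δ₁, hδ₁, hsmall₁⟩ := exists_rpow_mul_le hγ Y
  obtain ⟨δ₂, hδ₂, hsmall₂⟩ := exists_rpow_mul_le (show 0 < α - 1 by linarith [hα.1]) (4 * L)
  refine ⟨1, Y + 4 * L + C + 1, min δ₁ δ₂, one_pos, by positivity, lt_min hδ₁.1 hδ₂.1,
    fun ε hε' x₀ p₀ hinit => ?_⟩
  obtain ⟨μ₀, ν₀, hinit, hμ₀, hν₀⟩ := hinit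
  have hε : ε ∈ Ioc (0 : ℝ) 1 := ⟨hε'.1, (hε'.2.trans (min_le_left _ _)).trans hδ₁.2⟩
  have hs₁ := hsmall₁ ε ⟨hε'.1, hε'.2.trans (min_le_left _ _)⟩
  have hs₂ := hsmall₂ ε ⟨hε'.1, hε'.2.trans (min_le_right _ _)⟩
  obtain ⟨a, ha⟩ : ∃ a, a = ε ^ (α - 1) := ⟨_, rfl⟩
  obtain ⟨b, hb⟩ : ∃ b, b = ε ^ gammaExp α := ⟨_, rfl⟩
  have haε : a * ε = ε ^ α := ha ▸ rpow_sub_one_mul_self hε α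
  have ha0 : 0 < a := ha ▸ Real.rpow_pos_of_pos hε.1 _
  have hb0 : 0 < b := hb ▸ Real.rpow_pos_of_pos hε.1 _
  have e1 : a * ε / √ε ≤ b := by rw [ha, hb]; exact amplitude_mul_div_sqrt_le hε α
  have e2 : a ^ 2 / √ε ≤ b := by rw [ha, hb]; exact amplitude_sq_div_sqrt_le hε α
  have e3 : (a * ε ^ 3 + a ^ 3 * ε) / √ε ≤ 2 * (a * ε * b) := by
    rw [haε, ha, hb]; exact residual_le hε α
  rw [← ha] at hs₂
  rw [← hb] at hs₁ hμ₀ hν₀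
  obtain ⟨rt, pt, g, B, hA⟩ := hv.exists_approximation hα hτ₀ hC hK hε ha (by linarith)
  obtain ⟨T, hT⟩ : ∃ T, T = τ₀ / (a * ε) := ⟨_, rfl⟩
  simp only [← ha, ← hb, ← haε, ← hT] at hinit ⊢
  rw [← hT] at hA
  have hε0 := hε.1
  have haε0 : 0 < a * ε := by positivity
  have hT0 : 0 < T := by rw [hT]; positivity
  have hTτ : a * ε * T = τ₀ := by rw [hT]; field_simp
  have h0T : (0 : ℝ) ∈ Icc (-T) T := ⟨by linarith, hT0.le⟩
  obtain ⟨w, hw⟩ := hv.exists_samples huv hC hA hε ha0 hT0 hTτ e1 e2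
  -- the solution of the lattice equations with truncated force
  set r₀ : EllTwo := μ₀ - a • w 0 with hr₀
  set q₀ : EllTwo := ν₀ + (cSpeed α * a) • w 0 with hq₀
  have hw0 : ∀ j : ℤ, w 0 j = u (ε * j) 0 := fun j => by
    rw [(hw 0 h0T).1]; simp
  have hr₀j : ∀ j, r₀ j = x₀ (j + 1) - x₀ j - 1 := fun j => by
    have : r₀ j = μ₀ j - a * w 0 j := rfl
    rw [this, (hinit j).1, hw0]
    ring
  have hq₀j : ∀ j, q₀ j = p₀ j := fun j => by
    have : q₀ j = ν₀ j + cSpeed α * a * w 0 j := rfl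
    rw [this, (hinit j).2, hw0]
    ring
  obtain ⟨Λ, hΛ⟩ := hf.exists_lipschitzWith_field α
  obtain ⟨z, hz0, hz⟩ := exists_solution_of_lipschitzWith hΛ (r₀, q₀) hT0.le
  have hr : ∀ t ∈ Icc (-T) T, HasDerivWithinAt (fun t => (z t).1) (ellDiff (z t).2) (Icc (-T) T) t :=
    fun t ht => (ContinuousLinearMap.fst ℝ EllTwo EllTwo).hasFDerivAt.comp_hasDerivWithinAt t (hz t ht)
  have hp : ∀ t ∈ Icc (-T) T, HasDerivWithinAt (fun t => (z t).2) (hf.accel α (z t).1)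
      (Icc (-T) T) t :=
    fun t ht => (ContinuousLinearMap.snd ℝ EllTwo EllTwo).hasFDerivAt.comp_hasDerivWithinAt t (hz t ht)
  -- comparison with the approximate solution
  have hclose : ∀ t ∈ Icc (-T) T,
      ‖(z t).2 - pt t‖ ≤ √(2 * Z) * b ∧ ‖(z t).1 - rt t‖ ≤ √(2 * Z / c) * b := by
    intro t ht
    refine hA.dist_le hc hC' hL' hZ hε.1 ha0 hb0 hL0 hC0 hK0 hT0 hTτ e3 hr hp ?_ ?_ ht
    · have : (z 0).2 - pt 0 = ν₀ - (pt 0 - (cSpeed α * a) • w 0) := by rw [hz0]; module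
      rw [this]
      refine (norm_sub_le _ _).trans ?_
      have := (hw 0 h0T).2.2.1
      linarith
    · have : (z 0).1 - rt 0 = μ₀ - (rt 0 + a • w 0) := by rw [hz0]; module
      rw [this]
      refine (norm_sub_le _ _).trans ?_
      have := (hw 0 h0T).2.1
      linarith
  have hzone : ∀ t ∈ Icc (-T) T, ∀ j, 1 + (z t).1 j ∈ Icc (1 / 2 : ℝ) (1 / 2)⁻¹ := by
    intro t ht j
    refine one_add_mem_Icc ?_
    have h1 := lp_two_abs_apply_le ((z t).1 - rt t) j
    have h2 : ((z t).1 - rt t) j = (z t).1 j - rt t j := rfl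
    rw [h2] at h1
    have h3 : √(2 * Z / c) * b ≤ Y * b := by
      rw [hY]
      gcongr
      linarith [Real.sqrt_nonneg (2 * Z)]
    have h4 := abs_sub_abs_le_abs_sub ((z t).1 j) (rt t j)
    linarith [(hw t ht).2.2.2 j, (hclose t ht).2]
  obtain ⟨x, hx, hx0, hrx⟩ := exists_isCMSolution hα.1 half_mem hT0 hr hp hzone (x₀ := x₀) (fun j => by
    rw [hz0]; exact hr₀j j)
  have hp0 : ∀ j, (z 0).2 j = p₀ j := fun j => by rw [hz0]; exact hq₀j j
  refine ⟨x, fun j t => (z t).2 j, ⟨hx, fun j => ⟨hx0 j, hp0 j⟩⟩, fun y q hyq hyq0 t ht j => ?_,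
    fun t => (z t).1 + a • w t, fun t => (z t).2 - (cSpeed α * a) • w t, fun t ht => ⟨fun j => ?_, ?_, ?_⟩⟩
  · exact hx.unique hα.1 hT0 hyq (fun j => by rw [(hyq0 j).1, (hyq0 j).2, hx0, hp0]; exact ⟨rfl, rfl⟩)
      ht j
  · have h1 : ((z t).1 + a • w t) j = (z t).1 j + a * w t j := rfl
    have h2 : ((z t).2 - (cSpeed α * a) • w t) j = (z t).2 j - cSpeed α * a * w t j := rfl
    rw [h1, h2, ← hrx t ht, (hw t ht).1]
    constructor <;> ring
  · have h1 : (z t).1 + a • w t = ((z t).1 - rt t) + (rt t + a • w t) := by abel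
    have h2 := norm_add_le ((z t).1 - rt t) (rt t + a • w t)
    rw [← h1] at h2
    have h3 := (hclose t ht).2
    have h4 := (hw t ht).2.1
    have h5 : √(2 * Z / c) * b + 4 * L * b ≤ (Y + 4 * L + C + 1) * b := by
      rw [← add_mul, hY]
      refine mul_le_mul_of_nonneg_right ?_ hb0.le
      linarith [Real.sqrt_nonneg (2 * Z)]
    linarith
  · have h1 : (z t).2 - (cSpeed α * a) • w t = ((z t).2 - pt t) + (pt t - (cSpeed α * a) • w t) := by
      abel
    have h2 := norm_add_le ((z t).2 - pt t) (pt t - (cSpeed α * a) • w t)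
    rw [← h1] at h2
    have h3 := (hclose t ht).1
    have h4 := (hw t ht).2.2.1
    have h5 : √(2 * Z) * b + C * b ≤ (Y + 4 * L + C + 1) * b := by
      rw [← add_mul, hY]
      refine mul_le_mul_of_nonneg_right ?_ hb0.le
      linarith [Real.sqrt_nonneg (2 * Z / c)]
    linarith
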